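/- Let $K$ be a field of characteristic $0$ and let $W=\langle w_1\mid w_2,w_3\rangle$ with $w_1$ odd and $w_2,w_3$ even. Let $L=\prod_{n\ge1}\mathrm{Hom}(S^n(W),W)$, with the graded bracket of coderivations of $S(W)$. For a multi-index $I=(i_1,i_2,i_3)$ let $\varphi^I_j\in L$ be given by $\varphi^I_j(w_J)=I!\,\delta^I_J\,w_j$; it is written $\psi^I_j$ if it is odd. Put $d=\psi^{0,1,1}_1$ and $D(\varphi)=[\varphi,d]$. Conventions. Formal sums of cochains are allowed. A formal base is a supercommutative augmented $K$-algebra $B$ with maximal ideal $\mathfrak m$ that is the inverse limit of its quotients by the closed powers of $\mathfrak m$, i.e. by graded ideals $F_n$ with $F_0=B$, $F_1=\mathfrak m$, $F_iF_j\subseteq F_{i+j}$, $F_n=\mathfrak m^n+F_{n+1}$; it is infinitesimal if $\mathfrak m^2=0$. Morphisms are even, augmented and continuous ($f(F_n)\subseteq F_n$). A deformation of $d$ with base $B$ is an odd element $\tilde d$ of $L\hat\otimes B$ with $[\tilde d,\tilde d]=0$ that the augmentation maps to $d$. Two deformations are equivalent if $\exp(\mathrm{ad}\,\varphi)$ maps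 one to the other for some even $\varphi\in L\hat\otimes\mathfrak m$. A deformation $d^\infty$ with formal base $A$ is miniversal if for each deformation $d^f$ with formal base $B$ there is a morphism $f:A\to B$ with $f_*(d^\infty)\sim d^f$, and this $f$ is unique whenever $B$ is infinitesimal. **(1) Cohomology.** $[d,d]=0$, and the cocycles $$\psi_1=\psi^{0,0,1}_1,\quad \psi_2=\psi^{0,1,0}_1,\quad \phi_n=\varphi^{1,0,n}_1+\varphi^{0,0,n+1}_3,\quad \sigma_n=\varphi^{1,n,0}_1+\varphi^{0,n+1,0}_2\qquad(n\ge0)$$ represent a basis of the cohomology of $D$: every cocycle is, modulo coboundaries, a formal sum of them with unique coefficients. In the grading by degree, $H^1=\langle\psi_1,\psi_2,\phi_0,\sigma_0\rangle$ and $H^n=\langle\phi_{n-1},\sigma_{n-1}\rangle$ for $n>1$, and these classes form bases. **(2) Coefficients.** Let $t^1,t^2$ be even and $\theta^n,\eta^n$ $(n\ge0)$ odd parameters. Let $K[[t^1,t^2,\theta^n,\eta^n]]$ be the ring of formal sums $\sum_n f_n$ with $f_n$ a homogeneous polynomial of degree $n$. In this ring there are unique families $r^k,s^k,y^k$ $(k\ge1)$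 and $u^{k,l},v^{k,l}$ $(k,l\ge0)$ such that, with $y^0=0$, $$r^k=t^1\eta^{k+1}-t^1r^{k+1}=\sum_{n\ge0}(-1)^n(t^1)^{n+1}\eta^{k+n+1},$$ $$s^1=t^2\theta^1+t^1\eta^1-t^1r^1,\qquad s^k=t^2\theta^k\quad(k>1),$$ $$y^k=-t^1s^{k+1}-t^2y^{k+1}=-t^1t^2\sum_{n\ge0}(-1)^n(t^2)^n\theta^{n+k+1},$$ $$u^{k,l}=-\Big(\big((k+2)\eta^{k+1}-(l+1)r^{k+1}\big)y^{l+1}+t^1u^{k+1,l}+t^2u^{k,l+1}\Big),$$ $$v^{k,0}=0,\qquad v^{k,l}=-\Big(l\,\theta^lr^{k+1}-\eta^{k+2}y^l+l\,r^{k+2}y^l-t^1u^{k+2,l-1}+t^1v^{k+1,l}\Big)\quad(l\ge1).$$ **(3) Miniversal deformation.** Let $\gamma_k=\varphi^{0,k,1}_3$, $\epsilon_k=\varphi^{0,0,k}_3$, $\beta_k=\varphi^{0,0,k}_2$ $(k\ge1)$, $\tau_{k,l}=\psi^{1,k,l}_2$, $\xi_{k,l}=\psi^{1,k,l}_3$ $(k,l\ge0)$,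 and $d^1=d+\psi_1t^1+\psi_2t^2+\phi_n\theta^n+\sigma_n\eta^n$ (repeated indices are summed). Then $$d^\infty=d^1+\gamma_kr^k+\epsilon_ks^k+\beta_ky^k+\tau_{k,l}u^{k,l}+\xi_{k,l}v^{k,l}$$ is a miniversal deformation of $d$. Its base is the formal base $K[[t^1,t^2,\theta^n,\eta^n]]/(R)$, where $(R)$ is the closed graded ideal generated by the two odd relations $$t^2\theta^0=0,\qquad -t^1\eta^0+t^1s^1+t^2y^1=0$$ and the two families of even relations, for $n\ge0$, $$-\eta^1y^n+n\,r^1y^n-t^1u^{1,n-1}+t^1v^{0,n}+\sum_{k+l=n}\Big(\tfrac12(k-l)\theta^k\theta^l+k\,\theta^ks^{l+1}\Big)=0\qquad(u^{1,-1}:=0),$$ $$t^2u^{n,0}+\tfrac12\sum_{k+l=n}(k-l)\eta^k\eta^l=0.$$ -/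

import Mathlib

universe u v

noncomputable section

namespace SuperDeform

/-! ### Augmented filtered superalgebras and formal bases

Over a field of characteristic zero a `ℤ/2`-grading is the same thing as an involution: the even
(odd) part is the `+1` (`-1`) eigenspace of the parity involution `inv`. -/

/-- The data carried by a base of a deformation: the parity involution, the augmentation,
and a decreasing filtration. -/
structure BaseData (K : Type u) (B : Type v) [Field K] [Ring B] [Algebra K B] where
  inv : B →ₐ[K] B
  aug : B →ₐ[K] K
  fil : ℕ → Submodule K B

/-- The ground field as a (purely even) base. -/
def groundBase (K : Type u) [Field K] : BaseData K K where
  inv := AlgHom.id K K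
  aug := AlgHom.id K K
  fil := fun n => if n = 0 then ⊤ else ⊥

section Base

variable {K : Type u} [Field K] {B : Type v} [Ring B] [Algebra K B]

/-- The maximal ideal, i.e. the kernel of the augmentation. -/
def BaseData.maxIdeal (b : BaseData K B) : Submodule K B := LinearMap.ker b.aug.toLinearMap

/-- A formal base: a supercommutative augmented algebra `B`, with maximal ideal `m`, that is the
inverse limit of its quotients `B / fil n`, where `fil n` is the closed `n`-th power of `m`, that is
`fil 1 = m` and `fil n = m ^ n + fil (n + 1)` for all `n` (so `fil n` is `m ^ n` up to terms of
arbitrarily high order; a supercommutative `B` that is the inverse limit of the `B / m ^ n` is the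
case `fil n = m ^ n`). -/
structure BaseData.IsFormal (b : BaseData K B) : Prop where
  inv_inv : ∀ x, b.inv (b.inv x) = x
  even_comm : ∀ x y, b.inv x = x → x * y = y * x
  odd_anticomm : ∀ x y, b.inv x = -x → b.inv y = -y → x * y = -(y * x)
  aug_inv : ∀ x, b.aug (b.inv x) = b.aug x
  fil_inv : ∀ n, ∀ x ∈ b.fil n, b.inv x ∈ b.fil n
  fil_zero : b.fil 0 = ⊤
  fil_one : b.fil 1 = b.maxIdeal
  fil_mul : ∀ i j, b.fil i * b.fil j ≤ b.fil (i + j)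
  fil_eq : ∀ n, b.fil n = b.maxIdeal ^ n ⊔ b.fil (n + 1)
  separated : ∀ x, (∀ n, x ∈ b.fil n) → x = 0
  complete : ∀ s : ℕ → B, (∀ n, s (n + 1) - s n ∈ b.fil n) → ∃ x, ∀ n, x - s n ∈ b.fil n

/-- An infinitesimal base: the square of the maximal ideal vanishes. -/
def BaseData.IsInfinitesimal (b : BaseData K B) : Prop :=
  b.IsFormal ∧ ∀ x ∈ b.maxIdeal, ∀ y ∈ b.maxIdeal, x * y = 0

/-- Morphisms of bases: even, continuous, augmented algebra homomorphisms. -/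
structure IsBaseHom {A : Type*} [Ring A] [Algebra K A] (a : BaseData K A) (b : BaseData K B)
    (f : A →ₐ[K] B) : Prop where
  map_inv : ∀ x, f (a.inv x) = b.inv (f x)
  map_aug : ∀ x, b.aug (f x) = a.aug x
  map_fil : ∀ n, ∀ x ∈ a.fil n, f x ∈ b.fil n

end Base

/-! ### Cochains: `L = Hom(S(W), W)` for `W = ⟨w₁ | w₂, w₃⟩`, with `w₁` odd and `w₂`, `w₃` even

The basis vectors `w₁`, `w₂`, `w₃` are indexed by `0`, `1`, `2 : Fin 3`.  A multi-index `I` stands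
for `w_I = w₁ ^ I 0 * w₂ ^ I 1 * w₃ ^ I 2`. -/

/-- The multi-indices of the basis monomials of the reduced symmetric coalgebra of `W`. -/
def IsMonomial (I : Fin 3 →₀ ℕ) : Prop := I 0 ≤ 1 ∧ I ≠ 0

/-- The type of multi-indices of positive degree. -/
def MIdx : Type := {I : Fin 3 →₀ ℕ // IsMonomial I}

/-- The multi-index `(a, p, q)`. -/
def mi (a p q : ℕ) : Fin 3 →₀ ℕ :=
  Finsupp.single 0 a + Finsupp.single 1 p + Finsupp.single 2 q

/-- The degree of a multi-index. -/
def deg (I : Fin 3 →₀ ℕ) : ℕ := I 0 + I 1 + I 2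

/-- The parity of `φ^I_j` (`0` for even, `1` for odd), where `φ^I_j (w_J) = I! δ^I_J w_j`. -/
def par (I : Fin 3 →₀ ℕ) (j : Fin 3) : ℕ := (I 0 + if j = 0 then 1 else 0) % 2

/-- The completed tensor product of `L = ∏ₙ Hom(Sⁿ(W), W)` with `B`: the family `X` stands for the
formal sum of the `φ^I_j ⊗ X I j`. -/
abbrev Cochain (B : Type v) : Type v := MIdx → Fin 3 → B

open Classical in
/-- The coefficient of `φ^I_j` in `X`, which is `0` when `w_I` is not a basis monomial. -/
def Cochain.coef {B : Type v} [Zero B] (X : Cochain B) (I : Fin 3 →₀ ℕ) (j : Fin 3) : B :=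
  if h : IsMonomial I then X ⟨I, h⟩ j else 0

open Classical in
/-- The cochain `φ^I_j ⊗ c` (which is `0` when `w_I` is not a basis monomial). -/
def phi {B : Type v} [Zero B] (I : Fin 3 →₀ ℕ) (j : Fin 3) (c : B) : Cochain B :=
  fun M k => if M.1 = I ∧ k = j then c else 0

/-- Sum of a family of cochains, of which only finitely many are nonzero at each place. -/
def fsum {ι : Type*} {B : Type v} [AddCommMonoid B] (F : ι → Cochain B) : Cochain B :=
  fun M j => ∑ᶠ i, F i M j

section Bracket

variable {K : Type u} [Field K] {B : Type v} [Ring B] [Algebra K B]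

/-- The composition `X ∘ Ŷ : S(W) → W`, where `Ŷ` is the coderivation of `S(W)` that extends `Y`.
In terms of the divided monomials `e_M = w_M / M!` one has `φ^I_j (e_M) = δ^I_M w_j` and
`Ŷ (e_M) = ∑_{J + N = M} Y (e_J) · e_N`, with `w_k · e_N = (N k + 1) e_{N + 1_k}` (which is `0` if
this is not a basis monomial).
The coefficients obey the sign rule
`(φ ⊗ x) ∘ (ψ ⊗ y) = (-1) ^ (|x| |ψ|) (φ ∘ ψ) ⊗ x y`, so that `x` is hit by `inv` when `ψ` is odd. -/
def comp (b : BaseData K B) (X Y : Cochain B) : Cochain B := fun M j =>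
  ∑ JN ∈ Finset.HasAntidiagonal.antidiagonal M.1, ∑ k : Fin 3,
    ((JN.2 k + 1 : ℕ) : B) *
      (((⇑b.inv)^[par JN.1 k] (X.coef (JN.2 + Finsupp.single k 1) j)) * Y.coef JN.1 k)

/-- The total parity involution of the cochains. -/
def parityInv (b : BaseData K B) (X : Cochain B) : Cochain B :=
  fun M j => (-1 : B) ^ par M.1 j * b.inv (X M j)

/-- `X` is even (for the total parity). -/
def IsEven (b : BaseData K B) (X : Cochain B) : Prop := parityInv b X = X

/-- `X` is odd (for the total parity). -/
def IsOdd (b : BaseData K B) (X : Cochain B) : Prop := parityInv b X = -X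

/-- The even component of a cochain. -/
def evenPart (b : BaseData K B) (X : Cochain B) : Cochain B := (2⁻¹ : K) • (X + parityInv b X)

/-- The odd component of a cochain. -/
def oddPart (b : BaseData K B) (X : Cochain B) : Cochain B := (2⁻¹ : K) • (X - parityInv b X)

/-- The graded bracket of coderivations: `[X, Y] = X ∘ Y - (-1) ^ (|X| |Y|) Y ∘ X` for homogeneous
`X` and `Y`, extended biadditively. -/
def bracket (b : BaseData K B) (X Y : Cochain B) : Cochain B :=
  comp b X Y - (comp b (evenPart b Y) X + comp b (oddPart b Y) (evenPart b X)
    - comp b (oddPart b Y) (oddPart b X))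

/-- A `B`-linear `L∞` structure on `W ⊗ B`: an odd element `X` with `[X, X] = 0`. -/
def IsCodifferential (b : BaseData K B) (X : Cochain B) : Prop :=
  IsOdd b X ∧ bracket b X X = 0

/-- A deformation with base `b` of the `L∞` structure `d`: an `L∞` structure that is mapped to `d`
by the augmentation. -/
def IsDeformation (b : BaseData K B) (d : Cochain K) (X : Cochain B) : Prop :=
  IsCodifferential b X ∧ ∀ M j, b.aug (X M j) = d M j

/-- Equivalence of deformations: `Y = exp (ad φ) (X) = ∑ₖ (ad φ)ᵏ (X) / k!` for some even
`φ` in the completed tensor product of `L` with the maximal ideal (the series converges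
because `(ad φ)ᵏ (X)` has coefficients in `fil k`). -/
def Equivalent (b : BaseData K B) (X Y : Cochain B) : Prop :=
  ∃ φ : Cochain B, IsEven b φ ∧ (∀ M j, φ M j ∈ b.maxIdeal) ∧
    ∀ n M j, (Y - ∑ k ∈ Finset.range n, ((k.factorial : K)⁻¹) • (bracket b φ)^[k] X) M j ∈ b.fil n

/-- Change of base `f_* = 1 ⊗ f`. -/
def pushforward {A : Type*} [Ring A] [Algebra K A] (f : A →ₐ[K] B) (X : Cochain A) : Cochain B :=
  fun M j => f (X M j)

end Bracket

/-- `X` is a miniversal deformation of `d` with base `a`: it is a formal deformation; every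
deformation `Y` of `d` with formal base `b` is equivalent to `f_* X` for some morphism `f : a → b`;
and this `f` is unique if `b` is infinitesimal. -/
structure IsMiniversal {K : Type u} [Field K] {A : Type u} [Ring A] [Algebra K A]
    (a : BaseData K A) (d : Cochain K) (X : Cochain A) : Prop where
  formal : a.IsFormal
  deformation : IsDeformation a d X
  versal : ∀ (B : Type v) [Ring B] [Algebra K B] (b : BaseData K B), b.IsFormal →
    ∀ Y : Cochain B, IsDeformation b d Y →
      ∃ f : A →ₐ[K] B, IsBaseHom a b f ∧ Equivalent b (pushforward f X) Y
  unique : ∀ (B : Type v) [Ring B] [Algebra K B] (b : BaseData K B), b.IsInfinitesimal →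
    ∀ Y : Cochain B, IsDeformation b d Y → ∀ f g : A →ₐ[K] B, IsBaseHom a b f → IsBaseHom a b g →
      Equivalent b (pushforward f X) Y → Equivalent b (pushforward g X) Y → f = g

/-! ### The parameters and their ring of formal power series -/

/-- The parameters: `t¹`, `t²` (even) and `θⁿ`, `ηⁿ`, `n ≥ 0` (odd). -/
inductive Param : Type
  | t1 : Param
  | t2 : Param
  | th : ℕ → Param
  | et : ℕ → Param

/-- The parity of a parameter (`0` for even, `1` for odd). -/
def Param.parity : Param → ℕ
  | .t1 => 0
  | .t2 => 0
  | .th _ => 1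
  | .et _ => 1

section Series

variable (K : Type u) [Field K]

/-- Supercommutation of the parameters: `x y = (-1) ^ (|x| |y|) y x`. -/
inductive SuperRel : FreeAlgebra K Param → FreeAlgebra K Param → Prop
  | swap (x y : Param) : SuperRel (FreeAlgebra.ι K x * FreeAlgebra.ι K y)
      ((-1 : FreeAlgebra K Param) ^ (x.parity * y.parity) *
        (FreeAlgebra.ι K y * FreeAlgebra.ι K x))

/-- The polynomial superalgebra `K[t¹, t²] ⊗ Λ(θⁿ, ηⁿ)` in the parameters. -/
def SuperPoly : Type u := RingQuot (SuperRel K)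

instance : Ring (SuperPoly K) := inferInstanceAs (Ring (RingQuot (SuperRel K)))

instance : Algebra K (SuperPoly K) := inferInstanceAs (Algebra K (RingQuot (SuperRel K)))

/-- The quotient map from the free algebra. -/
def polyMk : FreeAlgebra K Param →ₐ[K] SuperPoly K := RingQuot.mkAlgHom K (SuperRel K)

/-- A parameter as an element of the polynomial superalgebra. -/
def polyGen (x : Param) : SuperPoly K := polyMk K (FreeAlgebra.ι K x)

theorem polyGen_swap (x y : Param) : polyGen K x * polyGen K y =
    (-1) ^ (x.parity * y.parity) * (polyGen K y * polyGen K x) := by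
  have h : polyMk K _ = polyMk K _ := RingQuot.mkAlgHom_rel K (SuperRel.swap (K := K) x y)
  simp only [map_mul, map_pow, map_neg, map_one] at h
  exact h

/-- The homomorphism out of the polynomial superalgebra with given values at the parameters. -/
def polyLift {K : Type u} [Field K] {C : Type*} [Ring C] [Algebra K C] (f : Param → C)
    (hf : ∀ x y : Param, f x * f y = (-1) ^ (x.parity * y.parity) * (f y * f x)) :
    SuperPoly K →ₐ[K] C :=
  RingQuot.liftAlgHom K (s := SuperRel K)
    ⟨FreeAlgebra.lift K f, by
      intro a c h
      cases h with
      | swap x y => simpa using hf x y⟩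

theorem polyLift_gen {C : Type*} [Ring C] [Algebra K C] (f : Param → C)
    (hf : ∀ x y : Param, f x * f y = (-1) ^ (x.parity * y.parity) * (f y * f x)) (x : Param) :
    polyLift (K := K) f hf (polyGen K x) = f x := by
  have h := RingQuot.liftAlgHom_mkAlgHom_apply K (FreeAlgebra.lift K f) (s := SuperRel K)
    (by
      intro a c h
      cases h with
      | swap x y => simpa using hf x y) (FreeAlgebra.ι K x)
  rw [FreeAlgebra.lift_ι_apply] at h
  exact h

theorem poly_hom_ext {C : Type*} [Ring C] [Algebra K C] {f g : SuperPoly K →ₐ[K] C}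
    (h : ∀ x, f (polyGen K x) = g (polyGen K x)) : f = g :=
  RingQuot.ringQuot_ext' K (s := SuperRel K) f g (FreeAlgebra.hom_ext (funext h))

/-- The span of the parameters; its `n`-th power is the homogeneous part of degree `n`. -/
def polySpan : Submodule K (SuperPoly K) := Submodule.span K (Set.range (polyGen K))

/-- The parity involution of the polynomial superalgebra. -/
def polyInv : SuperPoly K →ₐ[K] SuperPoly K :=
  polyLift (fun x => (-1 : SuperPoly K) ^ x.parity * polyGen K x) (by
    intro x y
    have h := polyGen_swap K x y
    cases x <;> cases y <;> simp [Param.parity] at h ⊢ <;> exact h)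

/-- The augmentation of the polynomial superalgebra. -/
def polyAug : SuperPoly K →ₐ[K] K :=
  polyLift (fun _ => (0 : K)) (by simp)

theorem polyInv_gen (x : Param) :
    polyInv K (polyGen K x) = (-1 : SuperPoly K) ^ x.parity * polyGen K x :=
  polyLift_gen K _ _ x

theorem polyAug_gen (x : Param) : polyAug K (polyGen K x) = 0 :=
  polyLift_gen K _ _ x

theorem polyInv_mem {n : ℕ} {x : SuperPoly K} (hx : x ∈ polySpan K ^ n) :
    polyInv K x ∈ polySpan K ^ n := by
  have h1 : (polySpan K).map (polyInv K).toLinearMap ≤ polySpan K := by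
    rw [polySpan, Submodule.map_span, Submodule.span_le]
    rintro _ ⟨_, ⟨y, rfl⟩, rfl⟩
    have hy : polyGen K y ∈ Submodule.span K (Set.range (polyGen K)) :=
      Submodule.subset_span ⟨y, rfl⟩
    rw [AlgHom.toLinearMap_apply, polyInv_gen]
    cases y <;> simpa [Param.parity, neg_one_mul] using hy
  have h2 : (polySpan K ^ n).map (polyInv K).toLinearMap ≤ polySpan K ^ n := by
    rw [Submodule.map_pow]
    exact pow_le_pow_left' h1 n
  exact h2 ⟨x, hx, rfl⟩

/-- The ring of formal power series `K[[t¹, t², θⁿ, ηⁿ]]` in infinitely many variables: formal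
sums `∑ₙ fₙ` with `fₙ` a homogeneous polynomial of degree `n`, for each `n`.  Such a sum is
recorded as `∑ₙ fₙ Xⁿ`, where `X` only keeps track of the total degree. -/
def SuperSeries : Subalgebra K (PowerSeries (SuperPoly K)) where
  carrier := {f | ∀ n, PowerSeries.coeff n f ∈ polySpan K ^ n}
  mul_mem' := by
    intro f g hf hg n
    rw [PowerSeries.coeff_mul]
    refine Submodule.sum_mem _ fun p hp => ?_
    rw [← Finset.HasAntidiagonal.mem_antidiagonal.mp hp, pow_add]
    exact Submodule.mul_mem_mul (hf _) (hg _)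
  add_mem' := by
    intro f g hf hg n
    rw [map_add]
    exact Submodule.add_mem _ (hf n) (hg n)
  algebraMap_mem' := by
    intro c n
    rw [Algebra.algebraMap_eq_smul_one, PowerSeries.coeff_smul, PowerSeries.coeff_one]
    refine Submodule.smul_mem _ _ ?_
    split_ifs with h
    · subst h
      rw [pow_zero]
      exact Submodule.one_le.mp le_rfl
    · exact Submodule.zero_mem _

/-- A parameter as a formal power series. -/
def gen (x : Param) : SuperSeries K :=
  ⟨PowerSeries.mk fun n => if n = 1 then polyGen K x else 0, by
    intro n
    rw [PowerSeries.coeff_mk]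
    split_ifs with h
    · subst h
      rw [pow_one]
      exact Submodule.subset_span ⟨x, rfl⟩
    · exact Submodule.zero_mem _⟩

/-- The ring of formal power series in the parameters, with its parity involution, its augmentation
and its filtration by order. -/
def seriesBase : BaseData K (SuperSeries K) where
  inv :=
    { toFun := fun f => ⟨PowerSeries.map (polyInv K).toRingHom f.1, fun n => by
        rw [PowerSeries.coeff_map]
        exact polyInv_mem K (f.2 n)⟩
      map_one' := Subtype.ext (map_one _)
      map_mul' := fun f g => Subtype.ext (map_mul _ _ _)
      map_zero' := Subtype.ext (map_zero _)
      map_add' := fun f g => Subtype.ext (map_add _ _ _)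
      commutes' := fun c => Subtype.ext <| by
        ext n
        simp [Algebra.algebraMap_eq_smul_one, PowerSeries.coeff_one, apply_ite (polyInv K)] }
  aug :=
    { toFun := fun f => polyAug K (PowerSeries.constantCoeff f.1)
      map_one' := by simp
      map_mul' := fun f g => by simp
      map_zero' := by simp
      map_add' := fun f g => by simp
      commutes' := fun c => by simp [Algebra.algebraMap_eq_smul_one] }
  fil := fun n =>
    { carrier := {f | ∀ i < n, PowerSeries.coeff i f.1 = 0}
      add_mem' := fun hf hg i hi => by simp [hf i hi, hg i hi]
      zero_mem' := fun i _ => by simp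
      smul_mem' := fun c f hf i hi => by simp [hf i hi] }

variable {K}

/-- The formal power series `∑ᵢ aᵢ` converges to `x` in the filtration by order. -/
def HasFormalSum (a : ℕ → SuperSeries K) (x : SuperSeries K) : Prop :=
  ∀ n, ∃ N, ∀ M ≥ N, x - ∑ i ∈ Finset.range M, a i ∈ (seriesBase K).fil n

/-- The closed graded two-sided ideal generated by a set `S` of formal power series. -/
def relIdeal (S : Set (SuperSeries K)) : TwoSidedIdeal (SuperSeries K) :=
  sInf {J | (∀ x ∈ S, x ∈ J) ∧ (∀ x ∈ J, (seriesBase K).inv x ∈ J) ∧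
    ∀ x, (∀ n, ∃ y ∈ J, x - y ∈ (seriesBase K).fil n) → x ∈ J}

theorem relIdeal_inv (S : Set (SuperSeries K)) {x : SuperSeries K} (hx : x ∈ relIdeal S) :
    (seriesBase K).inv x ∈ relIdeal S := by
  rw [relIdeal, TwoSidedIdeal.mem_sInf] at hx ⊢
  exact fun J hJ => hJ.2.1 x (hx J hJ)

theorem aug_inv (x : SuperSeries K) : (seriesBase K).aug ((seriesBase K).inv x) =
    (seriesBase K).aug x := by
  have h : (polyAug K).comp (polyInv K) = polyAug K := by
    apply poly_hom_ext
    intro y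
    rw [AlgHom.comp_apply, polyInv_gen, map_mul, polyAug_gen, mul_zero]
  change polyAug K (PowerSeries.constantCoeff (PowerSeries.map (polyInv K).toRingHom x.1)) = _
  rw [← PowerSeries.coeff_zero_eq_constantCoeff_apply, PowerSeries.coeff_map]
  refine (congrArg (fun F => F (PowerSeries.coeff 0 x.1)) h).trans ?_
  rw [PowerSeries.coeff_zero_eq_constantCoeff_apply]
  rfl

theorem aug_of_mem_fil_one {x : SuperSeries K} (hx : x ∈ (seriesBase K).fil 1) :
    (seriesBase K).aug x = 0 := by
  have h0 : PowerSeries.coeff 0 x.1 = 0 := hx 0 Nat.zero_lt_one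
  change polyAug K (PowerSeries.constantCoeff x.1) = 0
  rw [← PowerSeries.coeff_zero_eq_constantCoeff_apply, h0, map_zero]

theorem aug_gen (x : Param) : (seriesBase K).aug (gen K x) = 0 := by
  apply aug_of_mem_fil_one
  intro i hi
  obtain rfl : i = 0 := by omega
  simp [gen]

theorem aug_of_mem_relIdeal {S : Set (SuperSeries K)} (hS : ∀ x ∈ S, (seriesBase K).aug x = 0)
    {x : SuperSeries K} (hx : x ∈ relIdeal S) : (seriesBase K).aug x = 0 := by
  rw [relIdeal, TwoSidedIdeal.mem_sInf] at hx
  have := hx (TwoSidedIdeal.ker (seriesBase K).aug) ⟨fun y hy => ?_, fun y hy => ?_, fun y hy => ?_⟩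
  · exact (TwoSidedIdeal.mem_ker _).mp this
  · exact (TwoSidedIdeal.mem_ker _).mpr (hS y hy)
  · exact (TwoSidedIdeal.mem_ker _).mpr ((aug_inv y).trans ((TwoSidedIdeal.mem_ker _).mp hy))
  · obtain ⟨z, hz, hyz⟩ := hy 1
    have h1 := aug_of_mem_fil_one hyz
    rw [map_sub, (TwoSidedIdeal.mem_ker _).mp hz, sub_zero] at h1
    exact (TwoSidedIdeal.mem_ker _).mpr h1

/-- The quotient ring `K[[t¹, t², θⁿ, ηⁿ]] / (S)`. -/
abbrev QuotRing (S : Set (SuperSeries K)) : Type u := (relIdeal S).ringCon.Quotient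

/-- The quotient map. -/
def quotMk (S : Set (SuperSeries K)) : SuperSeries K →ₐ[K] QuotRing S :=
  RingCon.mkₐ K (relIdeal S).ringCon

/-- The quotient `K[[t¹, t², θⁿ, ηⁿ]] / (S)`, for relations `S` without constant term, with the
induced parity involution, augmentation and filtration. -/
def quotBase (S : Set (SuperSeries K)) (hS : ∀ x ∈ S, (seriesBase K).aug x = 0) :
    BaseData K (QuotRing S) where
  inv := RingCon.liftₐ _ ((quotMk S).comp (seriesBase K).inv) <| by
    intro x y h
    refine (RingCon.eq _).mpr ?_
    rw [TwoSidedIdeal.rel_iff] at h ⊢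
    change (seriesBase K).inv x - (seriesBase K).inv y ∈ relIdeal S
    rw [← map_sub]
    exact relIdeal_inv S h
  aug := RingCon.liftₐ _ (seriesBase K).aug <| by
    intro x y h
    rw [TwoSidedIdeal.rel_iff] at h
    have := aug_of_mem_relIdeal hS h
    rw [map_sub] at this
    exact sub_eq_zero.mp this
  fil := fun n => ((seriesBase K).fil n).map (quotMk S).toLinearMap

end Series

/-! ### The codifferential `d = ψ^{0,1,1}_1`, its cohomology classes, and the deformation -/

/-- The codifferential `d = ψ^{0,1,1}_1`. -/
def d011 (K : Type u) [Field K] : Cochain K := phi (mi 0 1 1) 0 1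

/-- The coboundary operator `D φ = [φ, d]`. -/
def coboundary (K : Type u) [Field K] (φ : Cochain K) : Cochain K :=
  bracket (groundBase K) φ (d011 K)

/-- The representative `δᵢ ⊗ c` of the cohomology class that belongs to the parameter `i`:
`ψ₁ = ψ^{0,0,1}_1` to `t¹`, `ψ₂ = ψ^{0,1,0}_1` to `t²`, `φ_n = φ^{1,0,n}_1 + φ^{0,0,n+1}_3` to `θⁿ`,
and `σ_n = φ^{1,n,0}_1 + φ^{0,n+1,0}_2` to `ηⁿ`. -/
def delta {B : Type v} [AddCommMonoid B] : Param → B → Cochain B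
  | .t1, c => phi (mi 0 0 1) 0 c
  | .t2, c => phi (mi 0 1 0) 0 c
  | .th n, c => phi (mi 1 0 n) 0 c + phi (mi 0 0 (n + 1)) 2 c
  | .et n, c => phi (mi 1 n 0) 0 c + phi (mi 0 (n + 1) 0) 1 c

/-- The degree of the class that belongs to a parameter: `1` for `ψ₁`, `ψ₂`, and `n + 1` for
`φ_n`, `σ_n`. -/
def Param.classDeg : Param → ℕ
  | .t1 => 1
  | .t2 => 1
  | .th n => n + 1
  | .et n => n + 1

/-- `z` lies in `Lₙ = Hom(Sⁿ(W), W)`. -/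
def IsHomogeneous {K : Type u} [Field K] (n : ℕ) (z : Cochain K) : Prop :=
  ∀ M j, z M j ≠ 0 → deg M.1 = n

/-- The coefficients `r^k`, `s^k`, `y^k` (for `k ≥ 1`; the value at `0` is a dummy), `u^{k,l}` and
`v^{k,l}` of the deformation, given as formal power series in the parameters by their explicit
formulas and their recursions. -/
structure CoeffSystem (K : Type u) [Field K] where
  r : ℕ → SuperSeries K
  s : ℕ → SuperSeries K
  y : ℕ → SuperSeries K
  u : ℕ → ℕ → SuperSeries K
  v : ℕ → ℕ → SuperSeries K
  r_zero : r 0 = 0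
  s_zero : s 0 = 0
  y_zero : y 0 = 0
  r_rec : ∀ k ≥ 1, r k = gen K .t1 * gen K (.et (k + 1)) - gen K .t1 * r (k + 1)
  r_sum : ∀ k ≥ 1, HasFormalSum
    (fun n => (-1) ^ n * (gen K .t1 ^ (n + 1) * gen K (.et (k + n + 1)))) (r k)
  s_one : s 1 = gen K .t2 * gen K (.th 1) + gen K .t1 * gen K (.et 1) - gen K .t1 * r 1
  s_eq : ∀ k ≥ 2, s k = gen K .t2 * gen K (.th k)
  y_rec : ∀ k ≥ 1, y k = -(gen K .t1 * s (k + 1)) - gen K .t2 * y (k + 1)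
  y_sum : ∀ k ≥ 1, HasFormalSum
    (fun n => -((-1) ^ n * (gen K .t1 * gen K .t2 * gen K .t2 ^ n * gen K (.th (n + k + 1))))) (y k)
  u_rec : ∀ k l, u k l =
    -((((k + 2 : ℕ) : SuperSeries K) * gen K (.et (k + 1)) -
        ((l + 1 : ℕ) : SuperSeries K) * r (k + 1)) * y (l + 1)
      + gen K .t1 * u (k + 1) l + gen K .t2 * u k (l + 1))
  v_zero : ∀ k, v k 0 = 0
  v_rec : ∀ k l, v k (l + 1) =
    -(((l + 1 : ℕ) : SuperSeries K) * (gen K (.th (l + 1)) * r (k + 1))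
      - gen K (.et (k + 2)) * y (l + 1)
      + ((l + 1 : ℕ) : SuperSeries K) * (r (k + 2) * y (l + 1))
      - gen K .t1 * u (k + 2) l + gen K .t1 * v (k + 1) (l + 1))

namespace CoeffSystem

variable {K : Type u} [Field K] (c : CoeffSystem K)

/-- The relation that belongs to `ψ₂`. -/
def rel2 : SuperSeries K := gen K .t2 * gen K (.th 0)

/-- The relation that belongs to `ψ₁`. -/
def rel1 : SuperSeries K :=
  -(gen K .t1 * gen K (.et 0)) + gen K .t1 * c.s 1 + gen K .t2 * c.y 1

/-- The relation that belongs to `φ_n` (the terms with `u^{1,n-1}` only occur for `n ≥ 1`). -/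
def relPhi (n : ℕ) : SuperSeries K :=
  -(gen K (.et 1) * c.y n) + (n : SuperSeries K) * (c.r 1 * c.y n)
    - (if n = 0 then 0 else gen K .t1 * c.u 1 (n - 1)) + gen K .t1 * c.v 0 n
    + ∑ kl ∈ Finset.HasAntidiagonal.antidiagonal n,
        ((2⁻¹ * ((kl.1 : K) - (kl.2 : K))) • (gen K (.th kl.1) * gen K (.th kl.2))
          + (kl.1 : K) • (gen K (.th kl.1) * c.s (kl.2 + 1)))

/-- The relation that belongs to `σ_n`. -/
def relSigma (n : ℕ) : SuperSeries K :=
  gen K .t2 * c.u n 0 + ∑ kl ∈ Finset.HasAntidiagonal.antidiagonal n,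
    (2⁻¹ * ((kl.1 : K) - (kl.2 : K))) • (gen K (.et kl.1) * gen K (.et kl.2))

/-- All relations on the base. -/
def relations : Set (SuperSeries K) :=
  {rel2, c.rel1} ∪ Set.range c.relPhi ∪ Set.range c.relSigma

theorem aug_relations : ∀ x ∈ c.relations, (seriesBase K).aug x = 0 := by
  have hr : (seriesBase K).aug (c.r 1) = 0 := by
    rw [c.r_rec 1 le_rfl]
    simp [aug_gen]
  rintro x ((hx | ⟨n, rfl⟩) | ⟨n, rfl⟩)
  · rcases hx with rfl | hx
    · simp [rel2, aug_gen]
    · rw [Set.mem_singleton_iff.mp hx]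
      simp [rel1, aug_gen]
  · simp [relPhi, aug_gen, hr, apply_ite (seriesBase K).aug]
  · simp [relSigma, aug_gen]

/-- The ring `K[[t¹, t², θⁿ, ηⁿ]] / (relations)`. -/
abbrev BaseRing : Type u := QuotRing c.relations

/-- The base of the deformation. -/
def base : BaseData K c.BaseRing := quotBase c.relations c.aug_relations

/-- The deformation
`d^∞ = d + ψ₁ t¹ + ψ₂ t² + φ_n θⁿ + σ_n ηⁿ + γ_k r^k + ε_k s^k + β_k y^k + τ_{k,l} u^{k,l}
  + ξ_{k,l} v^{k,l}`, where `γ_k = φ^{0,k,1}_3`, `ε_k = φ^{0,0,k}_3`, `β_k = φ^{0,0,k}_2`,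
`τ_{k,l} = ψ^{1,k,l}_2` and `ξ_{k,l} = ψ^{1,k,l}_3`. -/
def dInf : Cochain c.BaseRing :=
  phi (mi 0 1 1) 0 1
    + fsum (fun i : Param => delta i (quotMk c.relations (gen K i)))
    + fsum (fun k : ℕ => phi (mi 0 (k + 1) 1) 2 (quotMk c.relations (c.r (k + 1))))
    + fsum (fun k : ℕ => phi (mi 0 0 (k + 1)) 2 (quotMk c.relations (c.s (k + 1))))
    + fsum (fun k : ℕ => phi (mi 0 0 (k + 1)) 1 (quotMk c.relations (c.y (k + 1))))
    + fsum (fun kl : ℕ × ℕ => phi (mi 1 kl.1 kl.2) 1 (quotMk c.relations (c.u kl.1 kl.2)))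
    + fsum (fun kl : ℕ × ℕ => phi (mi 1 kl.1 kl.2) 2 (quotMk c.relations (c.v kl.1 kl.2)))

end CoeffSystem

end SuperDeform

end

/-! A cochain is a formal vector field, vanishing at the origin, on a superspace with one odd
coordinate `ξ` and two even coordinates `x`, `y`: `φ^{a,p,q}_j` corresponds to `ξ^a x^p y^q ∂_j`,
with `j = 0, 1, 2` standing for `∂_ξ`, `∂_x`, `∂_y`, and `d` is `xy ∂_ξ`. Composing `X` with the
coderivation of `Y` differentiates the coefficients of `X` along `Y`. The associator of this product
therefore contains only second derivatives of `X` and is supersymmetric in the other two arguments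
(`comp_assoc_odd_odd`, `comp_assoc_odd_even`). This yields the two identities that deformation
theory needs: `ad φ` is a derivation (`ad_comp_add_comp`), and `X ∘ X` commutes with an odd `X`
(`comp_self_comp`).

The coboundary operator has an explicit homotopy, and subtracting a coboundary brings every cochain
into a linear normal form (`normal_sub_cob_homotopy`). Conversely, a normal cochain with zero class
components and normal coboundary vanishes (`Normal.mem_of_cob`). With scalars in `K` this computes
the cohomology. Applied modulo the filtration of a formal base, it drives every successive
approximation below.

The recursions for `r, s, y, u, v` say exactly that the family with these coefficients has its
square `X ∘ X` in normal form (`normal_comp`); the class components of the square are the relations,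
up to a sign at `t²` (`harm_comp`). Where the relations vanish, the square is normal without class
components. By the Bianchi identity its coboundary has higher order than the square, so the square
is zero (`comp_self_eq_zero`), and `d^∞` is a deformation.

For versality, a given deformation is moved by `exp (ad φ)` to some `Z` with `Z - d` normal
(`exists_normal`); `Z` is again a solution (`comp_self_of_exp`). The class components of `Z` are
admissible values of the parameters. The family at these values is normal, has the same class
components and has normal square, so it equals `Z` (`eq_of_normal`). Hence the relations hold at
these values and evaluation descends to the quotient. Over an infinitesimal base an equivalence adds
only a coboundary, so the class components, and with them the images of the parameters, are
determined (`harm_of_equivalent`, `quotHom_ext`). -/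

namespace SuperDeform

open PowerSeries

/-! ### Supercommutative rings and power series over them -/

/-- Supercommutativity of a ring with respect to a parity involution. -/
structure SuperComm {R : Type*} [Ring R] (ι : R →+* R) : Prop where
  inv_inv : ∀ x, ι (ι x) = x
  even_comm : ∀ x y, ι x = x → x * y = y * x
  odd_anticomm : ∀ x y, ι x = -x → ι y = -y → x * y = -(y * x)

/-- The variable is central and even, so each law holds coefficient by coefficient once the
antidiagonal is swapped. -/
theorem SuperComm.powerSeries {R : Type*} [Ring R] {ι : R →+* R} (h : SuperComm ι) :
    SuperComm (PowerSeries.map ι) where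
  inv_inv x := by ext n; simp [h.inv_inv]
  even_comm x y hx := by
    ext n
    rw [coeff_mul, coeff_mul, ← Finset.Nat.sum_antidiagonal_swap]
    refine Finset.sum_congr rfl fun p _ => h.even_comm _ _ ?_
    have := congrArg (coeff p.2) hx
    simpa using this
  odd_anticomm x y hx hy := by
    ext n
    rw [map_neg, coeff_mul, coeff_mul, ← Finset.Nat.sum_antidiagonal_swap, ← Finset.sum_neg_distrib]
    refine Finset.sum_congr rfl fun p _ => h.odd_anticomm _ _ ?_ ?_
    · simpa using congrArg (coeff p.2) hx
    · simpa using congrArg (coeff p.1) hy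

/-! ### Formal partial derivatives over a noncommutative ring. -/

section Derivation

variable {R : Type*} [Ring R]

/-- The formal derivative of a power series over a noncommutative ring. -/
noncomputable def der : R⟦X⟧ →+ R⟦X⟧ where
  toFun f := PowerSeries.mk fun n => ((n + 1 : ℕ) : R) * coeff (n + 1) f
  map_zero' := by ext n; simp
  map_add' f g := by ext n; simp [mul_add]

@[simp]
theorem coeff_der (f : R⟦X⟧) (n : ℕ) : coeff n (der f) = ((n + 1 : ℕ) : R) * coeff (n + 1) f := by
  change coeff n (PowerSeries.mk fun n => ((n + 1 : ℕ) : R) * coeff (n + 1) f) = _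
  rw [coeff_mk]

theorem coeff_X_mul_der (f : R⟦X⟧) (n : ℕ) : coeff n (X * der f) = (n : R) * coeff n f := by
  cases n with
  | zero => simp
  | succ n => rw [coeff_succ_X_mul, coeff_der]

/-- After multiplication by `X` the derivative becomes the Euler operator, which multiplies the
`n`-th coefficient by `n`; the Leibniz rule is then `n = i + j` on the antidiagonal. -/
theorem der_mul (f g : R⟦X⟧) : der (f * g) = der f * g + f * der g := by
  apply X_mul_cancel
  have : X * (der f * g + f * der g) = (X * der f) * g + f * (X * der g) := by
    rw [mul_add, ← mul_assoc, ← mul_assoc, X_mul (φ := f), mul_assoc f]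
  rw [this]
  ext n
  rw [coeff_X_mul_der, map_add, coeff_mul, coeff_mul, coeff_mul, ← Finset.sum_add_distrib,
    Finset.mul_sum]
  refine Finset.sum_congr rfl fun p hp => ?_
  rw [coeff_X_mul_der, coeff_X_mul_der, ← Finset.HasAntidiagonal.mem_antidiagonal.mp hp,
    Nat.cast_add, add_mul, mul_assoc, ← mul_assoc (coeff p.1 f), (Nat.cast_commute p.2 _).eq.symm,
    mul_assoc]

theorem der_map {R' : Type*} [Ring R'] (ι : R →+* R') (f : R⟦X⟧) :
    der (PowerSeries.map ι f) = PowerSeries.map ι (der f) := by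
  ext n; simp

/-- The derivative of a double power series with respect to the inner variable. -/
noncomputable def derInner : R⟦X⟧⟦X⟧ →+ R⟦X⟧⟦X⟧ where
  toFun f := PowerSeries.mk fun n => der (coeff n f)
  map_zero' := by ext n; simp
  map_add' f g := by ext n; simp

@[simp]
theorem coeff_derInner (f : R⟦X⟧⟦X⟧) (n : ℕ) : coeff n (derInner f) = der (coeff n f) := by
  change coeff n (PowerSeries.mk fun n => der (coeff n f)) = _
  rw [coeff_mk]

theorem derInner_mul (f g : R⟦X⟧⟦X⟧) : derInner (f * g) = derInner f * g + f * derInner g := by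
  ext1 n
  simp only [coeff_derInner, map_add, coeff_mul, map_sum, der_mul, Finset.sum_add_distrib]

theorem derInner_map (ι : R →+* R) (f : R⟦X⟧⟦X⟧) :
    derInner (PowerSeries.map (PowerSeries.map ι) f) =
      PowerSeries.map (PowerSeries.map ι) (derInner f) := by
  ext1 n; simp [der_map]

theorem derInner_der (f : R⟦X⟧⟦X⟧) : derInner (der f) = der (derInner f) := by
  ext n m
  simp only [coeff_derInner, coeff_der]
  rw [← map_natCast (C (R := R)) (n + 1), coeff_C_mul, coeff_C_mul, coeff_der,
    ← mul_assoc, ← mul_assoc, (Nat.cast_commute _ _).eq]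

end Derivation

/-! ### Adjoining an odd variable -/

/-- The ring `R[ξ]` of elements `p + ξ q`, with `ξ` odd. -/
@[ext]
structure Gr (R : Type*) where
  p : R
  q : R

/-- The data of a supercommutative ring with two commuting even derivations. -/
structure DiffRing (R : Type*) [Ring R] where
  ι : R →+* R
  dx : R →+ R
  dy : R →+ R
  sc : SuperComm ι
  dx_mul : ∀ f g, dx (f * g) = dx f * g + f * dx g
  dy_mul : ∀ f g, dy (f * g) = dy f * g + f * dy g
  dx_ι : ∀ f, dx (ι f) = ι (dx f)
  dy_ι : ∀ f, dy (ι f) = ι (dy f)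
  dxy : ∀ f, dx (dy f) = dy (dx f)

namespace DiffRing

variable {R : Type*} [Ring R] (D : DiffRing R)

/-- The action on `f = p + ξ q` of the vector field with components `Y`. -/
def act (Y : Fin 3 → Gr R) (f : Gr R) : Gr R where
  p := D.dx f.p * (Y 1).p + D.dy f.p * (Y 2).p + D.ι f.q * (Y 0).p
  q := D.ι (D.dx f.p) * (Y 1).q + D.dx f.q * (Y 1).p + D.ι (D.dy f.p) * (Y 2).q
    + D.dy f.q * (Y 2).p + f.q * (Y 0).q

/-- An odd vector field. -/
structure OddField (Y : Fin 3 → Gr R) : Prop where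
  p0 : D.ι (Y 0).p = (Y 0).p
  q0 : D.ι (Y 0).q = -(Y 0).q
  p1 : D.ι (Y 1).p = -(Y 1).p
  q1 : D.ι (Y 1).q = (Y 1).q
  p2 : D.ι (Y 2).p = -(Y 2).p
  q2 : D.ι (Y 2).q = (Y 2).q

/-- An even vector field. -/
structure EvenField (Y : Fin 3 → Gr R) : Prop where
  p0 : D.ι (Y 0).p = -(Y 0).p
  q0 : D.ι (Y 0).q = (Y 0).q
  p1 : D.ι (Y 1).p = (Y 1).p
  q1 : D.ι (Y 1).q = -(Y 1).q
  p2 : D.ι (Y 2).p = (Y 2).p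
  q2 : D.ι (Y 2).q = -(Y 2).q

/-- The difference of the two ways to compose the actions of `Y` and `Z` is antisymmetric in
odd `Y` and `Z`. -/
theorem act_act_odd_odd {Y Z : Fin 3 → Gr R} (hY : D.OddField Y) (hZ : D.OddField Z) (f : Gr R) :
    (D.act Z (D.act Y f)).p - (D.act (fun k => D.act Z (Y k)) f).p =
      -((D.act Y (D.act Z f)).p - (D.act (fun k => D.act Y (Z k)) f).p) ∧
    (D.act Z (D.act Y f)).q - (D.act (fun k => D.act Z (Y k)) f).q =
      -((D.act Y (D.act Z f)).q - (D.act (fun k => D.act Y (Z k)) f).q) := by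
  have e := D.sc.even_comm
  have o := D.sc.odd_anticomm
  -- The swaps fix one order for the undifferentiated coefficients of `Y` and `Z`: even coefficients
  -- move freely, two odd ones change the sign. After that both sides consist of the same monomials.
  have n1 := fun x => e _ x hY.p0
  have n2 := fun x => e _ x hY.q1
  have n3 := fun x => e _ x hY.q2
  have a1 := (e _ (Y 0).q hZ.p0).symm
  have a4 := (e _ (Y 1).p hZ.p0).symm
  have a5 := (e _ (Y 1).p hZ.q1).symm
  have a6 := (e _ (Y 1).p hZ.q2).symm
  have a7 := (e _ (Y 2).p hZ.p0).symm
  have a8 := (e _ (Y 2).p hZ.q1).symm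
  have a9 := (e _ (Y 2).p hZ.q2).symm
  have b1 := o _ _ hY.q0 hZ.q0
  have b2 := o _ _ hY.q0 hZ.p1
  have b3 := o _ _ hY.q0 hZ.p2
  have b4 := o _ _ hY.p1 hZ.q0
  have b5 := o _ _ hY.p1 hZ.p1
  have b6 := o _ _ hY.p1 hZ.p2
  have b7 := o _ _ hY.p2 hZ.q0
  have b8 := o _ _ hY.p2 hZ.p1
  have b9 := o _ _ hY.p2 hZ.p2
  constructor
  · simp only [act, map_add, map_mul, D.dx_mul, D.dy_mul, D.dx_ι, D.dy_ι, D.dxy, D.sc.inv_inv,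
      hY.p0, hY.q0, hY.p1, hY.q1, hY.p2, hY.q2, hZ.p0, hZ.q0, hZ.p1, hZ.q1, hZ.p2, hZ.q2,
      add_mul, mul_add, mul_assoc, neg_mul, mul_neg, n1, n2, n3, a1, a4, a5, a6, a7, a8, a9,
      b1, b2, b3, b4, b5, b6, b7, b8, b9]
    abel
  · simp only [act, map_add, map_mul, D.dx_mul, D.dy_mul, D.dx_ι, D.dy_ι, D.dxy, D.sc.inv_inv,
      hY.p0, hY.q0, hY.p1, hY.q1, hY.p2, hY.q2, hZ.p0, hZ.q0, hZ.p1, hZ.q1, hZ.p2, hZ.q2,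
      add_mul, mul_add, mul_assoc, neg_mul, mul_neg, n1, n2, n3, a1, a4, a5, a6, a7, a8, a9,
      b1, b2, b3, b4, b5, b6, b7, b8, b9]
    abel

/-- The difference of the two ways to compose the actions of `Y` and `Z` is symmetric in
an odd `Y` and an even `Z`. -/
theorem act_act_odd_even {Y Z : Fin 3 → Gr R} (hY : D.OddField Y) (hZ : D.EvenField Z) (f : Gr R) :
    (D.act Z (D.act Y f)).p - (D.act (fun k => D.act Z (Y k)) f).p =
      (D.act Y (D.act Z f)).p - (D.act (fun k => D.act Y (Z k)) f).p ∧
    (D.act Z (D.act Y f)).q - (D.act (fun k => D.act Z (Y k)) f).q =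
      (D.act Y (D.act Z f)).q - (D.act (fun k => D.act Y (Z k)) f).q := by
  have e := D.sc.even_comm
  have o := D.sc.odd_anticomm
  have n1 := fun x => e _ x hY.p0
  have n2 := fun x => e _ x hY.q1
  have n3 := fun x => e _ x hY.q2
  have a1 := (e _ (Y 0).q hZ.q0).symm
  have a2 := (e _ (Y 0).q hZ.p1).symm
  have a3 := (e _ (Y 0).q hZ.p2).symm
  have a4 := (e _ (Y 1).p hZ.q0).symm
  have a5 := (e _ (Y 1).p hZ.p1).symm
  have a6 := (e _ (Y 1).p hZ.p2).symm
  have a7 := (e _ (Y 2).p hZ.q0).symm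
  have a8 := (e _ (Y 2).p hZ.p1).symm
  have a9 := (e _ (Y 2).p hZ.p2).symm
  have b1 := o _ _ hY.q0 hZ.p0
  have b4 := o _ _ hY.p1 hZ.p0
  have b5 := o _ _ hY.p1 hZ.q1
  have b6 := o _ _ hY.p1 hZ.q2
  have b7 := o _ _ hY.p2 hZ.p0
  have b8 := o _ _ hY.p2 hZ.q1
  have b9 := o _ _ hY.p2 hZ.q2
  constructor
  · simp only [act, map_add, map_mul, D.dx_mul, D.dy_mul, D.dx_ι, D.dy_ι, D.dxy, D.sc.inv_inv,
      hY.p0, hY.q0, hY.p1, hY.q1, hY.p2, hY.q2, hZ.p0, hZ.q0, hZ.p1, hZ.q1, hZ.p2, hZ.q2,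
      add_mul, mul_add, mul_assoc, neg_mul, mul_neg, n1, n2, n3, a1, a2, a3, a4, a5, a6, a7, a8, a9,
      b1, b4, b5, b6, b7, b8, b9]
    abel
  · simp only [act, map_add, map_mul, D.dx_mul, D.dy_mul, D.dx_ι, D.dy_ι, D.dxy, D.sc.inv_inv,
      hY.p0, hY.q0, hY.p1, hY.q1, hY.p2, hY.q2, hZ.p0, hZ.q0, hZ.p1, hZ.q1, hZ.p2, hZ.q2,
      add_mul, mul_add, mul_assoc, neg_mul, mul_neg, n1, n2, n3, a1, a2, a3, a4, a5, a6, a7, a8, a9,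
      b1, b4, b5, b6, b7, b8, b9]
    abel

end DiffRing
end SuperDeform

namespace SuperDeform

open PowerSeries

/-! ### Cochains as vector fields -/

section Coefficients

@[simp] theorem mi_zero (a p q : ℕ) : mi a p q 0 = a := by simp [mi]
@[simp] theorem mi_one (a p q : ℕ) : mi a p q 1 = p := by simp [mi]
@[simp] theorem mi_two (a p q : ℕ) : mi a p q 2 = q := by simp [mi]

theorem eq_mi (I : Fin 3 →₀ ℕ) : I = mi (I 0) (I 1) (I 2) := by
  ext i; fin_cases i <;> simp

theorem mi_inj {a p q a' p' q' : ℕ} : mi a p q = mi a' p' q' ↔ a = a' ∧ p = p' ∧ q = q' := by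
  refine ⟨fun h => ⟨?_, ?_, ?_⟩, fun h => by rw [h.1, h.2.1, h.2.2]⟩
  · simpa using DFunLike.congr_fun h 0
  · simpa using DFunLike.congr_fun h 1
  · simpa using DFunLike.congr_fun h 2

theorem mi_add (a p q a' p' q' : ℕ) : mi a p q + mi a' p' q' = mi (a + a') (p + p') (q + q') := by
  ext i; fin_cases i <;> simp

theorem isMonomial_mi {a p q : ℕ} : IsMonomial (mi a p q) ↔ a ≤ 1 ∧ 0 < a + p + q := by
  have : mi a p q = 0 ↔ a = 0 ∧ p = 0 ∧ q = 0 := by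
    have h0 : (0 : Fin 3 →₀ ℕ) = mi 0 0 0 := by simp [mi]
    rw [h0, mi_inj]
  rw [IsMonomial, mi_zero, ne_eq, this]
  omega

/-- The sum over `q` is outside the sum over `p`, to match products of double power series, where
`y` is the outer variable. -/
theorem sum_antidiagonal_mi {A : Type*} [AddCommMonoid A] (a p q : ℕ)
    (g : (Fin 3 →₀ ℕ) → (Fin 3 →₀ ℕ) → A) :
    ∑ JN ∈ Finset.HasAntidiagonal.antidiagonal (mi a p q), g JN.1 JN.2 =
      ∑ i ∈ Finset.HasAntidiagonal.antidiagonal a, ∑ k ∈ Finset.HasAntidiagonal.antidiagonal q,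
        ∑ j ∈ Finset.HasAntidiagonal.antidiagonal p, g (mi i.1 j.1 k.1) (mi i.2 j.2 k.2) := by
  have h (i : ℕ × ℕ) : ∑ k ∈ Finset.HasAntidiagonal.antidiagonal q,
      ∑ j ∈ Finset.HasAntidiagonal.antidiagonal p, g (mi i.1 j.1 k.1) (mi i.2 j.2 k.2) =
      ∑ x ∈ Finset.HasAntidiagonal.antidiagonal q ×ˢ Finset.HasAntidiagonal.antidiagonal p,
        g (mi i.1 x.2.1 x.1.1) (mi i.2 x.2.2 x.1.2) :=
    (Finset.sum_product _ _ fun x : (ℕ × ℕ) × (ℕ × ℕ) =>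
      g (mi i.1 x.2.1 x.1.1) (mi i.2 x.2.2 x.1.2)).symm
  rw [Finset.sum_congr rfl fun i _ => h i]
  refine Eq.trans ?_ (Finset.sum_product _ _ fun x : (ℕ × ℕ) × ((ℕ × ℕ) × (ℕ × ℕ)) =>
    g (mi x.1.1 x.2.2.1 x.2.1.1) (mi x.1.2 x.2.2.2 x.2.1.2))
  refine Finset.sum_bij'
    (fun JN _ => ((JN.1 0, JN.2 0), ((JN.1 2, JN.2 2), (JN.1 1, JN.2 1))))
    (fun x _ => (mi x.1.1 x.2.2.1 x.2.1.1, mi x.1.2 x.2.2.2 x.2.1.2)) ?_ ?_ ?_ ?_ ?_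
  · intro JN h
    rw [Finset.HasAntidiagonal.mem_antidiagonal] at h
    have h0 := DFunLike.congr_fun h 0
    have h1 := DFunLike.congr_fun h 1
    have h2 := DFunLike.congr_fun h 2
    simp only [Finsupp.add_apply, mi_zero, mi_one, mi_two] at h0 h1 h2
    simp only [Finset.mem_product, Finset.HasAntidiagonal.mem_antidiagonal]
    exact ⟨h0, h2, h1⟩
  · intro x h
    simp only [Finset.mem_product, Finset.HasAntidiagonal.mem_antidiagonal] at h
    rw [Finset.HasAntidiagonal.mem_antidiagonal, mi_add, h.1, h.2.1, h.2.2]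
  · intro JN _
    exact Prod.ext (eq_mi _).symm (eq_mi _).symm
  · intro x _
    simp only [mi_zero, mi_one, mi_two]
  · intro JN _
    simp only [← eq_mi]

variable {B : Type v}

theorem coef_of_not [Zero B] (X : Cochain B) {I : Fin 3 →₀ ℕ} (h : ¬ IsMonomial I) (j : Fin 3) :
    X.coef I j = 0 := dif_neg h

theorem coef_val [Zero B] (X : Cochain B) (M : MIdx) (j : Fin 3) : X.coef M.1 j = X M j :=
  dif_pos M.2

@[simp]
theorem coef_zero_zero [Zero B] (X : Cochain B) (j : Fin 3) : X.coef (mi 0 0 0) j = 0 :=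
  coef_of_not X (by simp [isMonomial_mi]) j

theorem coef_of_two_le [Zero B] (X : Cochain B) {a : ℕ} (ha : 2 ≤ a) (p q : ℕ) (j : Fin 3) :
    X.coef (mi a p q) j = 0 :=
  coef_of_not X (by rw [isMonomial_mi]; omega) j

theorem cochain_ext [Zero B] {X Y : Cochain B}
    (h0 : ∀ p q j, X.coef (mi 0 p q) j = Y.coef (mi 0 p q) j)
    (h1 : ∀ p q j, X.coef (mi 1 p q) j = Y.coef (mi 1 p q) j) : X = Y := by
  funext M j
  rw [← coef_val X, ← coef_val Y, eq_mi M.1]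
  have := M.2.1
  interval_cases M.1 0
  · exact h0 _ _ _
  · exact h1 _ _ _

theorem coef_mem_iff [AddCommMonoid B] {S : Type*} [SetLike S B] [AddSubmonoidClass S B] (F : S)
    (X : Cochain B) : (∀ M j, X M j ∈ F) ↔ ∀ I j, X.coef I j ∈ F := by
  refine ⟨fun h I j => ?_, fun h M j => coef_val X M j ▸ h M.1 j⟩
  unfold Cochain.coef
  split_ifs with hI
  · exact h _ _
  · exact zero_mem F

theorem coef_map {B' : Type*} [Zero B] [Zero B'] (f : B → B') (hf : f 0 = 0) (X : Cochain B)
    (I : Fin 3 →₀ ℕ) (j : Fin 3) : Cochain.coef (fun M k => f (X M k)) I j = f (X.coef I j) := by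
  unfold Cochain.coef
  split_ifs
  · rfl
  · exact hf.symm

@[simp]
theorem coef_add [AddMonoid B] (X Y : Cochain B) (I : Fin 3 →₀ ℕ) (j : Fin 3) :
    (X + Y).coef I j = X.coef I j + Y.coef I j := by
  unfold Cochain.coef
  split_ifs
  · rfl
  · simp

@[simp]
theorem coef_zero [Zero B] (I : Fin 3 →₀ ℕ) (j : Fin 3) : (0 : Cochain B).coef I j = 0 := by
  unfold Cochain.coef
  split_ifs <;> rfl

@[simp]
theorem coef_neg [AddGroup B] (X : Cochain B) (I : Fin 3 →₀ ℕ) (j : Fin 3) :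
    (-X).coef I j = -X.coef I j := by
  unfold Cochain.coef
  split_ifs
  · rfl
  · simp

@[simp]
theorem coef_sub [AddGroup B] (X Y : Cochain B) (I : Fin 3 →₀ ℕ) (j : Fin 3) :
    (X - Y).coef I j = X.coef I j - Y.coef I j := by
  unfold Cochain.coef
  split_ifs
  · rfl
  · simp

theorem coef_phi [Zero B] {a p q : ℕ} (h : a ≤ 1 ∧ 0 < a + p + q) (I : Fin 3 →₀ ℕ) (j k : Fin 3)
    (c : B) : (phi (mi a p q) j c).coef I k = if I = mi a p q ∧ k = j then c else 0 := by
  unfold Cochain.coef phi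
  split_ifs with h1 h2 h2
  · rfl
  · rfl
  · exact absurd (h2.1 ▸ isMonomial_mi.mpr h) h1
  · rfl

theorem coef_ofFun [Zero B] (g : ℕ → ℕ → ℕ → Fin 3 → B) {a p q : ℕ} (h : a ≤ 1)
    (h' : 0 < a + p + q) (j : Fin 3) :
    Cochain.coef (fun M j => g (M.1 0) (M.1 1) (M.1 2) j) (mi a p q) j = g a p q j := by
  unfold Cochain.coef
  rw [dif_pos (isMonomial_mi.mpr ⟨h, h'⟩)]
  simp

end Coefficients

/-! ### Generating series of cochains, and composition as differentiation along a vector field. -/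

section Series

variable {B : Type v} [Ring B]

/-- The component of a cochain along `ξ ^ a` and `w_j`, as a double power series. -/
noncomputable def ser (X : Cochain B) (a : ℕ) (j : Fin 3) : B⟦X⟧⟦X⟧ :=
  PowerSeries.mk fun q => PowerSeries.mk fun p => X.coef (mi a p q) j

@[simp]
theorem coeff_ser (X : Cochain B) (a : ℕ) (j : Fin 3) (p q : ℕ) :
    coeff p (coeff q (ser X a j)) = X.coef (mi a p q) j := by
  simp [ser]

/-- The components of a cochain as a vector field. -/
noncomputable def toField (X : Cochain B) : Fin 3 → Gr B⟦X⟧⟦X⟧ := fun j => ⟨ser X 0 j, ser X 1 j⟩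

variable {K : Type u} [Field K] [Algebra K B] (b : BaseData K B)

/-- The parity involution of the double power series over a base. -/
noncomputable def serInv : B⟦X⟧⟦X⟧ →+* B⟦X⟧⟦X⟧ := PowerSeries.map (PowerSeries.map (b.inv : B →+* B))

@[simp]
theorem coeff_serInv (f : B⟦X⟧⟦X⟧) (p q : ℕ) :
    coeff p (coeff q (serInv b f)) = b.inv (coeff p (coeff q f)) := by
  simp [serInv]

theorem coeff_coeff_mul (f g : B⟦X⟧⟦X⟧) (p q : ℕ) : coeff p (coeff q (f * g)) =
    ∑ k ∈ Finset.HasAntidiagonal.antidiagonal q, ∑ j ∈ Finset.HasAntidiagonal.antidiagonal p,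
      coeff j.1 (coeff k.1 f) * coeff j.2 (coeff k.2 g) := by
  rw [coeff_mul, map_sum]
  refine Finset.sum_congr rfl fun k _ => coeff_mul _ _ _

theorem coeff_coeff_mul_swap (f g : B⟦X⟧⟦X⟧) (p q : ℕ) : coeff p (coeff q (f * g)) =
    ∑ k ∈ Finset.HasAntidiagonal.antidiagonal q, ∑ j ∈ Finset.HasAntidiagonal.antidiagonal p,
      coeff j.2 (coeff k.2 f) * coeff j.1 (coeff k.1 g) := by
  rw [coeff_coeff_mul]
  refine (Finset.Nat.sum_antidiagonal_swap (n := q) (M := B)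
    (f := fun k => ∑ j ∈ Finset.HasAntidiagonal.antidiagonal p,
      coeff j.1 (coeff k.1 f) * coeff j.2 (coeff k.2 g))).symm.trans
    (Finset.sum_congr rfl fun k _ => ?_)
  exact (Finset.Nat.sum_antidiagonal_swap (n := p) (M := B)
    (f := fun j => coeff j.1 (coeff k.2 f) * coeff j.2 (coeff k.1 g))).symm

theorem coeff_coeff_der (f : B⟦X⟧⟦X⟧) (p q : ℕ) :
    coeff p (coeff q (der f)) = ((q + 1 : ℕ) : B) * coeff p (coeff (q + 1) f) := by
  rw [coeff_der, ← map_natCast (C (R := B)) (q + 1), coeff_C_mul]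

theorem coeff_coeff_derInner (f : B⟦X⟧⟦X⟧) (p q : ℕ) :
    coeff p (coeff q (derInner f)) = ((p + 1 : ℕ) : B) * coeff (p + 1) (coeff q f) := by
  rw [coeff_derInner, coeff_der]

theorem comp_coef (X Y : Cochain B) {a p q : ℕ} (h : IsMonomial (mi a p q)) (j : Fin 3) :
    (comp b X Y).coef (mi a p q) j =
      ∑ i ∈ Finset.HasAntidiagonal.antidiagonal a, ∑ k ∈ Finset.HasAntidiagonal.antidiagonal q,
        ∑ l ∈ Finset.HasAntidiagonal.antidiagonal p,
        (((i.2 + 1 : ℕ) : B) * (((⇑b.inv)^[(i.1 + 1) % 2] (X.coef (mi (i.2 + 1) l.2 k.2) j)) *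
            Y.coef (mi i.1 l.1 k.1) 0)
          + ((l.2 + 1 : ℕ) : B) * (((⇑b.inv)^[i.1 % 2] (X.coef (mi i.2 (l.2 + 1) k.2) j)) *
            Y.coef (mi i.1 l.1 k.1) 1)
          + ((k.2 + 1 : ℕ) : B) * (((⇑b.inv)^[i.1 % 2] (X.coef (mi i.2 l.2 (k.2 + 1)) j)) *
            Y.coef (mi i.1 l.1 k.1) 2)) := by
  have h0 : ∀ a p q, mi a p q + Finsupp.single 0 1 = mi (a + 1) p q := by
    intro a p q; ext i; fin_cases i <;> simp
  have h1 : ∀ a p q, mi a p q + Finsupp.single 1 1 = mi a (p + 1) q := by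
    intro a p q; ext i; fin_cases i <;> simp
  have h2 : ∀ a p q, mi a p q + Finsupp.single 2 1 = mi a p (q + 1) := by
    intro a p q; ext i; fin_cases i <;> simp
  refine (coef_val (comp b X Y) ⟨mi a p q, h⟩ j).trans ?_
  refine (sum_antidiagonal_mi a p q fun J N => ∑ k : Fin 3, ((N k + 1 : ℕ) : B) *
    (((⇑b.inv)^[par J k] (X.coef (N + Finsupp.single k 1) j)) * Y.coef J k)).trans ?_
  refine Finset.sum_congr rfl fun i _ => Finset.sum_congr rfl fun k _ =>
    Finset.sum_congr rfl fun l _ => ?_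
  rw [Fin.sum_univ_three]
  simp [par, h0, h1, h2]

/-- At `ξ^0` the chain rule has three terms; the third is `∂_ξ` applied to the `ξ`-part of `X`.
There the basis field `∂_ξ` of `Y` is odd, and the sign rule puts `inv` on the coefficients of `X`.
-/
theorem ser_comp_zero (X Y : Cochain B) (j : Fin 3) : ser (comp b X Y) 0 j =
    derInner (ser X 0 j) * ser Y 0 1 + der (ser X 0 j) * ser Y 0 2
      + serInv b (ser X 1 j) * ser Y 0 0 := by
  ext q p
  rw [coeff_ser, map_add, map_add, map_add, map_add]
  simp only [coeff_coeff_mul_swap, coeff_coeff_der, coeff_coeff_derInner, coeff_serInv, coeff_ser]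
  by_cases h : 0 < p + q
  · rw [comp_coef b X Y (isMonomial_mi.mpr (by omega))]
    have : Finset.HasAntidiagonal.antidiagonal 0 = {((0 : ℕ), (0 : ℕ))} := rfl
    simp only [this, Finset.sum_singleton, ← Finset.sum_add_distrib]
    refine Finset.sum_congr rfl fun k _ => Finset.sum_congr rfl fun l _ => ?_
    simp only [Nat.zero_mod, Function.iterate_zero, id, mul_assoc]
    simp
    abel
  -- There is no cochain coefficient at the constant monomial; the right side vanishes there too
  -- because the components of `Y` at `ξ^0` have no constant term.
  · obtain ⟨rfl, rfl⟩ : p = 0 ∧ q = 0 := by omega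
    simp

theorem ser_comp_one (X Y : Cochain B) (j : Fin 3) :
    ser (comp b X Y) 1 j =
    serInv b (derInner (ser X 0 j)) * ser Y 1 1 + derInner (ser X 1 j) * ser Y 0 1
      + serInv b (der (ser X 0 j)) * ser Y 1 2 + der (ser X 1 j) * ser Y 0 2
      + ser X 1 j * ser Y 1 0 := by
  ext q p
  rw [coeff_ser]
  simp only [map_add]
  simp only [coeff_coeff_mul_swap, coeff_coeff_der, coeff_coeff_derInner, coeff_serInv, coeff_ser]
  rw [comp_coef b X Y (isMonomial_mi.mpr (by omega))]
  have : Finset.HasAntidiagonal.antidiagonal 1 = {((0 : ℕ), (1 : ℕ)), (1, 0)} := rfl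
  rw [this, Finset.sum_pair (by simp)]
  simp only [← Finset.sum_add_distrib]
  refine Finset.sum_congr rfl fun k _ => Finset.sum_congr rfl fun l _ => ?_
  -- The term in which `∂_ξ` would act on `ξ²` is absent.
  rw [coef_of_two_le X (a := 1 + 1) le_rfl]
  simp only [mul_assoc, Nat.zero_mod, Function.iterate_zero, id, map_mul, map_natCast]
  simp
  abel

end Series

/-! ### Supersymmetry of the associator. -/

section Act

variable {K : Type u} [Field K] {B : Type v} [Ring B] [Algebra K B] {b : BaseData K B}

theorem BaseData.IsFormal.superComm (hb : b.IsFormal) : SuperComm (b.inv : B →+* B) :=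
  ⟨hb.inv_inv, hb.even_comm, hb.odd_anticomm⟩

/-- The double power series over a formal base, with their partial derivatives. -/
noncomputable def BaseData.IsFormal.diffRing (hb : b.IsFormal) : DiffRing B⟦X⟧⟦X⟧ where
  ι := serInv b
  -- The inner variable is `x` (exponent `p`), the outer one is `y` (exponent `q`).
  dx := derInner
  dy := der
  sc := hb.superComm.powerSeries.powerSeries
  dx_mul := derInner_mul
  dy_mul := der_mul
  dx_ι := derInner_map _
  dy_ι := der_map _
  dxy := derInner_der

theorem toField_comp (hb : b.IsFormal) (X Y : Cochain B) :
    toField (comp b X Y) = fun j => hb.diffRing.act (toField Y) (toField X j) := by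
  funext j
  ext1
  · exact ser_comp_zero b X Y j
  · exact ser_comp_one b X Y j

theorem parityInv_coef (X : Cochain B) (a p q : ℕ) (j : Fin 3) :
    (parityInv b X).coef (mi a p q) j =
      (-1 : B) ^ ((a + if j = 0 then 1 else 0) % 2) * b.inv (X.coef (mi a p q) j) := by
  unfold Cochain.coef
  by_cases h : IsMonomial (mi a p q)
  · rw [dif_pos h, dif_pos h]
    simp only [parityInv, par, mi_zero]
  · rw [dif_neg h, dif_neg h, map_zero, mul_zero]

theorem IsOdd.coef {X : Cochain B} (h : IsOdd b X) (a p q : ℕ) (j : Fin 3) :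
    (-1 : B) ^ ((a + if j = 0 then 1 else 0) % 2) * b.inv (X.coef (mi a p q) j) =
      -X.coef (mi a p q) j := by
  rw [← parityInv_coef, h, coef_neg]

theorem IsEven.coef {X : Cochain B} (h : IsEven b X) (a p q : ℕ) (j : Fin 3) :
    (-1 : B) ^ ((a + if j = 0 then 1 else 0) % 2) * b.inv (X.coef (mi a p q) j) =
      X.coef (mi a p q) j := by
  rw [← parityInv_coef, h]

theorem IsOdd.oddField (hb : b.IsFormal) {X : Cochain B} (h : IsOdd b X) :
    hb.diffRing.OddField (toField X) := by
  constructor <;> refine PowerSeries.ext fun q => PowerSeries.ext fun p => ?_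
  · simpa [toField, BaseData.IsFormal.diffRing] using h.coef 0 p q 0
  · simpa [toField, BaseData.IsFormal.diffRing] using h.coef 1 p q 0
  · simpa [toField, BaseData.IsFormal.diffRing] using h.coef 0 p q 1
  · simpa [toField, BaseData.IsFormal.diffRing] using h.coef 1 p q 1
  · simpa [toField, BaseData.IsFormal.diffRing] using h.coef 0 p q 2
  · simpa [toField, BaseData.IsFormal.diffRing] using h.coef 1 p q 2

theorem IsEven.evenField (hb : b.IsFormal) {X : Cochain B} (h : IsEven b X) :
    hb.diffRing.EvenField (toField X) := by
  constructor <;> refine PowerSeries.ext fun q => PowerSeries.ext fun p => ?_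
  · simpa [toField, BaseData.IsFormal.diffRing, neg_eq_iff_eq_neg] using h.coef 0 p q 0
  · simpa [toField, BaseData.IsFormal.diffRing, neg_eq_iff_eq_neg] using h.coef 1 p q 0
  · simpa [toField, BaseData.IsFormal.diffRing, neg_eq_iff_eq_neg] using h.coef 0 p q 1
  · simpa [toField, BaseData.IsFormal.diffRing, neg_eq_iff_eq_neg] using h.coef 1 p q 1
  · simpa [toField, BaseData.IsFormal.diffRing, neg_eq_iff_eq_neg] using h.coef 0 p q 2
  · simpa [toField, BaseData.IsFormal.diffRing, neg_eq_iff_eq_neg] using h.coef 1 p q 2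

/-- The graded pre-Lie identity: what remains of the associator is the second derivative of `X`
along `Y` and `Z`, in which odd directions anticommute. -/
theorem comp_assoc_odd_odd (hb : b.IsFormal) (X : Cochain B) {Y Z : Cochain B} (hY : IsOdd b Y)
    (hZ : IsOdd b Z) : comp b (comp b X Y) Z - comp b X (comp b Y Z) =
      -(comp b (comp b X Z) Y - comp b X (comp b Z Y)) := by
  have h := fun j => hb.diffRing.act_act_odd_odd (hY.oddField hb) (hZ.oddField hb) (toField X j)
  simp only [← congrFun (toField_comp hb _ _)] at h
  apply cochain_ext <;> intro p q j
  · simpa [toField] using congrArg (fun f => coeff p (coeff q f)) (h j).1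
  · simpa [toField] using congrArg (fun f => coeff p (coeff q f)) (h j).2

theorem comp_assoc_odd_even (hb : b.IsFormal) (X : Cochain B) {Y Z : Cochain B} (hY : IsOdd b Y)
    (hZ : IsEven b Z) : comp b (comp b X Y) Z - comp b X (comp b Y Z) =
      comp b (comp b X Z) Y - comp b X (comp b Z Y) := by
  have h := fun j => hb.diffRing.act_act_odd_even (hY.oddField hb) (hZ.evenField hb) (toField X j)
  simp only [← congrFun (toField_comp hb _ _)] at h
  apply cochain_ext <;> intro p q j
  · simpa [toField] using congrArg (fun f => coeff p (coeff q f)) (h j).1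
  · simpa [toField] using congrArg (fun f => coeff p (coeff q f)) (h j).2

end Act

end SuperDeform

namespace SuperDeform

open PowerSeries

section Bilinear

variable {K : Type u} [Field K] {B : Type v} [Ring B] [Algebra K B]

/-! ### Linearity, filtration and parity of the composition -/

theorem iterate_inv_add (b : BaseData K B) (n : ℕ) (x y : B) :
    (⇑b.inv)^[n] (x + y) = (⇑b.inv)^[n] x + (⇑b.inv)^[n] y :=
  iterate_map_add b.inv n x y

theorem iterate_inv_smul (b : BaseData K B) (n : ℕ) (c : K) (x : B) :
    (⇑b.inv)^[n] (c • x) = c • (⇑b.inv)^[n] x := by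
  induction n generalizing x with
  | zero => rfl
  | succ n ih => rw [Function.iterate_succ_apply, Function.iterate_succ_apply, map_smul, ih]

variable (b : BaseData K B)

@[simp]
theorem coef_smul (c : K) (X : Cochain B) (I : Fin 3 →₀ ℕ) (j : Fin 3) :
    (c • X).coef I j = c • X.coef I j :=
  coef_map (fun x => c • x) (smul_zero c) X I j

theorem comp_add_left (X X' Y : Cochain B) : comp b (X + X') Y = comp b X Y + comp b X' Y := by
  funext M j
  simp only [comp, Pi.add_apply, coef_add, iterate_inv_add, add_mul, mul_add,
    Finset.sum_add_distrib]

theorem comp_add_right (X Y Y' : Cochain B) : comp b X (Y + Y') = comp b X Y + comp b X Y' := by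
  funext M j
  simp only [comp, Pi.add_apply, coef_add, mul_add, Finset.sum_add_distrib]

theorem comp_smul_left (c : K) (X Y : Cochain B) : comp b (c • X) Y = c • comp b X Y := by
  funext M j
  simp only [comp, Pi.smul_apply, coef_smul, iterate_inv_smul, smul_mul_assoc, mul_smul_comm,
    Finset.smul_sum]

theorem comp_smul_right (c : K) (X Y : Cochain B) : comp b X (c • Y) = c • comp b X Y := by
  funext M j
  simp only [comp, Pi.smul_apply, coef_smul, mul_smul_comm, Finset.smul_sum]

/-- The composition of cochains as a bilinear map. -/
noncomputable def compHom : Cochain B →ₗ[K] Cochain B →ₗ[K] Cochain B :=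
  LinearMap.mk₂ K (comp b) (comp_add_left b) (comp_smul_left b) (comp_add_right b)
    (comp_smul_right b)

theorem comp_sub_left (X X' Y : Cochain B) : comp b (X - X') Y = comp b X Y - comp b X' Y :=
  LinearMap.map_sub₂ (compHom b) X X' Y

theorem comp_sub_right (X Y Y' : Cochain B) : comp b X (Y - Y') = comp b X Y - comp b X Y' :=
  map_sub (compHom b X) Y Y'

@[simp]
theorem comp_zero_left (Y : Cochain B) : comp b 0 Y = 0 := LinearMap.map_zero₂ (compHom b) Y

@[simp]
theorem comp_zero_right (X : Cochain B) : comp b X 0 = 0 := map_zero (compHom b X)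

/-- The cochains with coefficients in a subspace. -/
def cochainsIn (F : Submodule K B) : Submodule K (Cochain B) where
  carrier := {X | ∀ M j, X M j ∈ F}
  add_mem' hX hY M j := F.add_mem (hX M j) (hY M j)
  zero_mem' _ _ := F.zero_mem
  smul_mem' c _ hX M j := F.smul_mem c (hX M j)

theorem mem_cochainsIn {F : Submodule K B} {X : Cochain B} :
    X ∈ cochainsIn F ↔ ∀ I j, X.coef I j ∈ F :=
  coef_mem_iff F X

variable {b}

theorem BaseData.IsFormal.fil_succ_le (hb : b.IsFormal) (n : ℕ) : b.fil (n + 1) ≤ b.fil n := by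
  rw [hb.fil_eq n]
  exact le_sup_right

theorem BaseData.IsFormal.fil_anti (hb : b.IsFormal) : Antitone b.fil :=
  antitone_nat_of_succ_le hb.fil_succ_le

theorem cochainsIn_mono {F G : Submodule K B} (h : F ≤ G) : cochainsIn F ≤ cochainsIn G :=
  fun _ hX M j => h (hX M j)

theorem BaseData.IsFormal.mul_mem (hb : b.IsFormal) {i j : ℕ} {x y : B} (hx : x ∈ b.fil i)
    (hy : y ∈ b.fil j) : x * y ∈ b.fil (i + j) :=
  hb.fil_mul i j (Submodule.mul_mem_mul hx hy)

theorem BaseData.IsFormal.mem_zero (hb : b.IsFormal) (x : B) : x ∈ b.fil 0 := by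
  rw [hb.fil_zero]; exact Submodule.mem_top

theorem natCast_mul_mem {F : Submodule K B} (n : ℕ) {x : B} (hx : x ∈ F) : (n : B) * x ∈ F := by
  rw [← nsmul_eq_mul]
  exact nsmul_mem hx n

theorem iterate_inv_mem (hb : b.IsFormal) (n : ℕ) {i : ℕ} {x : B} (hx : x ∈ b.fil i) :
    (⇑b.inv)^[n] x ∈ b.fil i := by
  induction n with
  | zero => exact hx
  | succ n ih => rw [Function.iterate_succ_apply']; exact hb.fil_inv _ _ ih

theorem comp_mem (hb : b.IsFormal) {i j : ℕ} {X Y : Cochain B} (hX : X ∈ cochainsIn (b.fil i))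
    (hY : Y ∈ cochainsIn (b.fil j)) : comp b X Y ∈ cochainsIn (b.fil (i + j)) := by
  rw [mem_cochainsIn] at hX hY
  intro M k
  refine Submodule.sum_mem _ fun JN _ => Submodule.sum_mem _ fun l _ => natCast_mul_mem _ ?_
  exact hb.mul_mem (iterate_inv_mem hb _ (hX _ _)) (hY _ _)

theorem mem_cochainsIn_fil_zero (hb : b.IsFormal) (X : Cochain B) : X ∈ cochainsIn (b.fil 0) :=
  fun _ _ => hb.mem_zero _

theorem comp_mem_left (hb : b.IsFormal) {i : ℕ} {X : Cochain B} (hX : X ∈ cochainsIn (b.fil i))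
    (Y : Cochain B) : comp b X Y ∈ cochainsIn (b.fil i) :=
  comp_mem hb hX (mem_cochainsIn_fil_zero hb Y)

theorem comp_mem_right (hb : b.IsFormal) {i : ℕ} (X : Cochain B) {Y : Cochain B}
    (hY : Y ∈ cochainsIn (b.fil i)) : comp b X Y ∈ cochainsIn (b.fil i) := by
  have := comp_mem hb (mem_cochainsIn_fil_zero hb X) hY
  rwa [zero_add] at this

theorem eq_zero_of_mem_fil (hb : b.IsFormal) {X : Cochain B}
    (h : ∀ n, X ∈ cochainsIn (b.fil n)) : X = 0 := by
  funext M j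
  exact hb.separated _ fun n => h n M j

theorem neg_one_pow_mem_units (n : ℕ) (x : B) : (-1 : B) ^ n * x = x ∨ (-1 : B) ^ n * x = -x := by
  rcases neg_one_pow_eq_or B n with h | h <;> rw [h] <;> simp

theorem parityInv_add (X Y : Cochain B) :
    parityInv b (X + Y) = parityInv b X + parityInv b Y := by
  funext M j
  simp only [parityInv, Pi.add_apply, map_add, mul_add]

theorem parityInv_smul (c : K) (X : Cochain B) : parityInv b (c • X) = c • parityInv b X := by
  funext M j
  simp only [parityInv, Pi.smul_apply, map_smul, mul_smul_comm]

variable (b) in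
/-- The parity involution of cochains as a linear map. -/
noncomputable def parityHom : Cochain B →ₗ[K] Cochain B where
  toFun := parityInv b
  map_add' := parityInv_add
  map_smul' := parityInv_smul

theorem parityInv_sub (X Y : Cochain B) : parityInv b (X - Y) = parityInv b X - parityInv b Y :=
  map_sub (parityHom b) X Y

theorem parityInv_zero : parityInv b (0 : Cochain B) = 0 := map_zero (parityHom b)

theorem parityInv_mem (hb : b.IsFormal) {i : ℕ} {X : Cochain B} (hX : X ∈ cochainsIn (b.fil i)) :
    parityInv b X ∈ cochainsIn (b.fil i) := by
  intro M j
  have := hb.fil_inv i _ (hX M j)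
  rcases neg_one_pow_mem_units (par M.1 j) (b.inv (X M j)) with h | h <;> rw [parityInv, h]
  · exact this
  · exact neg_mem this

theorem coef_parityInv (X : Cochain B) (I : Fin 3 →₀ ℕ) (j : Fin 3) :
    (parityInv b X).coef I j = (-1 : B) ^ par I j * b.inv (X.coef I j) := by
  unfold Cochain.coef
  by_cases h : IsMonomial I
  · rw [dif_pos h, dif_pos h]
    rfl
  · rw [dif_neg h, dif_neg h, map_zero, mul_zero]

/-- Parity is an automorphism of the composition because the parities of the two basis fields that
are composed add up modulo two. -/
theorem parityInv_comp (X Y : Cochain B) :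
    parityInv b (comp b X Y) = comp b (parityInv b X) (parityInv b Y) := by
  funext M j
  simp only [parityInv]
  unfold comp
  rw [map_sum, Finset.mul_sum]
  refine Finset.sum_congr rfl fun JN hJN => ?_
  rw [map_sum, Finset.mul_sum]
  refine Finset.sum_congr rfl fun k _ => ?_
  rw [coef_parityInv, coef_parityInv, map_mul, map_natCast, map_mul]
  have hit : ∀ (m n : ℕ) (x : B), (⇑b.inv)^[m] ((-1 : B) ^ n * x) = (-1) ^ n * (⇑b.inv)^[m] x := by
    intro m n x
    rcases neg_one_pow_mem_units n x with h | h <;> rw [h]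
    · rcases neg_one_pow_eq_or B n with h' | h'
      · rw [h', one_mul]
      · rw [h', neg_one_mul] at h ⊢
        rw [← iterate_map_neg, h]
    · rcases neg_one_pow_eq_or B n with h' | h'
      · rw [h', one_mul] at h ⊢
        rw [← h]
      · rw [h', neg_one_mul, iterate_map_neg]
  have hM : M.1 0 = JN.1 0 + JN.2 0 := by
    rw [← Finset.HasAntidiagonal.mem_antidiagonal.mp hJN, Finsupp.add_apply]
  rw [hit, ← Function.iterate_succ_apply' (⇑b.inv), Function.iterate_succ_apply (⇑b.inv)]
  -- `∂_k` lowers the exponent of `w_k` in the first factor, and `w_k` is the output of the second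
  -- factor, so the two contributions of `k` cancel modulo two.
  have hsign : (-1 : B) ^ par M.1 j =
      (-1) ^ par (JN.2 + Finsupp.single k 1) j * (-1) ^ par JN.1 k := by
    rw [← pow_add, neg_one_pow_eq_pow_mod_two, neg_one_pow_eq_pow_mod_two (n := _ + _)]
    congr 1
    simp only [par, hM, Finsupp.add_apply, Finsupp.single_apply]
    split_ifs <;> omega
  rw [hsign]
  rcases neg_one_pow_eq_or B (par (JN.2 + Finsupp.single k 1) j) with h1 | h1 <;>
    rcases neg_one_pow_eq_or B (par JN.1 k) with h2 | h2 <;> rw [h1, h2] <;> simp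

theorem IsOdd.add {X Y : Cochain B} (hX : IsOdd b X) (hY : IsOdd b Y) : IsOdd b (X + Y) := by
  rw [IsOdd, parityInv_add, hX, hY, neg_add]

theorem IsOdd.sub {X Y : Cochain B} (hX : IsOdd b X) (hY : IsOdd b Y) : IsOdd b (X - Y) := by
  rw [IsOdd, parityInv_sub, hX, hY]; abel

theorem IsEven.add {X Y : Cochain B} (hX : IsEven b X) (hY : IsEven b Y) : IsEven b (X + Y) := by
  rw [IsEven, parityInv_add, hX, hY]

theorem IsOdd.smul (c : K) {X : Cochain B} (hX : IsOdd b X) : IsOdd b (c • X) := by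
  rw [IsOdd, parityInv_smul, hX, smul_neg]

theorem comp_neg_left (X Y : Cochain B) : comp b (-X) Y = -comp b X Y :=
  LinearMap.map_neg₂ (compHom b) X Y

theorem comp_neg_right (X Y : Cochain B) : comp b X (-Y) = -comp b X Y := map_neg (compHom b X) Y

theorem IsOdd.comp {X Y : Cochain B} (hX : IsOdd b X) (hY : IsOdd b Y) :
    IsEven b (comp b X Y) := by
  rw [IsEven, parityInv_comp, hX, hY, comp_neg_left, comp_neg_right, neg_neg]

theorem IsOdd.comp_even {X Y : Cochain B} (hX : IsOdd b X) (hY : IsEven b Y) :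
    IsOdd b (SuperDeform.comp b X Y) := by
  rw [IsOdd, parityInv_comp, hX, hY, comp_neg_left]

theorem IsEven.comp_odd {X Y : Cochain B} (hX : IsEven b X) (hY : IsOdd b Y) :
    IsOdd b (comp b X Y) := by
  rw [IsOdd, parityInv_comp, hX, hY, comp_neg_right]

/-! ### The bracket -/

theorem evenPart_add_oddPart [CharZero K] (X : Cochain B) : evenPart b X + oddPart b X = X := by
  rw [evenPart, oddPart, ← smul_add, add_add_sub_cancel, ← two_smul K, smul_smul,
    inv_mul_cancel₀ two_ne_zero, one_smul]

theorem evenPart_sub_oddPart [CharZero K] (X : Cochain B) :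
    evenPart b X - oddPart b X = parityInv b X := by
  rw [evenPart, oddPart, ← smul_sub, add_sub_sub_cancel, ← two_smul K, smul_smul,
    inv_mul_cancel₀ two_ne_zero, one_smul]

theorem IsEven.evenPart_eq [CharZero K] {X : Cochain B} (h : IsEven b X) : evenPart b X = X := by
  rw [evenPart, h, ← two_smul K, smul_smul, inv_mul_cancel₀ two_ne_zero, one_smul]

theorem IsEven.oddPart_eq {X : Cochain B} (h : IsEven b X) : oddPart b X = 0 := by
  rw [oddPart, h, sub_self, smul_zero]

theorem IsOdd.evenPart_eq {X : Cochain B} (h : IsOdd b X) : evenPart b X = 0 := by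
  rw [evenPart, h, add_neg_cancel, smul_zero]

theorem IsOdd.oddPart_eq [CharZero K] {X : Cochain B} (h : IsOdd b X) : oddPart b X = X := by
  rw [oddPart, h, sub_neg_eq_add, ← two_smul K, smul_smul, inv_mul_cancel₀ two_ne_zero, one_smul]

theorem bracket_even_left [CharZero K] {φ : Cochain B} (h : IsEven b φ) (X : Cochain B) :
    bracket b φ X = comp b φ X - comp b X φ := by
  rw [bracket, h.evenPart_eq, h.oddPart_eq, comp_zero_right, sub_zero, ← comp_add_left,
    evenPart_add_oddPart]

theorem bracket_odd_right [CharZero K] (X : Cochain B) {Y : Cochain B} (h : IsOdd b Y) :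
    bracket b X Y = comp b X Y - comp b Y (parityInv b X) := by
  rw [bracket, h.evenPart_eq, h.oddPart_eq, comp_zero_left, zero_add, ← comp_sub_right,
    evenPart_sub_oddPart]

theorem bracket_self_odd [CharZero K] {X : Cochain B} (h : IsOdd b X) :
    bracket b X X = 0 ↔ comp b X X = 0 := by
  rw [bracket_odd_right X h, h, comp_neg_right, sub_neg_eq_add, ← two_smul K,
    smul_eq_zero_iff_right two_ne_zero]

/-- For odd `X` the bracket `[X, X]` is `2 (X ∘ X)`, and two is invertible. -/
theorem isCodifferential_iff [CharZero K] {X : Cochain B} :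
    IsCodifferential b X ↔ IsOdd b X ∧ comp b X X = 0 :=
  and_congr_right fun h => bracket_self_odd h

variable (b) in
/-- The commutator with an even cochain. -/
noncomputable def ad (φ : Cochain B) : Cochain B →ₗ[K] Cochain B := compHom b φ - (compHom b).flip φ

theorem ad_apply (φ X : Cochain B) : ad b φ X = comp b φ X - comp b X φ := rfl

theorem bracket_eq_ad [CharZero K] {φ : Cochain B} (h : IsEven b φ) : bracket b φ = ⇑(ad b φ) :=
  funext fun X => bracket_even_left h X

theorem ad_add (φ ψ X : Cochain B) : ad b (φ + ψ) X = ad b φ X + ad b ψ X := by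
  simp only [ad_apply, comp_add_left, comp_add_right]
  abel

theorem ad_sub (φ ψ X : Cochain B) : ad b (φ - ψ) X = ad b φ X - ad b ψ X := by
  simp only [ad_apply, comp_sub_left, comp_sub_right]
  abel

theorem ad_mem (hb : b.IsFormal) {i j : ℕ} {φ X : Cochain B} (hφ : φ ∈ cochainsIn (b.fil i))
    (hX : X ∈ cochainsIn (b.fil j)) : ad b φ X ∈ cochainsIn (b.fil (i + j)) := by
  refine Submodule.sub_mem _ (comp_mem hb hφ hX) ?_
  rw [add_comm]
  exact comp_mem hb hX hφ

theorem IsOdd.ad {φ X : Cochain B} (hφ : IsEven b φ) (hX : IsOdd b X) : IsOdd b (ad b φ X) :=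
  (hφ.comp_odd hX).sub (hX.comp_even hφ)

/-- The commutator with an even cochain is a derivation of the bracket of odd cochains. -/
theorem ad_comp_add_comp (hb : b.IsFormal) {φ X Y : Cochain B} (hφ : IsEven b φ) (hX : IsOdd b X)
    (hY : IsOdd b Y) : ad b φ (comp b X Y + comp b Y X) =
      comp b (ad b φ X) Y + comp b Y (ad b φ X) + (comp b X (ad b φ Y) + comp b (ad b φ Y) X) := by
  have h1 := comp_assoc_odd_odd hb φ hX hY
  have h2 := comp_assoc_odd_even hb X hY hφ
  have h3 := comp_assoc_odd_even hb Y hX hφ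
  rw [sub_eq_iff_eq_add] at h1 h2 h3
  simp only [ad_apply, comp_add_left, comp_add_right, comp_sub_left, comp_sub_right, h1, h2, h3]
  abel

/-- The Bianchi identity. -/
theorem comp_self_comp [CharZero K] (hb : b.IsFormal) {X : Cochain B} (hX : IsOdd b X) :
    comp b (comp b X X) X = comp b X (comp b X X) := by
  have h := comp_assoc_odd_odd hb X hX hX
  rw [eq_neg_iff_add_eq_zero, ← two_smul K, smul_eq_zero_iff_right two_ne_zero] at h
  exact sub_eq_zero.mp h

end Bilinear

end SuperDeform

namespace SuperDeform

open PowerSeries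

section Coboundary

variable {K : Type u} [Field K] {B : Type v} [Ring B] [Algebra K B]

/-! ### The coboundary operator and normal forms -/

/-- The codifferential `ψ^{0,1,1}_1` over an arbitrary base. -/
noncomputable def dB (B : Type v) [Ring B] : Cochain B := phi (mi 0 1 1) 0 1

/-- The double power series `x`. -/
noncomputable def sx : B⟦X⟧⟦X⟧ := C X

/-- The double power series `y`. -/
noncomputable def sy : B⟦X⟧⟦X⟧ := X

theorem coeff_sx (f : B⟦X⟧⟦X⟧) (p q : ℕ) :
    coeff p (coeff q (sx * f)) = if 1 ≤ p then coeff (p - 1) (coeff q f) else 0 := by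
  rw [sx, coeff_C_mul]
  cases p with
  | zero => rw [coeff_zero_X_mul, if_neg (by omega)]
  | succ p => rw [coeff_succ_X_mul, if_pos (by omega), Nat.add_sub_cancel]

theorem coeff_sy (f : B⟦X⟧⟦X⟧) (p q : ℕ) :
    coeff p (coeff q (sy * f)) = if 1 ≤ q then coeff p (coeff (q - 1) f) else 0 := by
  rw [sy]
  cases q with
  | zero => rw [coeff_zero_X_mul, map_zero, if_neg (by omega)]
  | succ p => rw [coeff_succ_X_mul, if_pos (by omega), Nat.add_sub_cancel]

theorem sx_comm (f : B⟦X⟧⟦X⟧) : f * sx = sx * f := by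
  ext q p
  rw [sx, coeff_C_mul, coeff_mul_C, X_mul]

theorem sy_comm (f : B⟦X⟧⟦X⟧) : f * sy = sy * f := X_mul.symm

theorem sxy_comm (f : B⟦X⟧⟦X⟧) : f * (sx * sy) = sx * (sy * f) := by
  rw [← mul_assoc, sx_comm, mul_assoc, sy_comm]

theorem coeff_coeff_one (p q : ℕ) :
    coeff p (coeff q (1 : B⟦X⟧⟦X⟧)) = if p = 0 ∧ q = 0 then 1 else 0 := by
  rw [coeff_one]
  split_ifs with h h' h'
  · rw [coeff_one, if_pos h'.1]
  · rw [coeff_one, if_neg (by tauto)]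
  · exact absurd h'.2 h
  · rw [map_zero]

theorem derInner_sx : derInner (sx : B⟦X⟧⟦X⟧) = 1 := by
  ext q p
  rw [coeff_coeff_derInner, ← mul_one sx, coeff_sx, coeff_coeff_one, coeff_coeff_one]
  by_cases h : p = 0 <;> simp [h]

theorem derInner_sy : derInner (sy : B⟦X⟧⟦X⟧) = 0 := by
  ext q p
  rw [coeff_coeff_derInner, ← mul_one sy, coeff_sy, coeff_coeff_one]
  simp

theorem der_sx : der (sx : B⟦X⟧⟦X⟧) = 0 := by
  ext q p
  rw [coeff_coeff_der, ← mul_one sx, coeff_sx, coeff_coeff_one]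
  simp

theorem der_sy : der (sy : B⟦X⟧⟦X⟧) = 1 := by
  ext q p
  rw [coeff_coeff_der, ← mul_one sy, coeff_sy, coeff_coeff_one, coeff_coeff_one]
  by_cases h : q = 0 <;> simp [h]

theorem serInv_sx (b : BaseData K B) : serInv b sx = sx := by
  simp [serInv, sx]

theorem serInv_sy (b : BaseData K B) : serInv b sy = sy := by
  simp [serInv, sy]

theorem coef_dB (a p q : ℕ) (j : Fin 3) : (dB B).coef (mi a p q) j =
    if a = 0 ∧ p = 1 ∧ q = 1 ∧ j = 0 then 1 else 0 := by
  rw [dB, coef_phi (by omega)]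
  simp only [mi_inj, and_assoc]

theorem ser_dB : ser (dB B) 0 0 = sx * sy := by
  ext q p
  rw [coeff_ser, coef_dB, ← mul_one sy, coeff_sx, coeff_sy, coeff_coeff_one, ← ite_and, ← ite_and]
  exact if_congr (by simp; omega) rfl rfl

theorem ser_dB_one (j : Fin 3) : ser (dB B) 1 j = 0 := by
  ext q p
  rw [coeff_ser, coef_dB]
  simp

theorem ser_dB_zero {j : Fin 3} (h : j ≠ 0) : ser (dB B) 0 j = 0 := by
  ext q p
  rw [coeff_ser, coef_dB]
  simp [h]

/-- The only component of `d` is `xy ∂_ξ`, so differentiation along `d` strips off `ξ` and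
multiplies by `xy`. -/
theorem ser_comp_dB_zero (b : BaseData K B) (X : Cochain B) (j : Fin 3) :
    ser (comp b X (dB B)) 0 j = sx * (sy * serInv b (ser X 1 j)) := by
  rw [ser_comp_zero, ser_dB, ser_dB_zero one_ne_zero, ser_dB_zero (j := 2) (by decide), mul_zero,
    mul_zero, zero_add, zero_add, sxy_comm]

theorem ser_comp_dB_one (b : BaseData K B) (X : Cochain B) (j : Fin 3) :
    ser (comp b X (dB B)) 1 j = 0 := by
  rw [ser_comp_one, ser_dB_one, ser_dB_one, ser_dB_one, ser_dB_zero one_ne_zero,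
    ser_dB_zero (j := 2) (by decide)]
  simp only [mul_zero, add_zero]

/-- This is the Leibniz rule for the coefficient `xy` of `d`, differentiated along `X`. -/
theorem ser_dB_comp_zero (b : BaseData K B) (X : Cochain B) :
    ser (comp b (dB B) X) 0 0 = sy * ser X 0 1 + sx * ser X 0 2 := by
  rw [ser_comp_zero, ser_dB, ser_dB_one, map_zero, zero_mul, add_zero, derInner_mul, der_mul,
    derInner_sx, derInner_sy, der_sx, der_sy, one_mul, mul_zero, add_zero, zero_mul, zero_add,
    mul_one]

theorem ser_dB_comp_one (b : BaseData K B) (X : Cochain B) :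
    ser (comp b (dB B) X) 1 0 = sy * ser X 1 1 + sx * ser X 1 2 := by
  rw [ser_comp_one, ser_dB, ser_dB_one, derInner_mul, der_mul,
    derInner_sx, derInner_sy, der_sx, der_sy, one_mul, mul_zero, add_zero, zero_mul, zero_add,
    mul_one, map_zero, map_zero, serInv_sx, serInv_sy]
  simp only [zero_mul, add_zero]

theorem ser_dB_comp (b : BaseData K B) (X : Cochain B) (a : ℕ) (ha : a ≤ 1) {j : Fin 3}
    (hj : j ≠ 0) : ser (comp b (dB B) X) a j = 0 := by
  interval_cases a
  · rw [ser_comp_zero, ser_dB_zero hj, ser_dB_one]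
    simp only [map_zero, zero_mul, add_zero]
  · rw [ser_comp_one, ser_dB_zero hj, ser_dB_one]
    simp only [map_zero, zero_mul, add_zero]

variable (b : BaseData K B)

/-- The coboundary operator `X ↦ [X, d]` over an arbitrary base. -/
noncomputable def cob : Cochain B →ₗ[K] Cochain B :=
  (compHom b).flip (dB B) - (compHom b (dB B)).comp (parityHom b)

theorem cob_apply (X : Cochain B) :
    cob b X = comp b X (dB B) - comp b (dB B) (parityInv b X) := rfl

theorem ser_parityInv (X : Cochain B) (a : ℕ) (j : Fin 3) : ser (parityInv b X) a j =
    (-1) ^ ((a + if j = 0 then 1 else 0) % 2) * serInv b (ser X a j) := by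
  ext q p
  rw [coeff_ser, parityInv_coef]
  rcases Nat.mod_two_eq_zero_or_one (a + if j = 0 then 1 else 0) with h | h <;> rw [h] <;> simp

theorem ser_cob (X : Cochain B) (a : ℕ) (j : Fin 3) : ser (cob b X) a j =
    ser (comp b X (dB B)) a j - ser (comp b (dB B) (parityInv b X)) a j := by
  ext q p
  simp [cob_apply]

/-- With the three lemmas that follow, this turns the coboundary into index shifts: `∂_ξ` at `ξ^0`
receives `xy` times the `ξ ∂_ξ` part, minus `y` times the `∂_x` part and `x` times the `∂_y` part.
-/
theorem cob_coef_zero_zero (X : Cochain B) (p q : ℕ) : (cob b X).coef (mi 0 p q) 0 =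
    b.inv ((if 1 ≤ p ∧ 1 ≤ q then X.coef (mi 1 (p - 1) (q - 1)) 0 else 0)
      - ((if 1 ≤ q then X.coef (mi 0 p (q - 1)) 1 else 0)
        + (if 1 ≤ p then X.coef (mi 0 (p - 1) q) 2 else 0))) := by
  rw [← coeff_ser, ser_cob, ser_comp_dB_zero, ser_dB_comp_zero, ser_parityInv, ser_parityInv]
  simp only [map_sub, map_add, coeff_sx, coeff_sy, coeff_serInv, coeff_ser, ite_and,
    apply_ite b.inv, map_zero]
  simp

theorem cob_coef_one_zero (X : Cochain B) (p q : ℕ) : (cob b X).coef (mi 1 p q) 0 =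
    b.inv ((if 1 ≤ q then X.coef (mi 1 p (q - 1)) 1 else 0)
        + (if 1 ≤ p then X.coef (mi 1 (p - 1) q) 2 else 0)) := by
  rw [← coeff_ser, ser_cob, ser_comp_dB_one, ser_dB_comp_one, ser_parityInv, ser_parityInv]
  simp only [map_sub, map_add, coeff_sx, coeff_sy, apply_ite b.inv, map_zero]
  simp
  split_ifs <;> simp [add_comm]

theorem cob_coef_zero (X : Cochain B) (p q : ℕ) {j : Fin 3} (hj : j ≠ 0) :
    (cob b X).coef (mi 0 p q) j =
    b.inv (if 1 ≤ p ∧ 1 ≤ q then X.coef (mi 1 (p - 1) (q - 1)) j else 0) := by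
  rw [← coeff_ser, ser_cob, ser_comp_dB_zero, ser_dB_comp b _ 0 zero_le_one hj, sub_zero]
  simp only [coeff_sx, coeff_sy, coeff_serInv, coeff_ser, ite_and, apply_ite b.inv, map_zero]

theorem cob_coef_one (X : Cochain B) (p q : ℕ) {j : Fin 3} (hj : j ≠ 0) :
    (cob b X).coef (mi 1 p q) j = 0 := by
  rw [← coeff_ser, ser_cob, ser_comp_dB_one, ser_dB_comp b _ 1 le_rfl hj, sub_zero, map_zero,
    map_zero]

/-- The components of a cochain along the coboundaries vanish modulo `F`. -/
structure Normal (F : Submodule K B) (X : Cochain B) : Prop where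
  zero : ∀ p q, 2 ≤ p + q → X.coef (mi 0 p q) 0 ∈ F
  one : ∀ p q, X.coef (mi 0 (p + 1) (q + 1)) 1 ∈ F
  two : ∀ p q, X.coef (mi 1 (p + 1) q) 0 - X.coef (mi 0 (p + 2) q) 1 ∈ F

/-- The component of a cochain along the cohomology class that belongs to a parameter. -/
noncomputable def harm (X : Cochain B) : Param → B
  | .t1 => X.coef (mi 0 0 1) 0
  | .t2 => X.coef (mi 0 1 0) 0
  -- For `n = 0` the subtraction removes the contribution of `σ_0`. For `n ≥ 1` it makes the
  -- functional vanish on the coboundary of `ξ y^{n-1} ∂_x`.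
  | .th n => X.coef (mi 1 0 n) 0 - X.coef (mi 0 1 n) 1
  | .et n => X.coef (mi 0 (n + 1) 0) 1

variable {b}

theorem Normal.add {F : Submodule K B} {X Y : Cochain B} (hX : Normal F X) (hY : Normal F Y) :
    Normal F (X + Y) where
  zero p q h := by rw [coef_add]; exact F.add_mem (hX.zero p q h) (hY.zero p q h)
  one p q := by rw [coef_add]; exact F.add_mem (hX.one p q) (hY.one p q)
  two p q := by
    rw [coef_add, coef_add, add_sub_add_comm]; exact F.add_mem (hX.two p q) (hY.two p q)

theorem Normal.neg {F : Submodule K B} {X : Cochain B} (hX : Normal F X) : Normal F (-X) where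
  zero p q h := by rw [coef_neg]; exact F.neg_mem (hX.zero p q h)
  one p q := by rw [coef_neg]; exact F.neg_mem (hX.one p q)
  two p q := by rw [coef_neg, coef_neg, ← neg_sub']; exact F.neg_mem (hX.two p q)

theorem Normal.sub {F : Submodule K B} {X Y : Cochain B} (hX : Normal F X) (hY : Normal F Y) :
    Normal F (X - Y) := by
  rw [sub_eq_add_neg]
  exact hX.add hY.neg

theorem Normal.mono {F G : Submodule K B} (h : F ≤ G) {X : Cochain B} (hX : Normal F X) :
    Normal G X :=
  ⟨fun p q hpq => h (hX.zero p q hpq), fun p q => h (hX.one p q), fun p q => h (hX.two p q)⟩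

theorem normal_of_mem {F : Submodule K B} {X : Cochain B} (hX : X ∈ cochainsIn F) :
    Normal F X := by
  rw [mem_cochainsIn] at hX
  exact ⟨fun p q _ => hX _ _, fun p q => hX _ _, fun p q => F.sub_mem (hX _ _) (hX _ _)⟩

theorem harm_sub (X Y : Cochain B) (i : Param) : harm (X - Y) i = harm X i - harm Y i := by
  cases i <;> simp only [harm, coef_sub]
  abel

theorem harm_add (X Y : Cochain B) (i : Param) : harm (X + Y) i = harm X i + harm Y i := by
  cases i <;> simp only [harm, coef_add]
  abel

/-- The class components are functionals on cohomology. The monomials they read are out of reach of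
the shifts in the coboundary, except for `φ_n`, where the two contributions cancel. -/
theorem harm_cob (X : Cochain B) (i : Param) : harm (cob b X) i = 0 := by
  cases i with
  | t1 => simp [harm, cob_coef_zero_zero]
  | t2 => simp [harm, cob_coef_zero_zero]
  | th n =>
    rw [harm, cob_coef_one_zero, cob_coef_zero b X _ _ one_ne_zero]
    simp
  | et n =>
    rw [harm, cob_coef_zero b X _ _ one_ne_zero]
    simp

/-- A cochain in normal form without cohomological components, whose coboundary is in normal form,
vanishes. -/
theorem Normal.mem_of_cob (hinv : ∀ x, b.inv (b.inv x) = x) {F : Submodule K B}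
    (hF : ∀ x ∈ F, b.inv x ∈ F) {X : Cochain B} (hX : Normal F X) (hH : ∀ i, harm X i ∈ F)
    (hD : Normal F (cob b X)) : X ∈ cochainsIn F := by
  have hF' : ∀ x, b.inv x ∈ F → x ∈ F := fun x hx => hinv x ▸ hF _ hx
  have h10 : ∀ p q, X.coef (mi 0 (p + 1) q) 1 ∈ F := by
    intro p q
    rcases q with - | q
    · exact hH (.et p)
    · exact hX.one p q
  have h00 : ∀ p q, X.coef (mi 0 p q) 0 ∈ F := by
    intro p q
    rcases le_or_gt 2 (p + q) with h | h
    · exact hX.zero p q h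
    · obtain ⟨rfl, rfl⟩ | ⟨rfl, rfl⟩ | ⟨rfl, rfl⟩ :
          (p = 0 ∧ q = 0) ∨ (p = 0 ∧ q = 1) ∨ (p = 1 ∧ q = 0) := by omega
      · rw [coef_zero_zero]; exact F.zero_mem
      · exact hH .t1
      · exact hH .t2
  have h01 : ∀ p q, X.coef (mi 1 p q) 0 ∈ F := by
    intro p q
    rcases p with - | p
    · have := F.add_mem (hH (.th q)) (h10 0 q)
      rwa [harm, sub_add_cancel] at this
    · have := F.add_mem (hX.two p q) (h10 (p + 1) q)
      rwa [sub_add_cancel] at this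
  -- The remaining coefficients are read off the coboundary. Up to `inv`, its `one`-component is the
  -- `ξ ∂_x` part of `X`, and its `two`-component then isolates the `ξ ∂_y` part.
  have h11 : ∀ p q, X.coef (mi 1 p q) 1 ∈ F := by
    intro p q
    have := hD.one p q
    rw [cob_coef_zero b X _ _ one_ne_zero] at this
    simpa using hF' _ this
  have h12 : ∀ p q, X.coef (mi 1 p q) 2 ∈ F := by
    intro p q
    have := hD.two p q
    rw [cob_coef_zero b X _ _ one_ne_zero, cob_coef_one_zero, ← map_sub] at this
    have := hF' _ this
    rcases q with - | q
    · simpa using this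
    · have h' := F.sub_mem this (F.sub_mem (h11 (p + 1) q) (h11 (p + 1) q))
      simpa using h'
  -- Since the `ξ ∂_ξ` part is already in `F`, the `zero`-component controls `y X_x + x X_y`. At
  -- pure powers of `y` only `X_x` contributes, which completes the `∂_x` part; `X_y` follows by
  -- subtraction.
  have hcob : ∀ p q, (cob b X).coef (mi 0 p q) 0 ∈ F → (if 1 ≤ q then X.coef (mi 0 p (q - 1)) 1
      else 0) + (if 1 ≤ p then X.coef (mi 0 (p - 1) q) 2 else 0) ∈ F := by
    intro p q h
    rw [cob_coef_zero_zero] at h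
    have h' := F.sub_mem (?_ : (if 1 ≤ p ∧ 1 ≤ q then X.coef (mi 1 (p - 1) (q - 1)) 0 else 0) ∈ F)
      (hF' _ h)
    · rwa [sub_sub_cancel] at h'
    · split_ifs
      · exact h01 _ _
      · exact F.zero_mem
  have h10' : ∀ p q, X.coef (mi 0 p q) 1 ∈ F := by
    intro p q
    rcases p with - | p
    · rcases q with - | q
      · rw [coef_zero_zero]; exact F.zero_mem
      · simpa using hcob 0 (q + 2) (hD.zero _ _ (by omega))
    · exact h10 p q
  have h20 : ∀ p q, X.coef (mi 0 p q) 2 ∈ F := by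
    intro p q
    rcases Nat.eq_zero_or_pos (p + q) with h | h
    · obtain ⟨rfl, rfl⟩ : p = 0 ∧ q = 0 := by omega
      rw [coef_zero_zero]; exact F.zero_mem
    · have := hcob (p + 1) q (hD.zero _ _ (by omega))
      rcases q with - | q
      · simpa using this
      · have h' := F.sub_mem this (h10' (p + 1) q)
        simpa using h'
  rw [mem_cochainsIn]
  intro I j
  rw [eq_mi I]
  rcases Nat.lt_or_ge (I 0) 2 with h | h
  · interval_cases I 0 <;> fin_cases j
    exacts [h00 _ _, h10' _ _, h20 _ _, h01 _ _, h11 _ _, h12 _ _]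
  · rw [coef_of_two_le X h]; exact F.zero_mem

variable (b) in
/-- The contracting homotopy onto cochains in normal form. -/
noncomputable def homotopy (E : Cochain B) : Cochain B := fun M j =>
  b.inv (if M.1 0 = 1 then
      (if j = 1 then E.coef (mi 0 (M.1 1 + 1) (M.1 2 + 1)) 1
        else if j = 2 then E.coef (mi 1 (M.1 1 + 1) (M.1 2)) 0 - E.coef (mi 0 (M.1 1 + 2) (M.1 2)) 1
        else 0)
    else
      (if j = 2 then -E.coef (mi 0 (M.1 1 + 1) (M.1 2)) 0
        else if j = 1 ∧ M.1 1 = 0 then -E.coef (mi 0 0 (M.1 2 + 1)) 0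
        else 0))

theorem homotopy_coef (E : Cochain B) {a p q : ℕ} (h : a ≤ 1) (h' : 0 < a + p + q) (j : Fin 3) :
    (homotopy b E).coef (mi a p q) j = b.inv (if a = 1 then
      (if j = 1 then E.coef (mi 0 (p + 1) (q + 1)) 1
        else if j = 2 then E.coef (mi 1 (p + 1) q) 0 - E.coef (mi 0 (p + 2) q) 1
        else 0)
    else
      (if j = 2 then -E.coef (mi 0 (p + 1) q) 0
        else if j = 1 ∧ p = 0 then -E.coef (mi 0 0 (q + 1)) 0
        else 0)) :=
  coef_ofFun (fun a p q j => b.inv (if a = 1 then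
      (if j = 1 then E.coef (mi 0 (p + 1) (q + 1)) 1
        else if j = 2 then E.coef (mi 1 (p + 1) q) 0 - E.coef (mi 0 (p + 2) q) 1
        else 0)
    else
      (if j = 2 then -E.coef (mi 0 (p + 1) q) 0
        else if j = 1 ∧ p = 0 then -E.coef (mi 0 0 (q + 1)) 0
        else 0))) h h' j

/-- The homotopy solves a triangular system. A monomial of `∂_ξ` divisible by `x` is removed with a
`∂_y` field, a pure power of `y` with a `∂_x` field; a term `x^{p+1} y^{q+1} ∂_x` is removed with `ξ
x^p y^q ∂_x`. In the `two`-combination the `ξ ∂_x` contributions cancel, which leaves the `ξ ∂_y`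
field free to solve it. -/
theorem normal_sub_cob_homotopy (hinv : ∀ x, b.inv (b.inv x) = x) (E : Cochain B) :
    Normal (⊥ : Submodule K B) (E - cob b (homotopy b E)) where
  zero p q h := by
    rw [Submodule.mem_bot, coef_sub, cob_coef_zero_zero]
    rcases p with - | p
    · obtain ⟨q, rfl⟩ : ∃ r, q = r + 2 := ⟨q - 2, by omega⟩
      simp [homotopy_coef, hinv]
    · rcases q with - | q
      · simp [homotopy_coef, hinv, show 0 < p by omega]
      · simp [homotopy_coef, hinv]
  one p q := by
    rw [Submodule.mem_bot, coef_sub, cob_coef_zero b _ _ _ one_ne_zero]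
    simp [homotopy_coef, hinv]
  two p q := by
    rw [Submodule.mem_bot, coef_sub, coef_sub, cob_coef_zero b _ _ _ one_ne_zero,
      cob_coef_one_zero]
    rcases q with - | q
    · simp [homotopy_coef, hinv]
    · simp [homotopy_coef, hinv]

theorem homotopy_mem (hb : b.IsFormal) {n : ℕ} {E : Cochain B} (hE : E ∈ cochainsIn (b.fil n)) :
    homotopy b E ∈ cochainsIn (b.fil n) := by
  rw [mem_cochainsIn] at hE
  intro M j
  refine hb.fil_inv n _ ?_
  split_ifs
  exacts [hE _ _, sub_mem (hE _ _) (hE _ _), zero_mem _, neg_mem (hE _ _), neg_mem (hE _ _),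
    zero_mem _]

/-- The homotopy inverts an odd operator, so it turns the odd error term into an even cochain, as a
gauge parameter has to be. -/
theorem IsOdd.homotopy {E : Cochain B} (hE : IsOdd b E) : IsEven b (homotopy b E) := by
  have h0 := fun p q => hE.coef 0 p q 0
  have h1 := fun p q => hE.coef 1 p q 0
  have h2 := fun p q => hE.coef 0 p q 1
  simp at h0 h1 h2
  apply cochain_ext <;> intro p q j <;> rw [parityInv_coef]
  · rcases Nat.eq_zero_or_pos (p + q) with h | h
    · obtain ⟨rfl, rfl⟩ : p = 0 ∧ q = 0 := by omega
      simp
    · rw [homotopy_coef E zero_le_one (by omega)]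
      fin_cases j
      · simp
      · by_cases hp : p = 0
        · simp [hp, h0]
        · simp [hp]
      · simp [h0]
  · rw [homotopy_coef E le_rfl (by omega)]
    fin_cases j
    · simp
    · simp [h2]
    · simp [h1, h2, add_comm]

theorem isOdd_dB : IsOdd b (dB B) := by
  apply cochain_ext <;> intro p q j <;> rw [parityInv_coef, coef_neg, coef_dB]
  · by_cases h : 0 = 0 ∧ p = 1 ∧ q = 1 ∧ j = 0
    · rw [if_pos h]; simp [h.2.2.2]
    · rw [if_neg h]; simp
  · simp

theorem comp_dB_dB : comp b (dB B) (dB B) = 0 := by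
  apply cochain_ext <;> intro p q j
  · rw [← coeff_ser, ser_comp_dB_zero, ser_dB_one]
    simp
  · rw [← coeff_ser, ser_comp_dB_one]
    simp

theorem cob_even {φ : Cochain B} (h : IsEven b φ) : cob b φ = ad b φ (dB B) := by
  rw [cob_apply, h, ad_apply]

theorem cob_odd {X : Cochain B} (h : IsOdd b X) :
    cob b X = comp b X (dB B) + comp b (dB B) X := by
  rw [cob_apply, h, comp_neg_right, sub_neg_eq_add]

end Coboundary

end SuperDeform

namespace SuperDeform

open PowerSeries

/-! ### The family of cochains that underlies the miniversal deformation -/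

section OneVariable

variable {B : Type v} [Ring B]

/-- A double power series in `x` only. -/
noncomputable def onlyX (f : ℕ → B) : B⟦X⟧⟦X⟧ := C (PowerSeries.mk f)

/-- A double power series in `y` only. -/
noncomputable def onlyY (f : ℕ → B) : B⟦X⟧⟦X⟧ := PowerSeries.map C (PowerSeries.mk f)

/-- A constant double power series. -/
noncomputable def const (c : B) : B⟦X⟧⟦X⟧ := C (C c)

/-- The Cauchy product of two sequences. -/
noncomputable def cauchy (f g : ℕ → B) (n : ℕ) : B :=
  ∑ kl ∈ Finset.HasAntidiagonal.antidiagonal n, f kl.1 * g kl.2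

theorem coeff_onlyX (f : ℕ → B) (p q : ℕ) :
    coeff p (coeff q (onlyX f)) = if q = 0 then f p else 0 := by
  rw [onlyX, coeff_C]
  split_ifs <;> simp

theorem coeff_onlyY (f : ℕ → B) (p q : ℕ) :
    coeff p (coeff q (onlyY f)) = if p = 0 then f q else 0 := by
  rw [onlyY, coeff_map, coeff_C, coeff_mk]

theorem coeff_const (c : B) (p q : ℕ) :
    coeff p (coeff q (const c)) = if p = 0 ∧ q = 0 then c else 0 := by
  rw [const, coeff_C]
  split_ifs with h h' h'
  · rw [coeff_C, if_pos h'.1]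
  · rw [coeff_C, if_neg (by tauto)]
  · exact absurd h'.2 h
  · rw [map_zero]

theorem coeff_const_mul (c : B) (F : B⟦X⟧⟦X⟧) (p q : ℕ) :
    coeff p (coeff q (const c * F)) = c * coeff p (coeff q F) := by
  rw [const, coeff_C_mul, coeff_C_mul]

theorem coeff_mul_const (c : B) (F : B⟦X⟧⟦X⟧) (p q : ℕ) :
    coeff p (coeff q (F * const c)) = coeff p (coeff q F) * c := by
  rw [const, coeff_mul_C, coeff_mul_C]

theorem coeff_mul_sx_mul (f g : B⟦X⟧⟦X⟧) (p q : ℕ) :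
    coeff p (coeff q (f * (sx * g))) = if 1 ≤ p then coeff (p - 1) (coeff q (f * g)) else 0 := by
  rw [← mul_assoc, sx_comm, mul_assoc, coeff_sx]

theorem coeff_mul_sy_mul (f g : B⟦X⟧⟦X⟧) (p q : ℕ) :
    coeff p (coeff q (f * (sy * g))) = if 1 ≤ q then coeff p (coeff (q - 1) (f * g)) else 0 := by
  rw [← mul_assoc, sy_comm, mul_assoc, coeff_sy]

theorem coeff_mul_sy (f : B⟦X⟧⟦X⟧) (p q : ℕ) :
    coeff p (coeff q (f * sy)) = if 1 ≤ q then coeff p (coeff (q - 1) f) else 0 := by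
  rw [sy_comm, coeff_sy]

theorem coeff_onlyX_mul_onlyY (f g : ℕ → B) (p q : ℕ) :
    coeff p (coeff q (onlyX f * onlyY g)) = f p * g q := by
  rw [onlyX, onlyY, coeff_C_mul, coeff_map, coeff_mul_C, coeff_mk, coeff_mk]

theorem coeff_onlyY_mul_onlyX (f g : ℕ → B) (p q : ℕ) :
    coeff p (coeff q (onlyY f * onlyX g)) = f q * g p := by
  rw [onlyX, onlyY, coeff_mul_C, coeff_map, coeff_C_mul, coeff_mk, coeff_mk]

theorem onlyX_mul_onlyX (f g : ℕ → B) : onlyX f * onlyX g = onlyX (cauchy f g) := by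
  rw [onlyX, onlyX, onlyX, ← map_mul]
  congr 1
  ext n
  simp [coeff_mul, cauchy]

theorem onlyY_mul_onlyY (f g : ℕ → B) : onlyY f * onlyY g = onlyY (cauchy f g) := by
  rw [onlyY, onlyY, onlyY, ← map_mul]
  congr 1
  ext n
  simp [coeff_mul, cauchy]

theorem derInner_onlyX (f : ℕ → B) :
    derInner (onlyX f) = onlyX fun n => ((n + 1 : ℕ) : B) * f (n + 1) := by
  ext q p
  rw [coeff_coeff_derInner, coeff_onlyX, coeff_onlyX]
  split_ifs <;> simp

theorem derInner_sx_onlyX (f : ℕ → B) :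
    derInner (sx * onlyX f) = onlyX fun n => ((n + 1 : ℕ) : B) * f n := by
  ext q p
  rw [coeff_coeff_derInner, coeff_sx, coeff_onlyX, coeff_onlyX, if_pos (by omega)]
  split_ifs <;> simp

theorem der_onlyY (f : ℕ → B) : der (onlyY f) = onlyY fun n => ((n + 1 : ℕ) : B) * f (n + 1) := by
  ext q p
  rw [coeff_coeff_der, coeff_onlyY, coeff_onlyY]
  split_ifs <;> simp

theorem derInner_onlyY (f : ℕ → B) : derInner (onlyY f) = 0 := by
  ext q p
  rw [coeff_coeff_derInner, coeff_onlyY]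
  simp

theorem der_onlyX (f : ℕ → B) : der (onlyX f) = 0 := by
  ext q p
  rw [coeff_coeff_der, coeff_onlyX]
  simp

theorem derInner_const (c : B) : derInner (const c) = 0 := by
  ext q p
  rw [coeff_coeff_derInner, ← mul_one (const c), coeff_const_mul, coeff_coeff_one]
  simp

theorem der_const (c : B) : der (const c) = 0 := by
  ext q p
  rw [coeff_coeff_der, ← mul_one (const c), coeff_const_mul, coeff_coeff_one]
  simp

end OneVariable

/-- Values for the parameters and for the coefficients of the deformation. -/
structure Values (B : Type v) where
  a : Param → B
  r : ℕ → B
  s : ℕ → B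
  y : ℕ → B
  u : ℕ → ℕ → B
  v : ℕ → ℕ → B

namespace Values

section

variable {B : Type v} [Ring B] (c : Values B)

/-- The coefficients of the cochain with the given values of the parameters. -/
noncomputable def familyCoef (a p q : ℕ) (j : Fin 3) : B :=
  if a = 0 then
    if j = 0 then
      (if p = 1 ∧ q = 1 then 1 else 0) + (if p = 0 ∧ q = 1 then c.a .t1 else 0)
        + (if p = 1 ∧ q = 0 then c.a .t2 else 0)
    else if j = 1 then
      (if 1 ≤ p ∧ q = 0 then c.a (.et (p - 1)) else 0) + (if p = 0 then c.y q else 0)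
    else
      (if p = 0 ∧ 1 ≤ q then c.a (.th (q - 1)) else 0) + (if q = 1 then c.r p else 0)
        + (if p = 0 then c.s q else 0)
  else
    if j = 0 then (if p = 0 then c.a (.th q) else 0) + (if q = 0 then c.a (.et p) else 0)
    else if j = 1 then c.u p q
    else c.v p q

/-- The cochain with the given values of the parameters. -/
noncomputable def family : Cochain B := fun M j => c.familyCoef (M.1 0) (M.1 1) (M.1 2) j

/-- The recursions, parity conditions and initial values for the coefficients. -/
structure IsSolution {K : Type u} [Field K] [Algebra K B] (b : BaseData K B) : Prop where
  t1_even : b.inv (c.a .t1) = c.a .t1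
  t2_even : b.inv (c.a .t2) = c.a .t2
  th_odd : ∀ n, b.inv (c.a (.th n)) = -c.a (.th n)
  et_odd : ∀ n, b.inv (c.a (.et n)) = -c.a (.et n)
  r_odd : ∀ n, b.inv (c.r n) = -c.r n
  s_odd : ∀ n, b.inv (c.s n) = -c.s n
  y_odd : ∀ n, b.inv (c.y n) = -c.y n
  u_even : ∀ k l, b.inv (c.u k l) = c.u k l
  v_even : ∀ k l, b.inv (c.v k l) = c.v k l
  r_zero : c.r 0 = 0
  s_zero : c.s 0 = 0
  y_zero : c.y 0 = 0
  r_rec : ∀ k, c.r (k + 1) = c.a .t1 * c.a (.et (k + 2)) - c.a .t1 * c.r (k + 2)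
  s_one : c.s 1 = c.a .t2 * c.a (.th 1) + c.a .t1 * c.a (.et 1) - c.a .t1 * c.r 1
  s_eq : ∀ k, c.s (k + 2) = c.a .t2 * c.a (.th (k + 2))
  y_rec : ∀ k, c.y (k + 1) = -(c.a .t1 * c.s (k + 2)) - c.a .t2 * c.y (k + 2)
  u_rec : ∀ k l, c.u k l =
    -((((k + 2 : ℕ) : B) * c.a (.et (k + 1)) -
        ((l + 1 : ℕ) : B) * c.r (k + 1)) * c.y (l + 1)
      + c.a .t1 * c.u (k + 1) l + c.a .t2 * c.u k (l + 1))
  v_zero : ∀ k, c.v k 0 = 0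
  v_rec : ∀ k l, c.v k (l + 1) =
    -(((l + 1 : ℕ) : B) * (c.a (.th (l + 1)) * c.r (k + 1))
      - c.a (.et (k + 2)) * c.y (l + 1)
      + ((l + 1 : ℕ) : B) * (c.r (k + 2) * c.y (l + 1))
      - c.a .t1 * c.u (k + 2) l + c.a .t1 * c.v (k + 1) (l + 1))

/-- The value of the relation that belongs to a parameter. -/
noncomputable def rel (K : Type u) [Field K] [Algebra K B] : Param → B
  | .t1 => -(c.a .t1 * c.a (.et 0)) + c.a .t1 * c.s 1 + c.a .t2 * c.y 1
  | .t2 => -(c.a .t2 * c.a (.th 0))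
  | .th n => -(c.a (.et 1) * c.y n) + (n : B) * (c.r 1 * c.y n)
    - (if n = 0 then 0 else c.a .t1 * c.u 1 (n - 1)) + c.a .t1 * c.v 0 n
    + ∑ kl ∈ Finset.HasAntidiagonal.antidiagonal n,
        ((2⁻¹ * ((kl.1 : K) - (kl.2 : K))) • (c.a (.th kl.1) * c.a (.th kl.2))
          + (kl.1 : K) • (c.a (.th kl.1) * c.s (kl.2 + 1)))
  | .et n => c.a .t2 * c.u n 0 + ∑ kl ∈ Finset.HasAntidiagonal.antidiagonal n,
    (2⁻¹ * ((kl.1 : K) - (kl.2 : K))) • (c.a (.et kl.1) * c.a (.et kl.2))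

end

theorem family_coef {B : Type v} [Ring B] (c : Values B) {a : ℕ} (ha : a ≤ 1) (p q : ℕ) (j : Fin 3)
    (h : a = 1 ∨ 0 < p + q) : c.family.coef (mi a p q) j = c.familyCoef a p q j :=
  coef_ofFun c.familyCoef ha (by omega) j

theorem family_coef_one {B : Type v} [Ring B] (c : Values B) (p q : ℕ) (j : Fin 3) :
    c.family.coef (mi 1 p q) j = c.familyCoef 1 p q j :=
  c.family_coef le_rfl p q j (Or.inl rfl)

theorem ser_family_one_zero {B : Type v} [Ring B] (c : Values B) :
    ser c.family 1 0 = onlyY (fun n => c.a (.th n)) + onlyX (fun n => c.a (.et n)) := by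
  ext q p
  rw [coeff_ser, c.family_coef_one]
  simp [familyCoef, coeff_onlyX, coeff_onlyY]

theorem serInv_const {K : Type u} [Field K] {B : Type v} [Ring B] [Algebra K B] (b : BaseData K B)
    (x : B) : serInv b (const x) = const (b.inv x) := by
  simp [serInv, const]

namespace IsSolution

variable {K : Type u} [Field K] {B : Type v} [Ring B] [Algebra K B] {b : BaseData K B}
  {c : Values B} (hc : c.IsSolution b)

include hc

theorem family_coef_zero (p q : ℕ) (j : Fin 3) :
    c.family.coef (mi 0 p q) j = c.familyCoef 0 p q j := by
  rcases Nat.eq_zero_or_pos (p + q) with h | h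
  · obtain ⟨rfl, rfl⟩ : p = 0 ∧ q = 0 := by omega
    fin_cases j <;> simp [familyCoef, hc.y_zero, hc.s_zero]
  · exact c.family_coef zero_le_one p q j (Or.inr h)

theorem ser_zero_zero :
    ser c.family 0 0 = sx * sy + sy * const (c.a .t1) + sx * const (c.a .t2) := by
  ext q p
  rw [coeff_ser, hc.family_coef_zero]
  rw [← mul_one sy, mul_assoc sy, one_mul]
  simp only [map_add, coeff_sx, coeff_sy, coeff_coeff_one, coeff_const, familyCoef, if_true,
    ← ite_and]
  congr 1
  · congr 1
    · exact if_congr (by omega) rfl rfl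
    · exact if_congr (by omega) rfl rfl
  · exact if_congr (by omega) rfl rfl

theorem ser_zero_one :
    ser c.family 0 1 = sx * onlyX (fun n => c.a (.et n)) + onlyY c.y := by
  ext q p
  rw [coeff_ser, hc.family_coef_zero]
  simp [familyCoef, coeff_onlyX, coeff_onlyY, coeff_sx, ite_and]

theorem ser_zero_two : ser c.family 0 2 =
    sy * onlyY (fun n => c.a (.th n)) + sy * onlyX c.r + onlyY c.s := by
  ext q p
  rw [coeff_ser, hc.family_coef_zero]
  simp only [map_add, coeff_onlyX, coeff_onlyY, coeff_sy, familyCoef, ← ite_and, if_true]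
  rw [if_neg (by decide), if_neg (by decide)]
  congr 1
  congr 1
  · exact if_congr (by omega) rfl rfl
  · exact if_congr (by omega) rfl rfl

theorem isOdd : IsOdd b c.family := by
  apply cochain_ext <;> intro p q j <;> rw [parityInv_coef, coef_neg]
  · rw [hc.family_coef_zero]
    fin_cases j <;>
    simp [familyCoef, apply_ite b.inv, hc.t1_even, hc.t2_even, hc.th_odd, hc.et_odd, hc.r_odd,
      hc.s_odd, hc.y_odd, neg_ite, add_comm]
  · rw [c.family_coef_one]
    fin_cases j <;>
    simp [familyCoef, apply_ite b.inv, hc.th_odd, hc.et_odd, hc.u_even, hc.v_even, neg_ite,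
      add_comm]

theorem derInner_ser : derInner (ser c.family 0 0) = sy + const (c.a .t2) := by
  rw [hc.ser_zero_zero]
  simp only [map_add, derInner_mul, derInner_sx, derInner_sy, derInner_const, mul_zero, zero_mul,
    one_mul, add_zero]

theorem der_ser : der (ser c.family 0 0) = sx + const (c.a .t1) := by
  rw [hc.ser_zero_zero]
  simp only [map_add, der_mul, der_sx, der_sy, der_const, mul_zero, zero_mul,
    one_mul, mul_one, add_zero, zero_add]

theorem serInv_ser_one_zero : serInv b (ser c.family 1 0) = -ser c.family 1 0 := by
  ext q p
  rw [coeff_serInv, map_neg, map_neg, coeff_ser]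
  simpa using hc.isOdd.coef 1 p q 0

theorem serInv_ser_one {j : Fin 3} (hj : j ≠ 0) :
    serInv b (ser c.family 1 j) = ser c.family 1 j := by
  ext q p
  rw [coeff_serInv, coeff_ser]
  simpa [hj] using hc.isOdd.coef 1 p q j

theorem t1_comm (hb : b.IsFormal) (x : B) : x * c.a .t1 = c.a .t1 * x :=
  (hb.even_comm _ x hc.t1_even).symm

theorem t2_comm (hb : b.IsFormal) (x : B) : x * c.a .t2 = c.a .t2 * x :=
  (hb.even_comm _ x hc.t2_even).symm

/-- The `∂_ξ` component at `ξ^0` is linear in the unknowns `r`, `s`, `y`, since the family there is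
only `xy + t¹ y + t² x`; this is why those three are determined before `u` and `v`. -/
theorem comp_coef_zero_zero (hb : b.IsFormal) (p q : ℕ) :
    (comp b c.family c.family).coef (mi 0 p q) 0 =
      (if 1 ≤ q ∧ p = 0 then c.y (q - 1) else 0) + (if p = 0 then c.a .t2 * c.y q else 0)
      + (if 1 ≤ p ∧ q = 1 then c.r (p - 1) else 0) + (if p = 1 then c.s q else 0)
      + (if q = 1 then c.a .t1 * c.r p else 0) + (if p = 0 then c.a .t1 * c.s q else 0)
      - (if p = 1 then c.a .t2 * c.a (.th q) else 0)
      - (if q = 1 then c.a .t1 * c.a (.et p) else 0) := by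
  rw [← coeff_ser, ser_comp_zero, hc.derInner_ser, hc.der_ser, hc.serInv_ser_one_zero,
    c.ser_family_one_zero, hc.ser_zero_zero, hc.ser_zero_one, hc.ser_zero_two]
  simp only [add_mul, mul_add, neg_mul, neg_add_rev, map_add, map_neg, coeff_sx,
    coeff_sy, coeff_mul_sy, coeff_mul_sx_mul, coeff_mul_sy_mul, coeff_const_mul,
    coeff_mul_const, coeff_onlyX, coeff_onlyY, hc.t1_comm hb, hc.t2_comm hb]
  rcases p with - | - | p <;> rcases q with - | - | q <;> simp <;> abel

/-- The coefficients of `c.family ∘ c.family` at `φ^{0,p,q}_2`. -/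
theorem comp_coef_zero_one (hb : b.IsFormal) (p q : ℕ) :
    (comp b c.family c.family).coef (mi 0 p q) 1 =
      (if 1 ≤ p ∧ q = 0 then cauchy (fun n => ((n + 1 : ℕ) : B) * c.a (.et n))
        (fun n => c.a (.et n)) (p - 1) else 0)
      + ((p + 1 : ℕ) : B) * c.a (.et p) * c.y q
      + (if 1 ≤ q ∧ p = 0 then cauchy (fun n => ((n + 1 : ℕ) : B) * c.y (n + 1))
        (fun n => c.a (.th n)) (q - 1) else 0)
      + (if 1 ≤ q then (q : B) * c.y q * c.r p else 0)
      + (if p = 0 then cauchy (fun n => ((n + 1 : ℕ) : B) * c.y (n + 1)) c.s q else 0)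
      + (if 1 ≤ p ∧ 1 ≤ q then c.u (p - 1) (q - 1) else 0)
      + (if 1 ≤ q then c.a .t1 * c.u p (q - 1) else 0)
      + (if 1 ≤ p then c.a .t2 * c.u (p - 1) q else 0) := by
  have hu : ∀ p q, coeff p (coeff q (ser c.family 1 1)) = c.u p q := by
    intro p q
    rw [coeff_ser, c.family_coef_one]
    simp [familyCoef]
  have h1 : derInner (sx * onlyX (fun n => c.a (.et n)) + onlyY c.y) =
      onlyX fun n => ((n + 1 : ℕ) : B) * c.a (.et n) := by
    rw [map_add, derInner_sx_onlyX, derInner_onlyY, add_zero]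
  have h2 : der (sx * onlyX (fun n => c.a (.et n)) + onlyY c.y) =
      onlyY fun n => ((n + 1 : ℕ) : B) * c.y (n + 1) := by
    rw [map_add, der_mul, der_sx, der_onlyX, der_onlyY, zero_mul, mul_zero, add_zero, zero_add]
  rw [← coeff_ser, ser_comp_zero, hc.serInv_ser_one one_ne_zero, hc.ser_zero_zero, hc.ser_zero_one,
    hc.ser_zero_two, h1, h2]
  simp only [mul_add, mul_assoc, map_add, coeff_mul_sy, coeff_mul_sx_mul, coeff_mul_sy_mul,
    coeff_mul_const, coeff_onlyX_mul_onlyY, coeff_onlyY_mul_onlyX, onlyX_mul_onlyX,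
    onlyY_mul_onlyY, coeff_onlyX, coeff_onlyY, hc.t1_comm hb, hc.t2_comm hb, hu]
  rcases p with - | p <;> rcases q with - | q <;> simp <;> abel

/-- The coefficients of `c.family ∘ c.family` at `φ^{1,p,q}_1`. -/
theorem comp_coef_one_zero [CharZero K] (hb : b.IsFormal) (p q : ℕ) :
    (comp b c.family c.family).coef (mi 1 p q) 0 =
      (if 1 ≤ q then c.u p (q - 1) else 0) + c.a .t2 * c.u p q
      + (if 1 ≤ p ∧ q = 0 then cauchy (fun n => ((n + 1 : ℕ) : B) * c.a (.et (n + 1)))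
        (fun n => c.a (.et n)) (p - 1) else 0)
      + ((p + 1 : ℕ) : B) * c.a (.et (p + 1)) * c.y q
      + (if 1 ≤ p then c.v (p - 1) q else 0) + c.a .t1 * c.v p q
      + (if 1 ≤ q ∧ p = 0 then cauchy (fun n => ((n + 1 : ℕ) : B) * c.a (.th (n + 1)))
        (fun n => c.a (.th n)) (q - 1) else 0)
      + (if 1 ≤ q then (q : B) * c.a (.th q) * c.r p else 0)
      + (if p = 0 then cauchy (fun n => ((n + 1 : ℕ) : B) * c.a (.th (n + 1))) c.s q else 0) := by
  have hu : ∀ p q, coeff p (coeff q (ser c.family 1 1)) = c.u p q := by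
    intro p q
    rw [coeff_ser, c.family_coef_one]
    simp [familyCoef]
  have hv : ∀ p q, coeff p (coeff q (ser c.family 1 2)) = c.v p q := by
    intro p q
    rw [coeff_ser, c.family_coef_one]
    simp [familyCoef]
  -- An odd element squares to zero when two is invertible; the `ξ ∂_ξ` part of the family therefore
  -- does not act on itself.
  have hsq : ser c.family 1 0 * ser c.family 1 0 = 0 := by
    have := hb.superComm.powerSeries.powerSeries.odd_anticomm _ _ hc.serInv_ser_one_zero
      hc.serInv_ser_one_zero
    rw [eq_neg_iff_add_eq_zero, ← two_smul K, smul_eq_zero_iff_right two_ne_zero] at this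
    exact this
  have h1 : derInner (ser c.family 1 0) = onlyX fun n => ((n + 1 : ℕ) : B) * c.a (.et (n + 1)) := by
    rw [c.ser_family_one_zero, map_add, derInner_onlyX, derInner_onlyY, zero_add]
  have h2 : der (ser c.family 1 0) = onlyY fun n => ((n + 1 : ℕ) : B) * c.a (.th (n + 1)) := by
    rw [c.ser_family_one_zero, map_add, der_onlyX, der_onlyY, add_zero]
  have h3 : serInv b (sy + const (c.a .t2)) = sy + const (c.a .t2) := by
    rw [map_add, serInv_sy, serInv_const, hc.t2_even]
  have h4 : serInv b (sx + const (c.a .t1)) = sx + const (c.a .t1) := by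
    rw [map_add, serInv_sx, serInv_const, hc.t1_even]
  rw [← coeff_ser, ser_comp_one, hsq, hc.derInner_ser, hc.der_ser, h1, h2, h3, h4, hc.ser_zero_one,
    hc.ser_zero_two]
  simp only [add_mul, mul_add, mul_assoc, map_add, add_zero, coeff_sx,
    coeff_sy, coeff_mul_sx_mul, coeff_mul_sy_mul, coeff_const_mul,
    coeff_onlyX_mul_onlyY, coeff_onlyY_mul_onlyX, onlyX_mul_onlyX,
    onlyY_mul_onlyY, coeff_onlyX, coeff_onlyY, hu, hv]
  rcases p with - | p <;> rcases q with - | q <;> simp <;> abel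

end IsSolution

end Values

end SuperDeform

namespace SuperDeform

/-! ### The square of the family: normal form and relations. -/

namespace Values

/-- The values at which a weighted sum of products of anticommuting elements is antisymmetrized. -/
theorem sum_antidiagonal_anticomm {K : Type u} [Field K] [CharZero K] {B : Type v} [Ring B]
    [Algebra K B] {g : ℕ → B} (hg : ∀ i j, g i * g j = -(g j * g i)) (w : ℕ → K) (n : ℕ) :
    ∑ kl ∈ Finset.HasAntidiagonal.antidiagonal n, w kl.1 • (g kl.1 * g kl.2) =
      ∑ kl ∈ Finset.HasAntidiagonal.antidiagonal n,
        (2⁻¹ * (w kl.1 - w kl.2)) • (g kl.1 * g kl.2) := by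
  have h : ∑ kl ∈ Finset.HasAntidiagonal.antidiagonal n, w kl.1 • (g kl.1 * g kl.2) =
      -∑ kl ∈ Finset.HasAntidiagonal.antidiagonal n, w kl.2 • (g kl.1 * g kl.2) := by
    rw [← Finset.Nat.sum_antidiagonal_swap, ← Finset.sum_neg_distrib]
    refine Finset.sum_congr rfl fun kl _ => ?_
    rw [Prod.fst_swap, Prod.snd_swap, hg, smul_neg]
  simp only [mul_sub, sub_smul, Finset.sum_sub_distrib, mul_smul, ← Finset.smul_sum]
  rw [← smul_sub, eq_comm, inv_smul_eq_iff₀ two_ne_zero, two_smul]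
  rw [sub_eq_add_neg, ← h]

namespace IsSolution

variable {K : Type u} [Field K] {B : Type v} [Ring B] [Algebra K B] {b : BaseData K B}
  {c : Values B} (hc : c.IsSolution b) (hb : b.IsFormal)

include hc hb

theorem et_anticomm (i j : ℕ) : c.a (.et i) * c.a (.et j) = -(c.a (.et j) * c.a (.et i)) :=
  hb.odd_anticomm _ _ (hc.et_odd i) (hc.et_odd j)

theorem th_anticomm (i j : ℕ) : c.a (.th i) * c.a (.th j) = -(c.a (.th j) * c.a (.th i)) :=
  hb.odd_anticomm _ _ (hc.th_odd i) (hc.th_odd j)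

variable [CharZero K]

theorem cauchy_et_one (n : ℕ) : cauchy (fun n => ((n + 1 : ℕ) : B) * c.a (.et n))
    (fun n => c.a (.et n)) n = ∑ kl ∈ Finset.HasAntidiagonal.antidiagonal n,
      (2⁻¹ * ((kl.1 : K) - (kl.2 : K))) • (c.a (.et kl.1) * c.a (.et kl.2)) := by
  have h := sum_antidiagonal_anticomm (fun i j => hc.et_anticomm hb i j)
    (fun i => ((i + 1 : ℕ) : K)) n
  simp only [Nat.cast_add, add_sub_add_right_eq_sub] at h
  rw [← h, cauchy]
  refine Finset.sum_congr rfl fun kl _ => ?_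
  rw [← Nat.cast_add, Nat.cast_smul_eq_nsmul, nsmul_eq_mul, mul_assoc]

/-- The weights `k` and `k + 1` have the same differences, hence the same antisymmetrization; with
weight `k` the term `k = 0` drops out and the index shifts. -/
theorem cauchy_et_two (n : ℕ) :
    cauchy (fun n => ((n + 1 : ℕ) : B) * c.a (.et (n + 1))) (fun n => c.a (.et n)) n =
    cauchy (fun n => ((n + 1 : ℕ) : B) * c.a (.et n)) (fun n => c.a (.et n)) (n + 1) := by
  have h1 : ∑ kl ∈ Finset.HasAntidiagonal.antidiagonal (n + 1),
      (kl.1 : K) • (c.a (.et kl.1) * c.a (.et kl.2)) =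
      cauchy (fun n => ((n + 1 : ℕ) : B) * c.a (.et (n + 1))) (fun n => c.a (.et n)) n := by
    rw [Finset.Nat.sum_antidiagonal_succ, Nat.cast_zero, zero_smul, zero_add]
    refine Finset.sum_congr rfl fun kl _ => ?_
    rw [Nat.cast_smul_eq_nsmul, nsmul_eq_mul, mul_assoc]
  rw [← h1, hc.cauchy_et_one hb, sum_antidiagonal_anticomm (fun i j => hc.et_anticomm hb i j)
    (fun i => (i : K))]

/-- Each recursion cancels one set of coefficients: those of `y`, `s`, `r` the `∂_ξ` monomials of
degree at least two with `p = 0`, `p = 1`, `p ≥ 2`, that of `u` the `one`-components and that of `v`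
the `two`-components. -/
theorem normal_comp : Normal (⊥ : Submodule K B) (comp b c.family c.family) where
  zero p q h := by
    rw [Submodule.mem_bot, hc.comp_coef_zero_zero hb]
    rcases p with - | - | p
    · obtain ⟨q, rfl⟩ : ∃ k, q = k + 2 := ⟨q - 2, by omega⟩
      simp [hc.y_rec q]
    · rcases q with - | - | q
      · omega
      · simp [hc.s_one, hc.r_zero]
      · simp [hc.s_eq]
    · rcases q with - | - | q
      · simp
      · simp [hc.r_rec p]
      · simp
  one p q := by
    rw [Submodule.mem_bot, hc.comp_coef_zero_one hb]
    have h : c.y (q + 1) * c.r (p + 1) = -(c.r (p + 1) * c.y (q + 1)) :=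
      hb.odd_anticomm _ _ (hc.y_odd _) (hc.r_odd _)
    simp [hc.u_rec p q, mul_assoc, h, sub_mul, add_mul, two_mul]
    abel
  two p q := by
    rw [Submodule.mem_bot, hc.comp_coef_zero_one hb, hc.comp_coef_one_zero hb]
    rcases q with - | q
    -- For `q = 0` there is no unknown left, because `v^{k,0} = 0`; the quadratic sums in the `η`
    -- cancel by themselves.
    · have h := hc.cauchy_et_two hb p
      simp [hc.v_zero, hc.y_zero, Nat.cast_add] at h ⊢
      rw [h]
      abel
    · have h : c.y (q + 1) * c.r (p + 2) = -(c.r (p + 2) * c.y (q + 1)) :=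
        hb.odd_anticomm _ _ (hc.y_odd _) (hc.r_odd _)
      simp [hc.v_rec p q, mul_assoc, h, add_mul, two_mul, show p + 1 + 1 = p + 2 from rfl]
      abel

/-- The recursions leave the class components of the square free; they are the obstructions. The
factors `(k - l) / 2` come from antisymmetrizing sums with weight `k` over anticommuting parameters.
-/
theorem harm_comp (i : Param) : harm (comp b c.family c.family) i = c.rel K i := by
  cases i with
  | t1 =>
    rw [harm, hc.comp_coef_zero_zero hb]
    simp [rel, hc.y_zero, hc.r_zero]
    abel
  | t2 =>
    rw [harm, hc.comp_coef_zero_zero hb]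
    simp [rel, hc.s_zero]
  | et n =>
    rw [harm, hc.comp_coef_zero_one hb, rel, ← hc.cauchy_et_one hb]
    simp [hc.y_zero]
    abel
  | th n =>
    have h1 : ∑ kl ∈ Finset.HasAntidiagonal.antidiagonal n,
        (kl.1 : K) • (c.a (.th kl.1) * c.s (kl.2 + 1)) =
        cauchy (fun n => ((n + 1 : ℕ) : B) * c.a (.th (n + 1))) c.s n := by
      have h2 : ∑ kl ∈ Finset.HasAntidiagonal.antidiagonal (n + 1),
          (kl.1 : K) • (c.a (.th kl.1) * c.s kl.2) =
          cauchy (fun n => ((n + 1 : ℕ) : B) * c.a (.th (n + 1))) c.s n := by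
        rw [Finset.Nat.sum_antidiagonal_succ, Nat.cast_zero, zero_smul, zero_add]
        refine Finset.sum_congr rfl fun kl _ => ?_
        rw [Nat.cast_smul_eq_nsmul, nsmul_eq_mul, mul_assoc]
      rw [← h2, Finset.Nat.sum_antidiagonal_succ', hc.s_zero, mul_zero, smul_zero, zero_add]
    rw [harm, hc.comp_coef_zero_one hb, hc.comp_coef_one_zero hb, rel, Finset.sum_add_distrib,
      ← sum_antidiagonal_anticomm (fun i j => hc.th_anticomm hb i j) (fun i => (i : K)), h1]
    rcases n with - | n
    · have h := hc.cauchy_et_one hb 0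
      simp at h
      simp [hc.y_zero, h]
      abel
    · have h : c.y (n + 1) * c.r 1 = -(c.r 1 * c.y (n + 1)) :=
        hb.odd_anticomm _ _ (hc.y_odd _) (hc.r_odd _)
      have h2 : ∑ kl ∈ Finset.HasAntidiagonal.antidiagonal (n + 1),
          (kl.1 : K) • (c.a (.th kl.1) * c.a (.th kl.2)) =
          cauchy (fun n => ((n + 1 : ℕ) : B) * c.a (.th (n + 1))) (fun n => c.a (.th n)) n := by
        rw [Finset.Nat.sum_antidiagonal_succ, Nat.cast_zero, zero_smul, zero_add]
        refine Finset.sum_congr rfl fun kl _ => ?_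
        rw [Nat.cast_smul_eq_nsmul, nsmul_eq_mul, mul_assoc]
      rw [h2]
      simp [hc.r_zero, mul_assoc, h, add_mul, two_mul]
      abel

end IsSolution

end Values

end SuperDeform

namespace SuperDeform

/-- Square minus triangle leaves only terms with `i + j ≥ n`. This compares a product of two partial
sums with the partial sum of the Cauchy product, both for exponentials and for the evaluation of
power series. -/
theorem sum_range_sub_sum_antidiagonal_mem {A : Type*} [AddCommGroup A] (G : AddSubgroup A) (n : ℕ)
    (F : ℕ → ℕ → A) (h : ∀ i j, n ≤ i + j → F i j ∈ G) :
    ∑ i ∈ Finset.range n, ∑ j ∈ Finset.range n, F i j -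
      ∑ m ∈ Finset.range n, ∑ kl ∈ Finset.HasAntidiagonal.antidiagonal m, F kl.1 kl.2 ∈ G := by
  have h1 : ∑ m ∈ Finset.range n, ∑ kl ∈ Finset.HasAntidiagonal.antidiagonal m, F kl.1 kl.2 =
      ∑ i ∈ Finset.range n, ∑ j ∈ Finset.range (n - i), F i j := by
    rw [← Finset.sum_range_diag_flip]
    exact Finset.sum_congr rfl fun m _ => Finset.Nat.sum_antidiagonal_eq_sum_range_succ F m
  rw [h1, ← Finset.sum_sub_distrib]
  refine sum_mem fun i hi => ?_
  have h2 : Finset.range (n - i) ⊆ Finset.range n := Finset.range_subset_range.mpr (Nat.sub_le _ _)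
  rw [← Finset.sum_sdiff h2, add_sub_cancel_right]
  refine sum_mem fun j hj => h i j ?_
  rw [Finset.mem_sdiff, Finset.mem_range, Finset.mem_range] at hj
  omega

section Gauge

variable {K : Type u} [Field K] {B : Type v} [Ring B] [Algebra K B] {b : BaseData K B}

/-! ### Rigidity of solutions in normal form -/

theorem normal_bot_of_fil (hb : b.IsFormal) {X : Cochain B} (h : ∀ n, Normal (b.fil n) X) :
    Normal (⊥ : Submodule K B) X where
  zero p q hpq := (Submodule.mem_bot K).mpr (hb.separated _ fun n => (h n).zero p q hpq)
  one p q := (Submodule.mem_bot K).mpr (hb.separated _ fun n => (h n).one p q)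
  two p q := (Submodule.mem_bot K).mpr (hb.separated _ fun n => (h n).two p q)

/-- The obstruction vanishes if its cohomological components vanish. -/
theorem comp_self_eq_zero [CharZero K] (hb : b.IsFormal) {X : Cochain B} (hX : IsOdd b X)
    (hX1 : X - dB B ∈ cochainsIn (b.fil 1)) (hN : Normal (⊥ : Submodule K B) (comp b X X))
    (hH : ∀ i, harm (comp b X X) i = 0) : comp b X X = 0 := by
  refine eq_zero_of_mem_fil hb fun n => ?_
  induction n with
  | zero => exact mem_cochainsIn_fil_zero hb _
  | succ n ih =>
    refine (hN.mono bot_le).mem_of_cob hb.inv_inv (hb.fil_inv _) (fun i => ?_) (normal_of_mem ?_)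
    · rw [hH]; exact zero_mem _
    -- By the Bianchi identity `ad (X ∘ X)` kills `X`, so `d` may be replaced by `d - X`, which
    -- gains one order.
    · have h : cob b (comp b X X) = -ad b (comp b X X) (X - dB B) := by
        rw [cob_even (hX.comp hX), map_sub, ad_apply (comp b X X) X, comp_self_comp hb hX, sub_self,
          zero_sub, neg_neg]
      rw [h]
      exact neg_mem (ad_mem hb ih hX1)

/-- A solution in normal form is determined by its cohomological components. -/
theorem eq_of_normal (hb : b.IsFormal) {Z X : Cochain B} (hZ : IsOdd b Z)
    (hX : IsOdd b X) (hZ1 : Z - dB B ∈ cochainsIn (b.fil 1))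
    (hX1 : X - dB B ∈ cochainsIn (b.fil 1)) (hZN : Normal (⊥ : Submodule K B) (Z - dB B))
    (hXN : Normal (⊥ : Submodule K B) (X - dB B)) (hH : ∀ i, harm Z i = harm X i)
    (hZZ : Normal (⊥ : Submodule K B) (comp b Z Z))
    (hXX : Normal (⊥ : Submodule K B) (comp b X X)) : Z = X := by
  rw [← sub_eq_zero]
  refine eq_zero_of_mem_fil hb fun n => ?_
  induction n with
  | zero => exact mem_cochainsIn_fil_zero hb _
  | succ n ih =>
    have hN : Normal (⊥ : Submodule K B) (Z - X) := by
      have := hZN.sub hXN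
      rwa [sub_sub_sub_cancel_right] at this
    refine (hN.mono bot_le).mem_of_cob hb.inv_inv (hb.fil_inv _) (fun i => ?_) ?_
    · rw [harm_sub, hH, sub_self]; exact zero_mem _
    -- The difference of the squares is linear in `Z - X`: its leading part is the coboundary, and
    -- the rest contains a factor from the maximal ideal. Only normality of the two squares enters,
    -- not their vanishing.
    · have h : cob b (Z - X) = (comp b Z Z - comp b X X) -
          (comp b (Z - X) (Z - dB B) + comp b (X - dB B) (Z - X)) := by
        rw [cob_odd (hZ.sub hX)]
        simp only [comp_sub_left, comp_sub_right]
        abel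
      rw [h]
      refine ((hZZ.sub hXX).mono bot_le).sub (normal_of_mem (add_mem (comp_mem hb ih hZ1) ?_))
      rw [add_comm]
      exact comp_mem hb hX1 ih

/-! ### Exponentials -/

theorem iterate_ad_mem (hb : b.IsFormal) {φ : Cochain B} (hφ : φ ∈ cochainsIn (b.fil 1))
    {i : ℕ} {X : Cochain B} (hX : X ∈ cochainsIn (b.fil i)) (k : ℕ) :
    (ad b φ)^[k] X ∈ cochainsIn (b.fil (i + k)) := by
  induction k with
  | zero => exact hX
  | succ k ih =>
    rw [Function.iterate_succ_apply', ← add_assoc, add_comm]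
    exact ad_mem hb hφ ih

variable (b) in
/-- The partial sums of `exp (ad φ) (Z)`. -/
noncomputable def expSum (φ Z : Cochain B) (n : ℕ) : Cochain B :=
  ∑ k ∈ Finset.range n, ((k.factorial : K)⁻¹) • (ad b φ)^[k] Z

theorem expSum_succ (φ Z : Cochain B) (n : ℕ) :
    expSum b φ Z (n + 1) = expSum b φ Z n + ((n.factorial : K)⁻¹) • (ad b φ)^[n] Z :=
  Finset.sum_range_succ _ _

/-- The difference of two iterates telescopes into terms that contain `φ - φ'` or `Z - Z'`; this
makes the exponential continuous and allows the passage to the limit in `exists_normal`. -/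
theorem iterate_ad_congr (hb : b.IsFormal) {n : ℕ} {φ φ' Z Z' : Cochain B}
    (hφ : φ - φ' ∈ cochainsIn (b.fil n)) (hZ : Z - Z' ∈ cochainsIn (b.fil n)) (k : ℕ) :
    (ad b φ)^[k] Z - (ad b φ')^[k] Z' ∈ cochainsIn (b.fil n) := by
  induction k with
  | zero => exact hZ
  | succ k ih =>
    rw [Function.iterate_succ_apply', Function.iterate_succ_apply']
    have : ad b φ ((ad b φ)^[k] Z) - ad b φ' ((ad b φ')^[k] Z') =
        ad b φ ((ad b φ)^[k] Z - (ad b φ')^[k] Z') + ad b (φ - φ') ((ad b φ')^[k] Z') := by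
      rw [map_sub, ad_sub]
      abel
    rw [this]
    refine add_mem ?_ (ad_mem (j := 0) hb hφ (mem_cochainsIn_fil_zero hb _))
    have := ad_mem hb (mem_cochainsIn_fil_zero hb φ) ih
    rwa [zero_add] at this

theorem expSum_congr (hb : b.IsFormal) {n : ℕ} {φ φ' Z Z' : Cochain B}
    (hφ : φ - φ' ∈ cochainsIn (b.fil n)) (hZ : Z - Z' ∈ cochainsIn (b.fil n)) (m : ℕ) :
    expSum b φ Z m - expSum b φ' Z' m ∈ cochainsIn (b.fil n) := by
  rw [expSum, expSum, ← Finset.sum_sub_distrib]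
  refine sum_mem fun k _ => ?_
  rw [← smul_sub]
  exact Submodule.smul_mem _ _ (iterate_ad_congr hb hφ hZ k)

/-- First-order perturbation: since `φ` and `Z - d` have positive order, a change of order `n + 1`
in both arguments affects the exponential in that order only through `N + [ζ, d]`. Iterates from the
second one on change in order `n + 2` only. -/
theorem iterate_ad_perturb (hb : b.IsFormal) {n : ℕ} {φ ζ Z N : Cochain B}
    (hφ : φ ∈ cochainsIn (b.fil 1)) (hζ : ζ ∈ cochainsIn (b.fil (n + 1)))
    (hZ : Z - dB B ∈ cochainsIn (b.fil 1)) (hN : N ∈ cochainsIn (b.fil (n + 1))) :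
    (ad b (φ + ζ) (Z + N) - ad b φ Z) - ad b ζ (dB B) ∈ cochainsIn (b.fil (n + 2)) ∧
    ∀ k, (ad b (φ + ζ))^[k + 2] (Z + N) - (ad b φ)^[k + 2] Z ∈ cochainsIn (b.fil (n + 2)) := by
  have h1 : (ad b (φ + ζ) (Z + N) - ad b φ Z) - ad b ζ (dB B) ∈ cochainsIn (b.fil (n + 2)) := by
    have : (ad b (φ + ζ) (Z + N) - ad b φ Z) - ad b ζ (dB B) =
        ad b φ N + ad b ζ N + ad b ζ (Z - dB B) := by
      rw [ad_add, map_add, map_add, map_sub]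
      abel
    rw [this]
    have h3 := ad_mem hb hζ hZ
    refine add_mem (add_mem ?_ ?_) h3
    · exact cochainsIn_mono (hb.fil_anti (by omega)) (ad_mem hb hφ hN)
    · exact cochainsIn_mono (hb.fil_anti (by omega)) (ad_mem hb hζ hN)
  refine ⟨h1, fun k => ?_⟩
  have hφζ : φ + ζ ∈ cochainsIn (b.fil 1) :=
    add_mem hφ (cochainsIn_mono (hb.fil_anti (by omega)) hζ)
  have step : ∀ k, (ad b (φ + ζ))^[k + 1] (Z + N) - (ad b φ)^[k + 1] Z ∈
      cochainsIn (b.fil (n + 1)) → (ad b (φ + ζ))^[k + 2] (Z + N) - (ad b φ)^[k + 2] Z ∈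
      cochainsIn (b.fil (n + 2)) := by
    intro k ih
    rw [Function.iterate_succ_apply', Function.iterate_succ_apply' (ad b φ)]
    have : ad b (φ + ζ) ((ad b (φ + ζ))^[k + 1] (Z + N)) - ad b φ ((ad b φ)^[k + 1] Z) =
        ad b (φ + ζ) ((ad b (φ + ζ))^[k + 1] (Z + N) - (ad b φ)^[k + 1] Z) +
          ad b ζ ((ad b φ)^[k + 1] Z) := by
      rw [map_sub, ad_add φ ζ ((ad b φ)^[k + 1] Z)]
      abel
    rw [this]
    refine add_mem (cochainsIn_mono (hb.fil_anti (by omega)) (ad_mem hb hφζ ih)) ?_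
    have h2 := iterate_ad_mem hb hφ (mem_cochainsIn_fil_zero hb Z) (k + 1)
    exact cochainsIn_mono (hb.fil_anti (by omega)) (ad_mem hb hζ h2)
  induction k with
  | zero =>
    refine step 0 ?_
    have h3 := add_mem (cochainsIn_mono (hb.fil_succ_le _) h1)
      (ad_mem (j := 0) hb hζ (mem_cochainsIn_fil_zero hb (dB B)))
    rwa [sub_add_cancel] at h3
  | succ k ih => exact step (k + 1) (cochainsIn_mono (hb.fil_succ_le _) ih)

theorem expSum_perturb (hb : b.IsFormal) {n : ℕ} {φ ζ Z N : Cochain B}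
    (hφ : φ ∈ cochainsIn (b.fil 1)) (hζ : ζ ∈ cochainsIn (b.fil (n + 1)))
    (hZ : Z - dB B ∈ cochainsIn (b.fil 1)) (hN : N ∈ cochainsIn (b.fil (n + 1))) (m : ℕ) :
    expSum b (φ + ζ) (Z + N) (m + 2) - expSum b φ Z (m + 2) - (N + ad b ζ (dB B)) ∈
      cochainsIn (b.fil (n + 2)) := by
  obtain ⟨h1, h2⟩ := iterate_ad_perturb hb hφ hζ hZ hN
  induction m with
  | zero =>
    have : expSum b (φ + ζ) (Z + N) (0 + 2) - expSum b φ Z (0 + 2) - (N + ad b ζ (dB B)) =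
        (ad b (φ + ζ) (Z + N) - ad b φ Z) - ad b ζ (dB B) := by
      simp [expSum, Finset.sum_range_succ]
      abel
    rw [this]
    exact h1
  | succ m ih =>
    have h3 := add_mem ih
      (Submodule.smul_mem (cochainsIn (b.fil (n + 2))) (((m + 2).factorial : K)⁻¹) (h2 m))
    rw [show m + 1 + 2 = (m + 2) + 1 from rfl, expSum_succ _ _ (m + 2), expSum_succ φ Z (m + 2)]
    convert h3 using 1
    rw [smul_sub]
    abel

/-- Every odd cochain that reduces to `d` can be transformed into normal form. -/
theorem exists_normal [CharZero K] (hb : b.IsFormal) {Y : Cochain B} (hY : IsOdd b Y)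
    (hY1 : Y - dB B ∈ cochainsIn (b.fil 1)) :
    ∃ φ Z : Cochain B, IsEven b φ ∧ φ ∈ cochainsIn (b.fil 1) ∧ IsOdd b Z ∧
      Z - dB B ∈ cochainsIn (b.fil 1) ∧ Normal (⊥ : Submodule K B) (Z - dB B) ∧
      ∀ n, Y - expSum b φ Z n ∈ cochainsIn (b.fil n) := by
  -- The invariant of the approximation: a gauge parameter and an odd cochain in normal form whose
  -- exponential agrees with `Y` up to order `n + 1`.
  let P : ℕ → Cochain B × Cochain B → Prop := fun n x =>
    IsEven b x.1 ∧ x.1 ∈ cochainsIn (b.fil 1) ∧ IsOdd b x.2 ∧ x.2 - dB B ∈ cochainsIn (b.fil 1) ∧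
      Normal (⊥ : Submodule K B) (x.2 - dB B) ∧
      Y - expSum b x.1 x.2 (n + 1) ∈ cochainsIn (b.fil (n + 1))
  have hexpodd : ∀ φ Z : Cochain B, IsEven b φ → IsOdd b Z → ∀ n, IsOdd b (expSum b φ Z n) := by
    intro φ Z hφ hZ n
    have hit : ∀ k, IsOdd b ((ad b φ)^[k] Z) := by
      intro k
      induction k with
      | zero => exact hZ
      | succ k ih => rw [Function.iterate_succ_apply']; exact IsOdd.ad hφ ih
    induction n with
    | zero => simp [expSum, IsOdd, parityInv_zero]
    | succ n ih => rw [expSum_succ]; exact ih.add ((hit n).smul _)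
  have h0 : P 0 (0, dB B) := by
    refine ⟨parityInv_zero, zero_mem _, isOdd_dB, ?_, ?_, ?_⟩
    · rw [sub_self]; exact zero_mem _
    · rw [sub_self]; exact normal_of_mem (zero_mem _)
    · simpa [expSum] using hY1
  have hstep : ∀ n x, P n x → ∃ x', P (n + 1) x' ∧ x'.1 - x.1 ∈ cochainsIn (b.fil (n + 1)) ∧
      x'.2 - x.2 ∈ cochainsIn (b.fil (n + 1)) := by
    rintro n ⟨φ, Z⟩ ⟨hφe, hφ, hZo, hZ, hZN, hE⟩
    simp only at hφe hφ hZo hZ hZN hE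
    -- One more term than in the invariant is taken, so that the partial sum always contains the
    -- linear term in `ad φ`; the added term has order `n + 1` and is harmless.
    set E := Y - expSum b φ Z (n + 2) with hEdef
    have hE1 : E ∈ cochainsIn (b.fil (n + 1)) := by
      have h := sub_mem hE (Submodule.smul_mem (cochainsIn (b.fil (n + 1)))
        (((n + 1).factorial : K)⁻¹)
        (cochainsIn_mono (hb.fil_anti (Nat.le_add_left _ _))
          (iterate_ad_mem hb hφ (mem_cochainsIn_fil_zero hb Z) (n + 1))))
      rwa [sub_sub, ← expSum_succ] at h
    have hEo : IsOdd b E := hY.sub (hexpodd _ _ hφe hZo _)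
    have hζe : IsEven b (homotopy b E) := hEo.homotopy
    have hζ := homotopy_mem hb hE1
    have hcob := cob_even hζe
    have hN1 : E - cob b (homotopy b E) ∈ cochainsIn (b.fil (n + 1)) := by
      rw [hcob]
      exact sub_mem hE1 (ad_mem (j := 0) hb hζ (mem_cochainsIn_fil_zero hb _))
    -- The error is split into a coboundary, which the gauge parameter absorbs, and a normal
    -- remainder, which is added to `Z`.
    refine ⟨(φ + homotopy b E, Z + (E - cob b (homotopy b E))), ⟨?_, ?_, ?_, ?_, ?_, ?_⟩, ?_, ?_⟩
    · exact hφe.add hζe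
    · exact add_mem hφ (cochainsIn_mono (hb.fil_anti (by omega)) hζ)
    · refine hZo.add (hEo.sub ?_)
      rw [hcob]
      exact IsOdd.ad hζe isOdd_dB
    · simp only
      rw [add_sub_right_comm]
      exact add_mem hZ (cochainsIn_mono (hb.fil_anti (by omega)) hN1)
    · simp only
      rw [add_sub_right_comm]
      exact hZN.add (normal_sub_cob_homotopy hb.inv_inv E)
    -- For this choice `N + [ζ, d] = E`, so the error cancels modulo order `n + 2`.
    · have h := neg_mem (expSum_perturb hb hφ hζ hZ hN1 n)
      rw [← hcob, sub_add_cancel, hEdef, neg_sub] at h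
      convert h using 1
      abel
    · simpa using hζ
    · simpa using hN1
  choose! next hnext using hstep
  let x : ℕ → Cochain B × Cochain B := fun n => Nat.rec (0, dB B) (fun n x => next n x) n
  have hx : ∀ n, P n (x n) := by
    intro n
    induction n with
    | zero => exact h0
    | succ n ih => exact (hnext n _ ih).1
  have hlim : ∀ s : ℕ → Cochain B, (∀ n, s (n + 1) - s n ∈ cochainsIn (b.fil (n + 1))) →
      ∃ X, ∀ n, X - s n ∈ cochainsIn (b.fil n) := by
    intro s hs
    choose X hX using fun M j => hb.complete (fun n => s n M j)
      (fun n => hb.fil_succ_le _ (hs n M j))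
    exact ⟨X, fun n M j => hX M j n⟩
  obtain ⟨φ, hφ⟩ := hlim (fun n => (x n).1) fun n => (hnext n _ (hx n)).2.1
  obtain ⟨Z, hZ⟩ := hlim (fun n => (x n).2) fun n => (hnext n _ (hx n)).2.2
  refine ⟨φ, Z, ?_, ?_, ?_, ?_, ?_, fun n => ?_⟩
  · refine sub_eq_zero.mp (eq_zero_of_mem_fil hb fun n => ?_)
    have h := sub_mem (parityInv_mem hb (hφ n)) (hφ n)
    rwa [parityInv_sub, (hx n).1, sub_sub_sub_cancel_right] at h
  · have h := add_mem (hφ 1) (hx 1).2.1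
    rwa [sub_add_cancel] at h
  · refine sub_eq_zero.mp (eq_zero_of_mem_fil hb fun n => ?_)
    have h := add_mem (parityInv_mem hb (hZ n)) (hZ n)
    rw [parityInv_sub, (hx n).2.2.1] at h
    convert h using 1
    abel
  · have h := add_mem (hZ 1) (hx 1).2.2.2.1
    rwa [sub_add_sub_cancel] at h
  · refine normal_bot_of_fil hb fun n => ?_
    have h := (normal_of_mem (hZ n)).add ((hx n).2.2.2.2.1.mono bot_le)
    rwa [sub_add_sub_cancel] at h
  -- The last term of the partial sum has order `n` and is dropped; then the `n`-th approximation is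
  -- replaced by the limit, from which it differs in order `n`.
  · have h1 := cochainsIn_mono (hb.fil_succ_le n) (hx n).2.2.2.2.2
    rw [expSum_succ, ← sub_sub] at h1
    have h2 := iterate_ad_mem hb (hx n).2.1 (mem_cochainsIn_fil_zero hb (x n).2) n
    rw [zero_add] at h2
    have h3 := add_mem h1 (Submodule.smul_mem _ ((n.factorial : K)⁻¹) h2)
    rw [sub_add_cancel] at h3
    have h4 := sub_mem h3 (expSum_congr hb (hφ n) (hZ n) n)
    rwa [sub_sub_sub_cancel_right] at h4

/-- If `exp (ad φ) (Z)` is a solution then so is `Z`. -/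
theorem comp_self_of_exp [CharZero K] (hb : b.IsFormal) {φ Y Z : Cochain B} (hφe : IsEven b φ)
    (hφ : φ ∈ cochainsIn (b.fil 1)) (hZ : IsOdd b Z) (hY : comp b Y Y = 0)
    (h : ∀ n, Y - expSum b φ Z n ∈ cochainsIn (b.fil n)) : comp b Z Z = 0 := by
  set f : ℕ → Cochain B := fun k => ((k.factorial : K)⁻¹) • (ad b φ)^[k] Z with hf
  have hfs : ∀ k, ad b φ (f k) = ((k + 1 : ℕ) : K) • f (k + 1) := by
    intro k
    simp only [hf, map_smul, smul_smul]
    rw [Function.iterate_succ_apply', Nat.factorial_succ, Nat.cast_mul, mul_inv, ← mul_assoc,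
      mul_inv_cancel₀ (by exact_mod_cast Nat.succ_ne_zero k), one_mul]
  have hfo : ∀ k, IsOdd b (f k) := by
    intro k
    refine IsOdd.smul _ ?_
    induction k with
    | zero => exact hZ
    | succ k ih => rw [Function.iterate_succ_apply']; exact IsOdd.ad hφe ih
  have hfm : ∀ k, f k ∈ cochainsIn (b.fil k) := by
    intro k
    have := iterate_ad_mem hb hφ (mem_cochainsIn_fil_zero hb Z) k
    rw [zero_add] at this
    exact Submodule.smul_mem _ _ this
  set g : ℕ → Cochain B := fun m =>
    ∑ kl ∈ Finset.HasAntidiagonal.antidiagonal m, comp b (f kl.1) (f kl.2) with hg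
  -- The derivation rule is available only for the symmetrized product of odd cochains, so `g m` is
  -- doubled before `ad φ` is applied.
  have hg2 : ∀ m, (2 : K) • g m = ∑ kl ∈ Finset.HasAntidiagonal.antidiagonal m,
      (comp b (f kl.1) (f kl.2) + comp b (f kl.2) (f kl.1)) := by
    intro m
    rw [Finset.sum_add_distrib, two_smul]
    congr 1
    exact (Finset.Nat.sum_antidiagonal_swap
      (f := fun kl : ℕ × ℕ => comp b (f kl.1) (f kl.2))).symm
  -- Thus `g m` behaves like `(ad φ)^m (Z ∘ Z) / m!`: the exponential respects squares, term by
  -- term.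
  have hgs : ∀ m, ad b φ (g m) = ((m + 1 : ℕ) : K) • g (m + 1) := by
    intro m
    have h2 : (2 : K) • ad b φ (g m) = (2 : K) • (((m + 1 : ℕ) : K) • g (m + 1)) := by
      set c : ℕ → ℕ → Cochain B := fun i j => comp b (f i) (f j) + comp b (f j) (f i) with hc
      have e1 : (2 : K) • ad b φ (g m) = ∑ kl ∈ Finset.HasAntidiagonal.antidiagonal m,
          (((kl.1 + 1 : ℕ) : K) • c (kl.1 + 1) kl.2 + ((kl.2 + 1 : ℕ) : K) • c kl.1 (kl.2 + 1)) := by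
        rw [← map_smul, hg2, map_sum]
        refine Finset.sum_congr rfl fun kl _ => ?_
        rw [ad_comp_add_comp hb hφe (hfo _) (hfo _), hfs, hfs, comp_smul_left _ _ (f _),
          comp_smul_right _ _ _ (f _), comp_smul_left _ _ (f _), comp_smul_right _ _ _ (f _),
          ← smul_add, ← smul_add]
      have e2 : ∑ kl ∈ Finset.HasAntidiagonal.antidiagonal (m + 1), (kl.1 : K) • c kl.1 kl.2 =
          ∑ kl ∈ Finset.HasAntidiagonal.antidiagonal m,
            ((kl.1 + 1 : ℕ) : K) • c (kl.1 + 1) kl.2 := by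
        rw [Finset.Nat.sum_antidiagonal_succ, Nat.cast_zero, zero_smul, zero_add]
      have e3 : ∑ kl ∈ Finset.HasAntidiagonal.antidiagonal (m + 1), (kl.2 : K) • c kl.1 kl.2 =
          ∑ kl ∈ Finset.HasAntidiagonal.antidiagonal m,
            ((kl.2 + 1 : ℕ) : K) • c kl.1 (kl.2 + 1) := by
        rw [Finset.Nat.sum_antidiagonal_succ', Nat.cast_zero, zero_smul, zero_add]
      rw [e1, Finset.sum_add_distrib, ← e2, ← e3, ← Finset.sum_add_distrib, smul_comm, hg2,
        Finset.smul_sum]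
      refine Finset.sum_congr rfl fun kl hkl => ?_
      rw [← add_smul, ← Nat.cast_add, Finset.HasAntidiagonal.mem_antidiagonal.mp hkl]
    exact smul_right_injective _ (two_ne_zero (α := K)) h2
  have hgm : ∀ i, g 0 ∈ cochainsIn (b.fil i) → ∀ m, g m ∈ cochainsIn (b.fil (i + m)) := by
    intro i hi m
    induction m with
    | zero => exact hi
    | succ m ih =>
      have h1 := ad_mem hb hφ ih
      rw [hgs] at h1
      have h2 := Submodule.smul_mem _ (((m + 1 : ℕ) : K)⁻¹) h1
      rw [inv_smul_smul₀ (by exact_mod_cast Nat.succ_ne_zero m)] at h2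
      rwa [add_comm 1, add_assoc] at h2
  have hsum : ∀ n, ∑ m ∈ Finset.range n, g m ∈ cochainsIn (b.fil n) := by
    intro n
    have h1 : comp b (expSum b φ Z n) (expSum b φ Z n) ∈ cochainsIn (b.fil n) := by
      have h2 := neg_mem (add_mem (comp_mem_left hb (h n) Y)
        (comp_mem_right hb (expSum b φ Z n) (h n)))
      rw [comp_sub_left, comp_sub_right, hY] at h2
      convert h2 using 1
      abel
    have h2 : comp b (expSum b φ Z n) (expSum b φ Z n) =
        ∑ i ∈ Finset.range n, ∑ j ∈ Finset.range n, comp b (f i) (f j) := by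
      change compHom b (∑ i ∈ Finset.range n, f i) (∑ i ∈ Finset.range n, f i) = _
      rw [LinearMap.map_sum₂]
      exact Finset.sum_congr rfl fun i _ => map_sum _ _ _
    have h3 := sum_range_sub_sum_antidiagonal_mem (cochainsIn (b.fil n)).toAddSubgroup n
      (fun i j => comp b (f i) (f j)) fun i j hij =>
        cochainsIn_mono (hb.fil_anti hij) (comp_mem hb (hfm i) (hfm j))
    have h4 := sub_mem h1 h3
    rwa [h2, sub_sub_cancel] at h4
  have hg0 : ∀ i, g 0 ∈ cochainsIn (b.fil i) := by
    intro i
    induction i with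
    | zero => exact mem_cochainsIn_fil_zero hb _
    | succ i ih =>
      -- If `g 0` has order `i`, then the later `g m` have order at least `i + 1`; as the whole
      -- partial sum does too, so does `g 0`.
      have h1 := hsum (i + 1)
      rw [Finset.sum_range_succ'] at h1
      refine (Submodule.add_mem_iff_right _ (sum_mem fun m _ => ?_)).mp h1
      exact cochainsIn_mono (hb.fil_anti (by omega)) (hgm i ih (m + 1))
  have := eq_zero_of_mem_fil hb hg0
  simpa [hg, hf] using this

end Gauge

end SuperDeform

namespace SuperDeform

open PowerSeries

/-! ### The ring of formal power series is a formal base -/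

section Poly

variable {K : Type u} [Field K]

/-- The universal property gives a map into the subalgebra that is the identity on generators, hence
a section of the inclusion. -/
theorem poly_subalgebra_eq_top (S : Subalgebra K (SuperPoly K)) (h : ∀ i, polyGen K i ∈ S)
    (x : SuperPoly K) : x ∈ S := by
  let f : SuperPoly K →ₐ[K] S := polyLift (fun i => ⟨polyGen K i, h i⟩) fun i j => by
    apply Subtype.ext
    simpa using polyGen_swap K i j
  have hf : S.val.comp f = AlgHom.id K _ := poly_hom_ext K fun i => by
    rw [AlgHom.comp_apply, polyLift_gen]
    rfl
  rw [show x = S.val (f x) from (DFunLike.congr_fun hf x).symm]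
  exact (f x).2

theorem polyInv_polyInv (x : SuperPoly K) : polyInv K (polyInv K x) = x := by
  have h : (polyInv K).comp (polyInv K) = AlgHom.id K _ := poly_hom_ext K fun i => by
    rw [AlgHom.comp_apply, polyInv_gen]
    cases i <;> simp [Param.parity, polyInv_gen]
  exact DFunLike.congr_fun h x

theorem polyGen_mul_even {i : Param} (hi : i.parity = 0) (y : SuperPoly K) :
    polyGen K i * y = y * polyGen K i := by
  have := poly_subalgebra_eq_top (Subalgebra.centralizer K {polyGen K i}) (fun j => by
    rw [Subalgebra.mem_centralizer_iff]
    rintro _ rfl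
    rw [polyGen_swap, hi, zero_mul, pow_zero, one_mul]) y
  exact Subalgebra.mem_centralizer_iff K |>.mp this _ rfl

theorem polyGen_mul_odd {i : Param} (hi : i.parity = 1) (y : SuperPoly K) :
    polyGen K i * y = polyInv K y * polyGen K i := by
  let S : Subalgebra K (SuperPoly K) :=
    { carrier := {y | polyGen K i * y = polyInv K y * polyGen K i}
      mul_mem' := fun {y z} hy hz => by
        rw [Set.mem_ofPred_eq] at hy hz ⊢
        rw [map_mul, ← mul_assoc, hy, mul_assoc, hz, mul_assoc]
      add_mem' := fun {y z} hy hz => by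
        rw [Set.mem_ofPred_eq] at hy hz ⊢
        rw [mul_add, hy, hz, map_add, add_mul]
      algebraMap_mem' := fun c => by
        rw [Set.mem_ofPred_eq, AlgHom.commutes]
        exact (Algebra.commutes c _).symm }
  refine poly_subalgebra_eq_top S (fun j => ?_) y
  change polyGen K i * polyGen K j = polyInv K (polyGen K j) * polyGen K i
  rw [polyGen_swap, polyInv_gen, hi, one_mul, mul_assoc]

/-- The defining relations only concern generators. Elements that split into a central even part and
a part twisted by parity form a subalgebra, so supercommutativity spreads to all polynomials. -/
theorem poly_decomposition (x : SuperPoly K) : ∃ x0 x1, x = x0 + x1 ∧ polyInv K x0 = x0 ∧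
    polyInv K x1 = -x1 ∧ (∀ y, x0 * y = y * x0) ∧ ∀ y, x1 * y = polyInv K y * x1 := by
  let S : Subalgebra K (SuperPoly K) :=
    { carrier := {x | ∃ x0 x1, x = x0 + x1 ∧ polyInv K x0 = x0 ∧
        polyInv K x1 = -x1 ∧ (∀ y, x0 * y = y * x0) ∧ ∀ y, x1 * y = polyInv K y * x1}
      mul_mem' := by
        rintro _ _ ⟨x0, x1, rfl, h1, h2, h3, h4⟩ ⟨y0, y1, rfl, k1, k2, k3, k4⟩
        refine ⟨x0 * y0 + x1 * y1, x0 * y1 + x1 * y0, ?_, ?_, ?_, fun z => ?_, fun z => ?_⟩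
        · rw [add_mul, mul_add, mul_add]; abel
        · simp [h1, h2, k1, k2]
        · simp [h1, h2, k1, k2, add_comm]
        · rw [add_mul, mul_add, mul_assoc, k3, ← mul_assoc, h3, mul_assoc, mul_assoc x1, k4,
            ← mul_assoc x1, h4, polyInv_polyInv, mul_assoc]
        · rw [add_mul, mul_add, mul_assoc, k4, ← mul_assoc, h3, mul_assoc, mul_assoc x1, k3,
            ← mul_assoc x1, h4, mul_assoc]
      add_mem' := by
        rintro _ _ ⟨x0, x1, rfl, h1, h2, h3, h4⟩ ⟨y0, y1, rfl, k1, k2, k3, k4⟩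
        refine ⟨x0 + y0, x1 + y1, ?_, ?_, ?_, fun z => ?_, fun z => ?_⟩
        · abel
        · rw [map_add, h1, k1]
        · rw [map_add, h2, k2, neg_add]
        · rw [add_mul, mul_add, h3, k3]
        · rw [add_mul, mul_add, h4, k4]
      algebraMap_mem' := fun c => ⟨algebraMap K _ c, 0, by simp, by simp, by simp,
        fun y => Algebra.commutes c y, by simp⟩ }
  refine poly_subalgebra_eq_top S (fun i => ?_) x
  by_cases hi : i.parity = 0
  · exact ⟨polyGen K i, 0, by simp, by simp [polyInv_gen, hi], by simp, polyGen_mul_even hi,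
      by simp⟩
  · have hi : i.parity = 1 := by cases i <;> simp [Param.parity] at hi ⊢
    exact ⟨0, polyGen K i, by simp, by simp, by simp [polyInv_gen, hi], by simp,
      polyGen_mul_odd hi⟩

theorem poly_superComm [CharZero K] : SuperComm (polyInv K : SuperPoly K →+* SuperPoly K) where
  inv_inv := polyInv_polyInv
  even_comm x y hx := by
    obtain ⟨x0, x1, rfl, h1, h2, h3, -⟩ := poly_decomposition x
    rw [RingHom.coe_coe, map_add, h1, h2, add_right_inj, neg_eq_iff_add_eq_zero, ← two_smul K,
      smul_eq_zero_iff_right two_ne_zero] at hx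
    rw [hx, add_zero, h3]
  odd_anticomm x y hx hy := by
    obtain ⟨x0, x1, rfl, h1, h2, -, h4⟩ := poly_decomposition x
    rw [RingHom.coe_coe, map_add, h1, h2, neg_add, add_left_inj, eq_neg_iff_add_eq_zero,
      ← two_smul K, smul_eq_zero_iff_right two_ne_zero] at hx
    rw [RingHom.coe_coe] at hy
    rw [hx, zero_add, h4, hy, neg_mul]

theorem seriesInv_coe (f : SuperSeries K) :
    ((seriesBase K).inv f).1 = PowerSeries.map (polyInv K : SuperPoly K →+* SuperPoly K) f.1 := rfl

theorem mem_seriesFil {n : ℕ} {f : SuperSeries K} :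
    f ∈ (seriesBase K).fil n ↔ ∀ i < n, coeff i f.1 = 0 := Iff.rfl

theorem seriesFil_mul {i j : ℕ} {f g : SuperSeries K} (hf : f ∈ (seriesBase K).fil i)
    (hg : g ∈ (seriesBase K).fil j) : f * g ∈ (seriesBase K).fil (i + j) := by
  rw [mem_seriesFil] at hf hg ⊢
  intro n hn
  change coeff n (f.1 * g.1) = 0
  rw [coeff_mul]
  refine Finset.sum_eq_zero fun p hp => ?_
  have := Finset.HasAntidiagonal.mem_antidiagonal.mp hp
  rcases lt_or_ge p.1 i with h | h
  · rw [hf _ h, zero_mul]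
  · rw [hg _ (by omega), mul_zero]

theorem series_maxIdeal : (seriesBase K).fil 1 = (seriesBase K).maxIdeal := by
  ext f
  refine ⟨fun hf => aug_of_mem_fil_one hf, fun hf i hi => ?_⟩
  obtain rfl : i = 0 := by omega
  have h0 := f.2 0
  rw [pow_zero] at h0
  obtain ⟨c, hc⟩ := Submodule.mem_one.mp h0
  have h1 : polyAug K (constantCoeff f.1) = 0 := hf
  rw [← coeff_zero_eq_constantCoeff_apply, ← hc, AlgHom.commutes] at h1
  have h2 : c = 0 := h1
  rw [← hc, h2, map_zero]

theorem gen_mem_fil (i : Param) : gen K i ∈ (seriesBase K).fil 1 := by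
  rw [series_maxIdeal]
  exact aug_gen i

theorem coeff_gen (i : Param) (n : ℕ) : coeff n (gen K i).1 = if n = 1 then polyGen K i else 0 := by
  change coeff n (PowerSeries.mk fun n => if n = 1 then polyGen K i else 0) = _
  rw [coeff_mk]

/-- A homogeneous polynomial of degree `n` is the leading term of a series in the algebraic power `m
^ n`. This is what makes the filtration by order equal to `m ^ n` up to higher order, despite the
infinitely many variables. -/
theorem exists_mem_maxIdeal_pow (n : ℕ) (x : SuperPoly K) (hx : x ∈ polySpan K ^ n) :
    ∃ g ∈ (seriesBase K).maxIdeal ^ n, g ∈ (seriesBase K).fil n ∧ coeff n g.1 = x := by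
  induction n generalizing x with
  | zero =>
    rw [pow_zero] at hx
    obtain ⟨c, rfl⟩ := Submodule.mem_one.mp hx
    refine ⟨algebraMap K _ c, ?_, fun i hi => absurd hi (Nat.not_lt_zero i), ?_⟩
    · rw [pow_zero]; exact Submodule.mem_one.mpr ⟨c, rfl⟩
    · change coeff 0 (algebraMap K (PowerSeries (SuperPoly K)) c) = _
      rw [Algebra.algebraMap_eq_smul_one, coeff_smul, coeff_zero_eq_constantCoeff_apply, map_one,
        Algebra.algebraMap_eq_smul_one]
  | succ n ih =>
    rw [pow_succ] at hx
    induction hx using Submodule.mul_induction_on' with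
    | mem_mul_mem y hy z hz =>
      obtain ⟨g, hg1, hg2, rfl⟩ := ih y hy
      have hz' : ∃ h ∈ (seriesBase K).maxIdeal, coeff 1 h.1 = z := by
        induction hz using Submodule.span_induction with
        | mem z hz =>
          obtain ⟨i, rfl⟩ := hz
          exact ⟨gen K i, aug_gen i, by rw [coeff_gen, if_pos rfl]⟩
        | zero => exact ⟨0, zero_mem _, by simp⟩
        | add z z' _ _ h h' =>
          obtain ⟨g, hg, rfl⟩ := h
          obtain ⟨g', hg', rfl⟩ := h'
          exact ⟨g + g', add_mem hg hg', map_add _ _ _⟩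
        | smul c z _ h =>
          obtain ⟨g, hg, rfl⟩ := h
          exact ⟨c • g, Submodule.smul_mem _ _ hg, coeff_smul _ _ _⟩
      obtain ⟨h, hh1, rfl⟩ := hz'
      have hh2 : h ∈ (seriesBase K).fil 1 := by rw [series_maxIdeal]; exact hh1
      refine ⟨g * h, ?_, seriesFil_mul hg2 hh2, ?_⟩
      · rw [pow_succ]; exact Submodule.mul_mem_mul hg1 hh1
      · change coeff (n + 1) (g.1 * h.1) = _
        rw [coeff_mul, Finset.sum_eq_single (n, 1)]
        · intro p hp hne
          have hp := Finset.HasAntidiagonal.mem_antidiagonal.mp hp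
          rcases lt_or_ge p.1 n with hlt | hge
          · rw [hg2 _ hlt, zero_mul]
          · have h2 : p.2 ≠ 1 := fun h2 => hne (Prod.ext (by simp only; omega) h2)
            rw [hh2 _ (by omega), mul_zero]
        · intro h
          exact absurd (Finset.HasAntidiagonal.mem_antidiagonal.mpr (rfl : n + 1 = n + 1)) h
    | add y _ z _ h h' =>
      obtain ⟨g, hg1, hg2, rfl⟩ := h
      obtain ⟨g', hg1', hg2', rfl⟩ := h'
      exact ⟨g + g', add_mem hg1 hg1', add_mem hg2 hg2', map_add _ _ _⟩

theorem series_maxIdeal_pow_le (n : ℕ) : (seriesBase K).maxIdeal ^ n ≤ (seriesBase K).fil n := by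
  induction n with
  | zero => exact fun f _ i hi => absurd hi (Nat.not_lt_zero i)
  | succ n ih =>
    rw [pow_succ, ← series_maxIdeal, Submodule.mul_le]
    intro f hf g hg
    rw [series_maxIdeal] at hf
    exact seriesFil_mul (ih hf) hg

theorem series_isFormal [CharZero K] : (seriesBase K).IsFormal where
  inv_inv x := Subtype.ext (poly_superComm.powerSeries.inv_inv x.1)
  even_comm x y hx := Subtype.ext (poly_superComm.powerSeries.even_comm x.1 y.1
    (congrArg Subtype.val hx))
  odd_anticomm x y hx hy := Subtype.ext (poly_superComm.powerSeries.odd_anticomm x.1 y.1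
    (congrArg Subtype.val hx) (congrArg Subtype.val hy))
  aug_inv := aug_inv
  fil_inv n x hx i hi := by
    rw [seriesInv_coe, coeff_map, hx i hi, map_zero]
  fil_zero := eq_top_iff.mpr fun f _ i hi => absurd hi (Nat.not_lt_zero i)
  fil_one := series_maxIdeal
  fil_mul i j := Submodule.mul_le.mpr fun f hf g hg => seriesFil_mul hf hg
  fil_eq n := by
    apply le_antisymm
    · intro f hf
      obtain ⟨g, hg1, hg2, hg3⟩ := exists_mem_maxIdeal_pow n _ (f.2 n)
      refine Submodule.mem_sup.mpr ⟨g, hg1, f - g, fun i hi => ?_, by abel⟩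
      change coeff i (f.1 - g.1) = 0
      rw [map_sub]
      rcases Nat.lt_succ_iff_lt_or_eq.mp hi with h | rfl
      · rw [hf i h, hg2 i h, sub_zero]
      · rw [hg3, sub_self]
    · exact sup_le (series_maxIdeal_pow_le n) fun f hf i hi => hf i (by omega)
  separated x hx := Subtype.ext (PowerSeries.ext fun n => hx (n + 1) n (Nat.lt_succ_self n))
  complete s hs := by
    refine ⟨⟨PowerSeries.mk fun n => coeff n (s (n + 1)).1, fun n => ?_⟩, fun n i hi => ?_⟩
    · rw [coeff_mk]; exact (s (n + 1)).2 n
    · change coeff i ((PowerSeries.mk fun n => coeff n (s (n + 1)).1) - (s n).1) = 0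
      rw [map_sub, coeff_mk, sub_eq_zero, eq_comm]
      induction n with
      | zero => exact absurd hi (Nat.not_lt_zero i)
      | succ n ih =>
        rcases Nat.lt_succ_iff_lt_or_eq.mp hi with h | rfl
        · rw [← ih h, ← sub_eq_zero, ← map_sub]
          exact hs n i h
        · rfl

end Poly

/-! ### Quotients -/

section Quotient

variable {K : Type u} [Field K] {S : Set (SuperSeries K)}

theorem relIdeal_closed {x : SuperSeries K}
    (h : ∀ n, ∃ y ∈ relIdeal S, x - y ∈ (seriesBase K).fil n) : x ∈ relIdeal S := by
  rw [relIdeal, TwoSidedIdeal.mem_sInf]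
  intro J hJ
  refine hJ.2.2 x fun n => ?_
  obtain ⟨y, hy, hxy⟩ := h n
  rw [relIdeal, TwoSidedIdeal.mem_sInf] at hy
  exact ⟨y, hy J hJ, hxy⟩

theorem subset_relIdeal {x : SuperSeries K} (hx : x ∈ S) : x ∈ relIdeal S := by
  rw [relIdeal, TwoSidedIdeal.mem_sInf]
  exact fun J hJ => hJ.1 x hx

theorem quotMk_eq_zero {x : SuperSeries K} : quotMk S x = 0 ↔ x ∈ relIdeal S := by
  rw [← map_zero (quotMk S)]
  exact (RingCon.eq _).trans (by rw [TwoSidedIdeal.rel_iff, sub_zero])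

theorem quotMk_surjective : Function.Surjective (quotMk S) := RingCon.mkₐ_surjective _

variable (hS : ∀ x ∈ S, (seriesBase K).aug x = 0)

theorem quotBase_inv (x : SuperSeries K) :
    (quotBase S hS).inv (quotMk S x) = quotMk S ((seriesBase K).inv x) := rfl

theorem quotBase_maxIdeal [CharZero K] :
    ((seriesBase K).maxIdeal).map (quotMk S).toLinearMap = (quotBase S hS).maxIdeal := by
  ext y
  obtain ⟨x, rfl⟩ := quotMk_surjective y
  constructor
  · rintro ⟨z, hz, hzx⟩
    rw [← hzx]
    exact hz
  · intro h
    exact ⟨x, h, rfl⟩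

/-- Gradedness of the ideal gives the parity laws and its closedness gives separatedness;
completeness and the filtration laws are lifted from the power series ring. -/
theorem quotBase_isFormal [CharZero K] : (quotBase S hS).IsFormal := by
  have hs := series_isFormal (K := K)
  have heven : ∀ x, (quotBase S hS).inv (quotMk S x) = quotMk S x →
      ∃ x', (seriesBase K).inv x' = x' ∧ quotMk S x' = quotMk S x := by
    intro x hx
    -- Averaging any lift over the parity involution gives an even lift.
    refine ⟨(2⁻¹ : K) • (x + (seriesBase K).inv x), ?_, ?_⟩
    · rw [map_smul, map_add, hs.inv_inv, add_comm]
    · rw [map_smul, map_add, ← quotBase_inv hS, hx, ← two_smul K, smul_smul,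
        inv_mul_cancel₀ two_ne_zero, one_smul]
  have hodd : ∀ x, (quotBase S hS).inv (quotMk S x) = -quotMk S x →
      ∃ x', (seriesBase K).inv x' = -x' ∧ quotMk S x' = quotMk S x := by
    intro x hx
    refine ⟨(2⁻¹ : K) • (x - (seriesBase K).inv x), ?_, ?_⟩
    · rw [map_smul, map_sub, hs.inv_inv, ← smul_neg, neg_sub]
    · rw [map_smul, map_sub, ← quotBase_inv hS, hx, sub_neg_eq_add, ← two_smul K, smul_smul,
        inv_mul_cancel₀ two_ne_zero, one_smul]
  refine
  { inv_inv := fun y => ?_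
    even_comm := fun y z hy => ?_
    odd_anticomm := fun y z hy hz => ?_
    aug_inv := fun y => ?_
    fil_inv := ?_
    fil_zero := ?_
    fil_one := ?_
    fil_mul := fun i j => ?_
    fil_eq := fun n => ?_
    separated := fun y hy => ?_
    complete := fun s hcauchy => ?_ }
  · obtain ⟨x, rfl⟩ := quotMk_surjective y
    rw [quotBase_inv, quotBase_inv, hs.inv_inv]
  · obtain ⟨x, rfl⟩ := quotMk_surjective y
    obtain ⟨x', rfl⟩ := quotMk_surjective z
    obtain ⟨w, hw, hwx⟩ := heven x hy
    rw [← hwx, ← map_mul, ← map_mul, hs.even_comm w x' hw]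
  · obtain ⟨x, rfl⟩ := quotMk_surjective y
    obtain ⟨x', rfl⟩ := quotMk_surjective z
    obtain ⟨w, hw, hwx⟩ := hodd x hy
    obtain ⟨w', hw', hwx'⟩ := hodd x' hz
    rw [← hwx, ← hwx', ← map_mul, ← map_mul, hs.odd_anticomm w w' hw hw', map_neg]
  · obtain ⟨x, rfl⟩ := quotMk_surjective y
    exact hs.aug_inv x
  · rintro n _ ⟨x, hx, rfl⟩
    exact ⟨_, hs.fil_inv n x hx, rfl⟩
  · change ((seriesBase K).fil 0).map (quotMk S).toLinearMap = ⊤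
    rw [hs.fil_zero, Submodule.map_top, LinearMap.range_eq_top]
    exact quotMk_surjective
  · change ((seriesBase K).fil 1).map (quotMk S).toLinearMap = _
    rw [hs.fil_one, quotBase_maxIdeal]
  · change ((seriesBase K).fil i).map (quotMk S).toLinearMap *
      ((seriesBase K).fil j).map (quotMk S).toLinearMap ≤ _
    rw [← Submodule.map_mul]
    exact Submodule.map_mono (hs.fil_mul i j)
  · change ((seriesBase K).fil n).map (quotMk S).toLinearMap =
      _ ⊔ ((seriesBase K).fil (n + 1)).map (quotMk S).toLinearMap
    rw [hs.fil_eq n, Submodule.map_sup, Submodule.map_pow, quotBase_maxIdeal hS]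
  · obtain ⟨x, rfl⟩ := quotMk_surjective y
    refine quotMk_eq_zero.mpr (relIdeal_closed fun n => ?_)
    obtain ⟨z, hz, hzx⟩ := hy n
    refine ⟨x - z, quotMk_eq_zero.mp ?_, ?_⟩
    · rw [map_sub, sub_eq_zero]; exact hzx.symm
    · rw [sub_sub_cancel]; exact hz
  -- The increments, not the terms, are lifted: their lifts can be chosen of order `n`, so that
  -- their partial sums converge upstairs.
  · choose e he1 he2 using hcauchy
    obtain ⟨x0, hx0⟩ := quotMk_surjective (s 0)
    obtain ⟨x, hx⟩ := hs.complete (fun n => x0 + ∑ i ∈ Finset.range n, e i) fun n => by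
      rw [Finset.sum_range_succ, add_sub_add_left_eq_sub, add_sub_cancel_left]
      exact he1 n
    have hsn : ∀ n, quotMk S (x0 + ∑ i ∈ Finset.range n, e i) = s n := by
      intro n
      induction n with
      | zero => simpa using hx0
      | succ n ih =>
        have h2 : quotMk S (e n) = s (n + 1) - s n := he2 n
        rw [Finset.sum_range_succ, ← add_assoc, map_add, ih, h2, add_sub_cancel]
    exact ⟨quotMk S x, fun n => ⟨_, hx n, by rw [AlgHom.toLinearMap_apply, map_sub, hsn]⟩⟩

end Quotient

end SuperDeform
namespace SuperDeform

/-! ### Contraction principle in the filtration. -/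

section Contraction

variable {K : Type u} [Field K] {B : Type v} [Ring B] [Algebra K B] {b : BaseData K B}

/-- The recursions run towards larger indices, so induction on the index is impossible; the
induction is on the order of the whole family at once. -/
theorem eq_zero_of_improving (hb : b.IsFormal) {ι : Type*} {z : ι → B}
    (h : ∀ n, (∀ i, z i ∈ b.fil n) → ∀ i, z i ∈ b.fil (n + 1)) (i : ι) : z i = 0 := by
  refine hb.separated _ fun n => ?_
  induction n generalizing i with
  | zero => exact hb.mem_zero _
  | succ n ih => exact h n ih i

/-- Banach's fixed point theorem for families of elements of a formal base. -/
theorem exists_fixedPoint (hb : b.IsFormal) {ι : Type*} (Φ : (ι → B) → ι → B)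
    (h : ∀ n x x', (∀ i, x i - x' i ∈ b.fil n) → ∀ i, Φ x i - Φ x' i ∈ b.fil (n + 1)) :
    ∃ x, Φ x = x := by
  have h1 : ∀ n i, Φ^[n + 1] 0 i - Φ^[n] 0 i ∈ b.fil n := by
    intro n
    induction n with
    | zero => exact fun i => hb.mem_zero _
    | succ n ih =>
      intro i
      rw [Function.iterate_succ_apply' Φ n, Function.iterate_succ_apply' Φ (n + 1)]
      exact h n _ _ ih i
  choose x hx using fun i => hb.complete (fun n => Φ^[n] 0 i) fun n => h1 n i
  refine ⟨x, funext fun i => sub_eq_zero.mp (hb.separated _ fun n => ?_)⟩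
  refine hb.fil_succ_le n ?_
  have h2 := h n x (Φ^[n] 0) (fun i => hx i n) i
  have h3 := hx i (n + 1)
  rw [Function.iterate_succ_apply'] at h3
  rw [← sub_sub_sub_cancel_right _ _ (Φ (Φ^[n] 0) i)]
  exact sub_mem h2 h3

end Contraction

/-! ### Parameters as power series, and solutions of the recursions as formal sums. -/

section Generators

variable {K : Type u} [Field K]

theorem series_mul_neg (x y : SuperSeries K) : x * -y = -(x * y) := mul_neg x y

theorem series_neg_mul (x y : SuperSeries K) : -x * y = -(x * y) := neg_mul x y

theorem inv_gen (i : Param) :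
    (seriesBase K).inv (gen K i) = (-1) ^ i.parity * gen K i := by
  apply Subtype.ext
  rw [seriesInv_coe]
  ext n
  rw [PowerSeries.coeff_map, coeff_gen]
  by_cases h : n = 1 <;> cases i <;> simp [Param.parity, coeff_gen, h, polyInv_gen]

theorem t1_comm [CharZero K] (x : SuperSeries K) : gen K .t1 * x = x * gen K .t1 :=
  series_isFormal.even_comm _ _ (by simp [inv_gen, Param.parity])

theorem t2_comm [CharZero K] (x : SuperSeries K) : gen K .t2 * x = x * gen K .t2 :=
  series_isFormal.even_comm _ _ (by simp [inv_gen, Param.parity])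

theorem gen_mul_mem [CharZero K] (i : Param) {n : ℕ} {x : SuperSeries K}
    (hx : x ∈ (seriesBase K).fil n) : gen K i * x ∈ (seriesBase K).fil (n + 1) := by
  rw [add_comm]
  exact seriesFil_mul (gen_mem_fil i) hx

theorem gen_pow_mul_mem [CharZero K] (i : Param) (n : ℕ) (x : SuperSeries K) :
    gen K i ^ n * x ∈ (seriesBase K).fil n := by
  induction n with
  | zero => exact series_isFormal.mem_zero _
  | succ n ih =>
    rw [pow_succ', mul_assoc]
    exact gen_mul_mem i ih

theorem neg_one_pow_mul_mem {n : ℕ} {x : SuperSeries K} (m : ℕ)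
    (hx : x ∈ (seriesBase K).fil n) : (-1) ^ m * x ∈ (seriesBase K).fil n := by
  rcases neg_one_pow_mem_units m x with h | h <;> rw [h]
  · exact hx
  · exact neg_mem hx

variable [CharZero K]

/-- Unrolling the recursion `M` times leaves the remainder `(-1)^M (t¹)^M r^{k+M}`, which has order
at least `M`. -/
theorem hasFormalSum_r {r : ℕ → SuperSeries K} (k : ℕ)
    (h : ∀ j ≥ k, r j = gen K .t1 * gen K (.et (j + 1)) - gen K .t1 * r (j + 1)) :
    HasFormalSum (fun n => (-1) ^ n * (gen K .t1 ^ (n + 1) * gen K (.et (k + n + 1)))) (r k) := by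
  have key : ∀ M, r k - ∑ i ∈ Finset.range M,
      (-1) ^ i * (gen K .t1 ^ (i + 1) * gen K (.et (k + i + 1))) =
      (-1) ^ M * (gen K .t1 ^ M * r (k + M)) := by
    intro M
    induction M with
    | zero => simp
    | succ M ih =>
      rw [Finset.sum_range_succ, ← sub_sub, ih, h (k + M) (Nat.le_add_right _ _), mul_sub, mul_sub,
        ← mul_assoc (gen K .t1 ^ M), ← pow_succ, ← mul_assoc (gen K .t1 ^ M), ← pow_succ,
        sub_sub_cancel_left, pow_succ (-1 : SuperSeries K), series_mul_neg, mul_one, series_neg_mul, add_assoc]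
  intro n
  refine ⟨n, fun M hM => ?_⟩
  rw [key]
  exact series_isFormal.fil_anti hM (neg_one_pow_mul_mem M (gen_pow_mul_mem _ M _))

theorem hasFormalSum_y {s y : ℕ → SuperSeries K} (k : ℕ)
    (hs : ∀ j ≥ k, s (j + 1) = gen K .t2 * gen K (.th (j + 1)))
    (h : ∀ j ≥ k, y j = -(gen K .t1 * s (j + 1)) - gen K .t2 * y (j + 1)) :
    HasFormalSum (fun n =>
      -((-1) ^ n * (gen K .t1 * gen K .t2 * gen K .t2 ^ n * gen K (.th (n + k + 1))))) (y k) := by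
  have key : ∀ M, y k - ∑ i ∈ Finset.range M,
      -((-1) ^ i * (gen K .t1 * gen K .t2 * gen K .t2 ^ i * gen K (.th (i + k + 1)))) =
      (-1) ^ M * (gen K .t2 ^ M * y (k + M)) := by
    intro M
    induction M with
    | zero => simp
    | succ M ih =>
      have h1 : gen K .t2 ^ M * (gen K .t1 * (gen K .t2 * gen K (.th (M + k + 1)))) =
          gen K .t1 * gen K .t2 * gen K .t2 ^ M * gen K (.th (M + k + 1)) := by
        rw [← mul_assoc, ← t1_comm, ← mul_assoc, mul_assoc (gen K .t1), ← t2_comm, ← mul_assoc]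
      have h2 : ∀ p q : SuperSeries K, -p - q + p = -q := fun p q => by abel
      rw [Finset.sum_range_succ, ← sub_sub, ih, h (k + M) (Nat.le_add_right _ _),
        hs (k + M) (Nat.le_add_right _ _), mul_sub, mul_sub, series_mul_neg, series_mul_neg, add_comm k M, h1,
        ← mul_assoc (gen K .t2 ^ M), ← pow_succ, sub_neg_eq_add, h2,
        pow_succ (-1 : SuperSeries K), series_mul_neg, mul_one, series_neg_mul, show k + (M + 1) = M + k + 1 by ring]
  intro n
  refine ⟨n, fun M hM => ?_⟩
  rw [key]
  exact series_isFormal.fil_anti hM (neg_one_pow_mul_mem M (gen_pow_mul_mem _ M _))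

/-- A sequence, shifted by one. -/
def shiftZero {A : Type*} [Zero A] (f : ℕ → A) : ℕ → A
  | 0 => 0
  | k + 1 => f k

end Generators

/-! ### The coefficients: existence, uniqueness, parity and order. -/

namespace CoeffSystem

section Values

variable {K : Type u} [Field K] (c : CoeffSystem K)

/-- The values of the parameters and of the coefficients under a homomorphism. -/
noncomputable def values {B : Type v} [Ring B] [Algebra K B] (f : SuperSeries K →ₐ[K] B) : Values B where
  a i := f (gen K i)
  r k := f (c.r k)
  s k := f (c.s k)
  y k := f (c.y k)
  u k l := f (c.u k l)
  v k l := f (c.v k l)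

theorem rel_values_t1 {B : Type v} [Ring B] [Algebra K B] (f : SuperSeries K →ₐ[K] B) :
    (c.values f).rel K .t1 = f c.rel1 := by
  simp [Values.rel, values, rel1]

theorem rel_values_t2 {B : Type v} [Ring B] [Algebra K B] (f : SuperSeries K →ₐ[K] B) :
    (c.values f).rel K .t2 = -f rel2 := by
  simp [Values.rel, values, rel2]

theorem rel_values_th {B : Type v} [Ring B] [Algebra K B] (f : SuperSeries K →ₐ[K] B) (n : ℕ) :
    (c.values f).rel K (.th n) = f (c.relPhi n) := by
  simp [Values.rel, values, relPhi, apply_ite f]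

theorem rel_values_et {B : Type v} [Ring B] [Algebra K B] (f : SuperSeries K →ₐ[K] B) (n : ℕ) :
    (c.values f).rel K (.et n) = f (c.relSigma n) := by
  simp [Values.rel, values, relSigma]

theorem rel_values_eq_zero_iff {B : Type v} [Ring B] [Algebra K B] (f : SuperSeries K →ₐ[K] B) :
    (∀ i, (c.values f).rel K i = 0) ↔ ∀ x ∈ c.relations, f x = 0 := by
  constructor
  · rintro h x (((rfl | rfl) | ⟨n, rfl⟩) | ⟨n, rfl⟩)
    · rw [← neg_eq_zero, ← rel_values_t2, h]
    · rw [← rel_values_t1, h]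
    · rw [← rel_values_th, h]
    · rw [← rel_values_et, h]
  · rintro h (_ | _ | n | n)
    · rw [rel_values_t1]; exact h _ (Or.inl (Or.inl (Or.inr rfl)))
    · rw [rel_values_t2, h _ (Or.inl (Or.inl (Or.inl rfl))), neg_zero]
    · rw [rel_values_th]; exact h _ (Or.inl (Or.inr ⟨n, rfl⟩))
    · rw [rel_values_et]; exact h _ (Or.inr ⟨n, rfl⟩)

end Values

variable {K : Type u} [Field K] [CharZero K]

theorem nonempty : Nonempty (CoeffSystem K) := by
  have hb := series_isFormal (K := K)
  -- Every recursive occurrence of an unknown carries a factor `t¹` or `t²`, hence the recursion is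
  -- a contraction. Here index `k` stands for `r^{k+1}`, and likewise for `y` and for the second
  -- index of `v`; `shiftZero` restores the numbering with the value zero at the start.
  obtain ⟨r, hr⟩ := exists_fixedPoint hb
    (fun (x : ℕ → SuperSeries K) k => gen K .t1 * gen K (.et (k + 2)) - gen K .t1 * x (k + 1))
    fun n x x' h k => by
      rw [sub_sub_sub_cancel_left, ← mul_sub, ← neg_sub, series_mul_neg]
      exact neg_mem (gen_mul_mem _ (h _))
  obtain ⟨y, hy⟩ := exists_fixedPoint hb
    (fun (x : ℕ → SuperSeries K) k =>
      -(gen K .t1 * (gen K .t2 * gen K (.th (k + 2)))) - gen K .t2 * x (k + 1))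
    fun n x x' h k => by
      rw [sub_sub_sub_cancel_left, ← mul_sub, ← neg_sub, series_mul_neg]
      exact neg_mem (gen_mul_mem _ (h _))
  obtain ⟨u, hu⟩ := exists_fixedPoint hb
    (fun (x : ℕ × ℕ → SuperSeries K) kl =>
      -((((kl.1 + 2 : ℕ) : SuperSeries K) * gen K (.et (kl.1 + 1)) -
        ((kl.2 + 1 : ℕ) : SuperSeries K) * r kl.1) * y kl.2
      + gen K .t1 * x (kl.1 + 1, kl.2) + gen K .t2 * x (kl.1, kl.2 + 1)))
    fun n x x' h k => by
      rw [neg_sub_neg, ← neg_sub, add_sub_add_comm, add_sub_add_left_eq_sub, ← mul_sub, ← mul_sub]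
      exact neg_mem (add_mem (gen_mul_mem _ (h _)) (gen_mul_mem _ (h _)))
  obtain ⟨v, hv⟩ := exists_fixedPoint hb
    (fun (x : ℕ × ℕ → SuperSeries K) kl =>
      -(((kl.2 + 1 : ℕ) : SuperSeries K) * (gen K (.th (kl.2 + 1)) * r kl.1)
      - gen K (.et (kl.1 + 2)) * y kl.2
      + ((kl.2 + 1 : ℕ) : SuperSeries K) * (r (kl.1 + 1) * y kl.2)
      - gen K .t1 * u (kl.1 + 2, kl.2) + gen K .t1 * x (kl.1 + 1, kl.2)))
    fun n x x' h k => by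
      rw [neg_sub_neg, ← neg_sub, add_sub_add_left_eq_sub, ← mul_sub]
      exact neg_mem (gen_mul_mem _ (h _))
  let s : ℕ → SuperSeries K
    | 0 => 0
    | 1 => gen K .t2 * gen K (.th 1) + gen K .t1 * gen K (.et 1) - gen K .t1 * r 0
    | k + 2 => gen K .t2 * gen K (.th (k + 2))
  have hr' : ∀ k ≥ 1, shiftZero r k =
      gen K .t1 * gen K (.et (k + 1)) - gen K .t1 * shiftZero r (k + 1) := by
    intro k hk
    obtain ⟨k, rfl⟩ := Nat.exists_eq_add_of_le' hk
    exact (congrFun hr k).symm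
  have hs : ∀ k ≥ 2, s k = gen K .t2 * gen K (.th k) := by
    intro k hk
    obtain ⟨k, rfl⟩ := Nat.exists_eq_add_of_le' hk
    rfl
  have hy' : ∀ k ≥ 1, shiftZero y k = -(gen K .t1 * s (k + 1)) - gen K .t2 * shiftZero y (k + 1) := by
    intro k hk
    obtain ⟨k, rfl⟩ := Nat.exists_eq_add_of_le' hk
    exact (congrFun hy k).symm
  exact ⟨{
    r := shiftZero r
    s := s
    y := shiftZero y
    u := fun k l => u (k, l)
    v := fun k => shiftZero fun l => v (k, l)
    r_zero := rfl
    s_zero := rfl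
    y_zero := rfl
    r_rec := hr'
    r_sum := fun k hk => hasFormalSum_r k fun j hj => hr' j (hk.trans hj)
    s_one := rfl
    s_eq := hs
    y_rec := hy'
    y_sum := fun k hk => hasFormalSum_y k (fun j hj => hs _ (by omega))
      fun j hj => hy' j (hk.trans hj)
    u_rec := fun k l => (congrFun hu (k, l)).symm
    v_zero := fun _ => rfl
    v_rec := fun k l => (congrFun hv (k, l)).symm }⟩

theorem subsingleton : Subsingleton (CoeffSystem K) := by
  have hb := series_isFormal (K := K)
  refine ⟨fun c c' => ?_⟩
  have hr : c.r = c'.r := by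
    have h := eq_zero_of_improving hb (z := fun k => c.r (k + 1) - c'.r (k + 1)) fun n h k => by
      rw [c.r_rec _ (Nat.le_add_left 1 k), c'.r_rec _ (Nat.le_add_left 1 k),
        sub_sub_sub_cancel_left, ← mul_sub, ← neg_sub, series_mul_neg]
      exact neg_mem (gen_mul_mem _ (h _))
    funext k
    cases k with
    | zero => rw [c.r_zero, c'.r_zero]
    | succ k => exact sub_eq_zero.mp (h k)
  have hs : c.s = c'.s := by
    funext k
    match k with
    | 0 => rw [c.s_zero, c'.s_zero]
    | 1 => rw [c.s_one, c'.s_one, hr]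
    | k + 2 => rw [c.s_eq _ (Nat.le_add_left 2 k), c'.s_eq _ (Nat.le_add_left 2 k)]
  have hy : c.y = c'.y := by
    have h := eq_zero_of_improving hb (z := fun k => c.y (k + 1) - c'.y (k + 1)) fun n h k => by
      rw [c.y_rec _ (Nat.le_add_left 1 k), c'.y_rec _ (Nat.le_add_left 1 k), hs,
        sub_sub_sub_cancel_left, ← mul_sub, ← neg_sub, series_mul_neg]
      exact neg_mem (gen_mul_mem _ (h _))
    funext k
    cases k with
    | zero => rw [c.y_zero, c'.y_zero]
    | succ k => exact sub_eq_zero.mp (h k)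
  have hu : c.u = c'.u := by
    have h := eq_zero_of_improving hb (z := fun kl : ℕ × ℕ => c.u kl.1 kl.2 - c'.u kl.1 kl.2)
      fun n h kl => by
        rw [c.u_rec, c'.u_rec, hr, hy, neg_sub_neg, ← neg_sub, add_sub_add_comm,
          add_sub_add_left_eq_sub, ← mul_sub, ← mul_sub]
        exact neg_mem (add_mem (gen_mul_mem _ (h (kl.1 + 1, kl.2)))
          (gen_mul_mem _ (h (kl.1, kl.2 + 1))))
    funext k l
    exact sub_eq_zero.mp (h (k, l))
  have hv : c.v = c'.v := by
    have h := eq_zero_of_improving hb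
      (z := fun kl : ℕ × ℕ => c.v kl.1 (kl.2 + 1) - c'.v kl.1 (kl.2 + 1)) fun n h kl => by
        rw [c.v_rec, c'.v_rec, hr, hy, hu, neg_sub_neg, ← neg_sub, add_sub_add_left_eq_sub,
          ← mul_sub]
        exact neg_mem (gen_mul_mem _ (h (kl.1 + 1, kl.2)))
    funext k l
    cases l with
    | zero => rw [c.v_zero, c'.v_zero]
    | succ l => exact sub_eq_zero.mp (h (k, l))
  cases c
  cases c'
  simp only at hr hs hy hu hv
  subst hr hs hy hu hv
  rfl

variable (c : CoeffSystem K)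

/-- The defect of the expected parity satisfies the homogeneous recursion, whose only solution is
zero. The same argument serves `y`, `u` and `v`. -/
theorem inv_r (k : ℕ) : (seriesBase K).inv (c.r k) = -c.r k := by
  have h := eq_zero_of_improving series_isFormal
    (z := fun k => (seriesBase K).inv (c.r (k + 1)) + c.r (k + 1)) fun n h k => by
      have h1 := neg_mem (gen_mul_mem .t1 (h (k + 1)))
      convert h1 using 1
      rw [c.r_rec _ (Nat.le_add_left 1 k)]
      simp only [map_sub, map_mul, inv_gen, Param.parity, pow_zero, pow_one, one_mul, series_neg_mul,
        series_mul_neg, mul_add, neg_add]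
      abel
  cases k with
  | zero => rw [c.r_zero, map_zero, neg_zero]
  | succ k => exact eq_neg_of_add_eq_zero_left (h k)

theorem inv_s (k : ℕ) : (seriesBase K).inv (c.s k) = -c.s k := by
  match k with
  | 0 => rw [c.s_zero, map_zero, neg_zero]
  | 1 =>
    rw [c.s_one]
    simp only [map_sub, map_add, map_mul, inv_gen, Param.parity, pow_zero, pow_one, one_mul,
      series_neg_mul, series_mul_neg, inv_r]
    abel
  | k + 2 =>
    rw [c.s_eq _ (Nat.le_add_left 2 k)]
    simp only [map_mul, inv_gen, Param.parity, pow_zero, pow_one, one_mul, series_neg_mul, series_mul_neg]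

theorem inv_y (k : ℕ) : (seriesBase K).inv (c.y k) = -c.y k := by
  have h := eq_zero_of_improving series_isFormal
    (z := fun k => (seriesBase K).inv (c.y (k + 1)) + c.y (k + 1)) fun n h k => by
      have h1 := neg_mem (gen_mul_mem .t2 (h (k + 1)))
      convert h1 using 1
      rw [c.y_rec _ (Nat.le_add_left 1 k)]
      simp only [map_sub, map_neg, map_mul, inv_gen, Param.parity, pow_zero, one_mul, inv_s,
        series_mul_neg, mul_add, neg_add]
      abel
  cases k with
  | zero => rw [c.y_zero, map_zero, neg_zero]
  | succ k => exact eq_neg_of_add_eq_zero_left (h k)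

theorem inv_u (k l : ℕ) : (seriesBase K).inv (c.u k l) = c.u k l := by
  have h := eq_zero_of_improving series_isFormal
    (z := fun kl : ℕ × ℕ => (seriesBase K).inv (c.u kl.1 kl.2) - c.u kl.1 kl.2) fun n h kl => by
      have h1 := neg_mem (add_mem (gen_mul_mem .t1 (h (kl.1 + 1, kl.2)))
        (gen_mul_mem .t2 (h (kl.1, kl.2 + 1))))
      convert h1 using 1
      rw [c.u_rec]
      simp only [map_sub, map_neg, map_add, map_mul, map_natCast, inv_gen, Param.parity, pow_zero,
        pow_one, one_mul, inv_r, inv_y, series_mul_neg, series_neg_mul, mul_sub, sub_mul, neg_add,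
        neg_neg]
      abel
  exact sub_eq_zero.mp (h (k, l))

theorem inv_v (k l : ℕ) : (seriesBase K).inv (c.v k l) = c.v k l := by
  have h := eq_zero_of_improving series_isFormal
    (z := fun kl : ℕ × ℕ => (seriesBase K).inv (c.v kl.1 (kl.2 + 1)) - c.v kl.1 (kl.2 + 1))
    fun n h kl => by
      have h1 := neg_mem (gen_mul_mem .t1 (h (kl.1 + 1, kl.2)))
      convert h1 using 1
      rw [c.v_rec]
      simp only [map_sub, map_neg, map_add, map_mul, map_natCast, inv_gen, Param.parity, pow_zero,
        pow_one, one_mul, inv_r, inv_y, inv_u, series_mul_neg, series_neg_mul, mul_sub, neg_add,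
        neg_neg]
      abel
  cases l with
  | zero => rw [c.v_zero, map_zero]
  | succ l => exact sub_eq_zero.mp (h (k, l))

theorem values_isSolution {B : Type v} [Ring B] [Algebra K B] {b : BaseData K B}
    {f : SuperSeries K →ₐ[K] B} (hf : ∀ x, f ((seriesBase K).inv x) = b.inv (f x)) :
    (c.values f).IsSolution b where
  t1_even := by simp [values, ← hf, inv_gen, Param.parity]
  t2_even := by simp [values, ← hf, inv_gen, Param.parity]
  th_odd n := by simp [values, ← hf, inv_gen, Param.parity]
  et_odd n := by simp [values, ← hf, inv_gen, Param.parity]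
  r_odd n := by simp [values, ← hf, inv_r]
  s_odd n := by simp [values, ← hf, inv_s]
  y_odd n := by simp [values, ← hf, inv_y]
  u_even k l := by simp [values, ← hf, inv_u]
  v_even k l := by simp [values, ← hf, inv_v]
  r_zero := by simp [values, c.r_zero]
  s_zero := by simp [values, c.s_zero]
  y_zero := by simp [values, c.y_zero]
  r_rec k := by simp [values, c.r_rec (k + 1) (Nat.le_add_left 1 k)]
  s_one := by simp [values, c.s_one]
  s_eq k := by simp [values, c.s_eq (k + 2) (Nat.le_add_left 2 k)]
  y_rec k := by simp [values, c.y_rec (k + 1) (Nat.le_add_left 1 k)]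
  u_rec k l := by
    refine (congrArg f (c.u_rec k l)).trans ?_
    simp only [values, map_neg, map_add, map_sub, map_mul, map_natCast]
  v_zero k := by simp [values, c.v_zero]
  v_rec k l := by
    refine (congrArg f (c.v_rec k l)).trans ?_
    simp only [values, map_neg, map_add, map_sub, map_mul, map_natCast]

/-- The recursion is used twice, each time gaining one order. Later on the coefficients only need to
have positive order, which makes the family reduce to `d`. -/
theorem r_mem (k : ℕ) : c.r k ∈ (seriesBase K).fil 2 := by
  have h : ∀ k, c.r (k + 1) ∈ (seriesBase K).fil 1 := fun k => by
    rw [c.r_rec _ (Nat.le_add_left 1 k), ← mul_sub]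
    exact gen_mul_mem _ (series_isFormal.mem_zero _)
  cases k with
  | zero => rw [c.r_zero]; exact zero_mem _
  | succ k =>
    rw [c.r_rec _ (Nat.le_add_left 1 k), ← mul_sub]
    exact gen_mul_mem _ (sub_mem (gen_mem_fil _) (h _))

theorem s_mem (k : ℕ) : c.s k ∈ (seriesBase K).fil 2 := by
  match k with
  | 0 => rw [c.s_zero]; exact zero_mem _
  | 1 =>
    rw [c.s_one]
    exact sub_mem (add_mem (gen_mul_mem _ (gen_mem_fil _)) (gen_mul_mem _ (gen_mem_fil _)))
      (gen_mul_mem _ (series_isFormal.fil_succ_le 1 (c.r_mem 1)))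
  | k + 2 =>
    rw [c.s_eq _ (Nat.le_add_left 2 k)]
    exact gen_mul_mem _ (gen_mem_fil _)

theorem y_mem (k : ℕ) : c.y k ∈ (seriesBase K).fil 2 := by
  have h : ∀ k, c.y (k + 1) ∈ (seriesBase K).fil 1 := fun k => by
    rw [c.y_rec _ (Nat.le_add_left 1 k)]
    exact sub_mem (neg_mem (gen_mul_mem _ (series_isFormal.mem_zero _)))
      (gen_mul_mem _ (series_isFormal.mem_zero _))
  cases k with
  | zero => rw [c.y_zero]; exact zero_mem _
  | succ k =>
    rw [c.y_rec _ (Nat.le_add_left 1 k)]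
    exact sub_mem (neg_mem (gen_mul_mem _ (series_isFormal.fil_succ_le 1 (c.s_mem _))))
      (gen_mul_mem _ (h _))

theorem u_mem (k l : ℕ) : c.u k l ∈ (seriesBase K).fil 2 := by
  have hy : ∀ x, x * c.y (l + 1) ∈ (seriesBase K).fil 2 := fun x => by
    have := series_isFormal.mul_mem (series_isFormal.mem_zero x) (c.y_mem (l + 1))
    rwa [zero_add] at this
  have h : ∀ k l, c.u k l ∈ (seriesBase K).fil 1 := fun k l => by
    rw [c.u_rec]
    have := series_isFormal.mul_mem (series_isFormal.mem_zero
      (((k + 2 : ℕ) : SuperSeries K) * gen K (.et (k + 1)) -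
        ((l + 1 : ℕ) : SuperSeries K) * c.r (k + 1))) (c.y_mem (l + 1))
    exact neg_mem (add_mem (add_mem (series_isFormal.fil_anti (by omega) this)
      (gen_mul_mem _ (series_isFormal.mem_zero _))) (gen_mul_mem _ (series_isFormal.mem_zero _)))
  rw [c.u_rec]
  exact neg_mem (add_mem (add_mem (hy _) (gen_mul_mem _ (h _ _))) (gen_mul_mem _ (h _ _)))

theorem v_mem (k l : ℕ) : c.v k l ∈ (seriesBase K).fil 2 := by
  have hb := series_isFormal (K := K)
  have h2 : ∀ k l, c.v (k + 1) l ∈ (seriesBase K).fil 1 →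
      c.v k l ∈ (seriesBase K).fil 2 := by
    rintro k (_ | l) h
    · rw [c.v_zero]; exact zero_mem _
    · rw [c.v_rec]
      refine neg_mem (add_mem (sub_mem (add_mem (sub_mem (natCast_mul_mem _ ?_) ?_)
        (natCast_mul_mem _ ?_)) ?_) (gen_mul_mem _ h))
      · exact gen_mul_mem _ (hb.fil_succ_le 1 (c.r_mem _))
      · exact gen_mul_mem _ (hb.fil_succ_le 1 (c.y_mem _))
      · exact hb.fil_anti (by omega) (hb.mul_mem (c.r_mem _) (c.y_mem _))
      · exact gen_mul_mem _ (hb.fil_succ_le 1 (c.u_mem _ _))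
  have h1 : ∀ k l, c.v k l ∈ (seriesBase K).fil 1 := by
    rintro k (_ | l)
    · rw [c.v_zero]; exact zero_mem _
    · rw [c.v_rec]
      refine neg_mem (add_mem (sub_mem (add_mem (sub_mem (natCast_mul_mem _ ?_) ?_)
        (natCast_mul_mem _ ?_)) ?_) (gen_mul_mem _ (hb.mem_zero _)))
      · exact gen_mul_mem _ (hb.mem_zero _)
      · exact gen_mul_mem _ (hb.mem_zero _)
      · exact hb.fil_anti (by omega) (hb.mul_mem (c.r_mem _) (c.y_mem _))
      · exact gen_mul_mem _ (hb.mem_zero _)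
  exact h2 k l (h1 _ _)

end CoeffSystem

end SuperDeform
namespace SuperDeform

/-! ### Coefficients of formal sums of cochains. -/

section Sums

variable {B : Type v}

theorem coef_fsum [AddCommMonoid B] {ι : Type*} (F : ι → Cochain B) (I : Fin 3 →₀ ℕ) (j : Fin 3) :
    (fsum F).coef I j = ∑ᶠ i, (F i).coef I j := by
  unfold Cochain.coef
  split_ifs with h
  · rfl
  · rw [finsum_zero]

/-- The caller names the one index `k` that can contribute at the given place, and the condition `P`
under which it does. -/
theorem coef_fsum_phi [AddCommMonoid B] {ι : Type*} {m : ι → Fin 3 →₀ ℕ} (hm : ∀ i, IsMonomial (m i))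
    (x : ι → B) {I : Fin 3 →₀ ℕ} {j j' : Fin 3} (k : ι) (P : Prop) [Decidable P]
    (h : ∀ i, (I = m i ∧ j = j') ↔ (i = k ∧ P)) :
    (fsum fun i => phi (m i) j' (x i)).coef I j = if P then x k else 0 := by
  have hphi : ∀ i, (phi (m i) j' (x i)).coef I j = if I = m i ∧ j = j' then x i else 0 := fun i => by
    have hi := hm i
    rw [eq_mi (m i)] at hi ⊢
    exact coef_phi (isMonomial_mi.mp hi) I j' j (x i)
  rw [coef_fsum, finsum_eq_single _ k]
  · rw [hphi, if_congr ((h k).trans (and_iff_right rfl)) rfl rfl]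
  · intro i hi
    rw [hphi, if_neg fun h' => hi ((h i).mp h').1]

theorem finsum_eq_add [AddCommMonoid B] {ι : Type*} [DecidableEq ι] {f : ι → B} (x y : ι) (u w : B)
    (h : ∀ i, f i = (if i = x then u else 0) + (if i = y then w else 0)) : ∑ᶠ i, f i = u + w := by
  have hs : ∀ (x : ι) (u : B), (Function.support fun i => if i = x then u else 0).Finite :=
    fun x u => (Set.finite_singleton x).subset fun i hi => by
      by_contra hne
      exact hi (if_neg hne)
  have h1 : ∀ (x : ι) (u : B), (∑ᶠ i, if i = x then u else 0) = u := fun x u => by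
    rw [finsum_eq_single _ x fun i hi => if_neg hi, if_pos rfl]
  rw [finsum_congr h, finsum_add_distrib (hs x u) (hs y w), h1, h1]

theorem coef_fsum_delta_zero [AddCommMonoid B] (a : Param → B) (p q : ℕ) (j : Fin 3) :
    (fsum fun i => delta i (a i)).coef (mi 0 p q) j =
      if j = 0 then (if p = 0 ∧ q = 1 then a .t1 else 0) + (if p = 1 ∧ q = 0 then a .t2 else 0)
      else if j = 1 then (if 1 ≤ p ∧ q = 0 then a (.et (p - 1)) else 0)
      else if p = 0 ∧ 1 ≤ q then a (.th (q - 1)) else 0 := by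
  classical
  rw [coef_fsum]
  fin_cases j
  · refine finsum_eq_add .t1 .t2 _ _ fun i => ?_
    cases i <;> simp [delta, coef_phi, mi_inj]
  -- Only one class contributes here; the second slot is filled with `.t1` and the value zero. For
  -- `p = 0` the truncated index is irrelevant, as its value is zero as well.
  · refine (finsum_eq_add (.et (p - 1)) .t1 (if 1 ≤ p ∧ q = 0 then a (.et (p - 1)) else 0) 0
      fun i => ?_).trans (by simp)
    rcases i with _ | _ | n | n
    · simp [delta, coef_phi, mi_inj]
    · simp [delta, coef_phi, mi_inj]
    · simp [delta, coef_phi, mi_inj]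
    · by_cases h : p = n + 1 <;> by_cases hq : q = 0
      · subst h; simp [delta, coef_phi, mi_inj, hq]
      · simp [delta, coef_phi, mi_inj, hq]
      · by_cases hp : 1 ≤ p
        · have : n ≠ p - 1 := by omega
          simp [delta, coef_phi, mi_inj, h, this]
        · simp [delta, coef_phi, mi_inj, h, hp]
      · simp [delta, coef_phi, mi_inj, h, hq]
  · refine (finsum_eq_add (.th (q - 1)) .t1 (if p = 0 ∧ 1 ≤ q then a (.th (q - 1)) else 0) 0
      fun i => ?_).trans (by simp)
    rcases i with _ | _ | n | n
    · simp [delta, coef_phi, mi_inj]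
    · simp [delta, coef_phi, mi_inj]
    · by_cases h : q = n + 1 <;> by_cases hq : p = 0
      · subst h; simp [delta, coef_phi, mi_inj, hq]
      · simp [delta, coef_phi, mi_inj, hq]
      · by_cases hp : 1 ≤ q
        · have : n ≠ q - 1 := by omega
          simp [delta, coef_phi, mi_inj, h, this]
        · simp [delta, coef_phi, mi_inj, h, hp]
      · simp [delta, coef_phi, mi_inj, h, hq]
    · simp [delta, coef_phi, mi_inj]

theorem coef_fsum_delta_one [AddCommMonoid B] (a : Param → B) (p q : ℕ) (j : Fin 3) :
    (fsum fun i => delta i (a i)).coef (mi 1 p q) j =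
      if j = 0 then (if p = 0 then a (.th q) else 0) + (if q = 0 then a (.et p) else 0) else 0 := by
  classical
  rw [coef_fsum]
  fin_cases j
  · refine finsum_eq_add (.th q) (.et p) _ _ fun i => ?_
    rcases i with _ | _ | n | n
    · simp [delta, coef_phi, mi_inj]
    · simp [delta, coef_phi, mi_inj]
    · by_cases h : q = n
      · subst h; simp [delta, coef_phi, mi_inj]
      · simp [delta, coef_phi, mi_inj, h, Ne.symm h]
    · by_cases h : p = n
      · subst h; simp [delta, coef_phi, mi_inj]
      · simp [delta, coef_phi, mi_inj, h, Ne.symm h]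
  all_goals
    rw [finsum_eq_zero_of_forall_eq_zero]
    · simp
    · intro i
      cases i <;> simp [delta, coef_phi, mi_inj]

end Sums

/-! ### Class components and order of the family, and its identification with `d^∞`. -/

section Family

variable {K : Type u} [Field K] {B : Type v} [Ring B] [Algebra K B] {b : BaseData K B}

theorem mem_cochainsIn_mi {F : Submodule K B} {X : Cochain B}
    (h0 : ∀ p q j, X.coef (mi 0 p q) j ∈ F) (h1 : ∀ p q j, X.coef (mi 1 p q) j ∈ F) :
    X ∈ cochainsIn F := by
  refine mem_cochainsIn.mpr fun I j => ?_
  rw [eq_mi I]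
  rcases Nat.lt_or_ge (I 0) 2 with h | h
  · interval_cases I 0
    · exact h0 _ _ _
    · exact h1 _ _ _
  · rw [coef_of_two_le X h]
    exact F.zero_mem

namespace Values.IsSolution

variable {c : Values B} (hc : c.IsSolution b)
include hc

theorem normal_sub_dB : Normal (⊥ : Submodule K B) (c.family - dB B) where
  zero p q h := by
    rw [Submodule.mem_bot, coef_sub, hc.family_coef_zero, coef_dB, familyCoef, if_pos rfl,
      if_pos rfl, if_neg (show ¬(p = 0 ∧ q = 1) by omega), if_neg (show ¬(p = 1 ∧ q = 0) by omega)]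
    simp
  one p q := by
    rw [Submodule.mem_bot, coef_sub, hc.family_coef_zero, coef_dB, familyCoef]
    simp
  two p q := by
    rw [Submodule.mem_bot, coef_sub, coef_sub, hc.family_coef_zero, c.family_coef_one, coef_dB,
      coef_dB, familyCoef, familyCoef]
    simp

theorem harm_family (i : Param) : harm c.family i = c.a i := by
  cases i <;> simp only [harm, hc.family_coef_zero, c.family_coef_one, familyCoef] <;>
    simp

theorem sub_dB_mem {F : Submodule K B} (ha : ∀ i, c.a i ∈ F) (hr : ∀ k, c.r k ∈ F)
    (hs : ∀ k, c.s k ∈ F) (hy : ∀ k, c.y k ∈ F) (hu : ∀ k l, c.u k l ∈ F)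
    (hv : ∀ k l, c.v k l ∈ F) : c.family - dB B ∈ cochainsIn F := by
  have hite : ∀ (P : Prop) [Decidable P] (x : B), x ∈ F → (if P then x else 0) ∈ F :=
    fun P _ x hx => by split_ifs; exacts [hx, F.zero_mem]
  refine mem_cochainsIn_mi (fun p q j => ?_) (fun p q j => ?_)
  · rw [coef_sub, hc.family_coef_zero, coef_dB, familyCoef, if_pos rfl]
    fin_cases j
    · by_cases h : p = 1 ∧ q = 1
      · obtain ⟨rfl, rfl⟩ := h
        simp
      · have h' : ¬(0 = 0 ∧ p = 1 ∧ q = 1 ∧ (0 : Fin 3) = 0) := by tauto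
        simpa [h, h'] using add_mem (hite (p = 0 ∧ q = 1) _ (ha .t1))
          (hite (p = 1 ∧ q = 0) _ (ha .t2))
    · simpa using add_mem (hite (1 ≤ p ∧ q = 0) _ (ha (.et (p - 1)))) (hite (p = 0) _ (hy q))
    · simpa using add_mem (add_mem (hite (p = 0 ∧ 1 ≤ q) _ (ha (.th (q - 1))))
        (hite (q = 1) _ (hr p))) (hite (p = 0) _ (hs q))
  · rw [coef_sub, c.family_coef_one, coef_dB, familyCoef, if_neg one_ne_zero,
      if_neg (show ¬(1 = 0 ∧ p = 1 ∧ q = 1 ∧ j = 0) by omega), sub_zero]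
    fin_cases j
    · exact add_mem (hite (p = 0) _ (ha (.th q))) (hite (q = 0) _ (ha (.et p)))
    · exact hu p q
    · exact hv p q

end Values.IsSolution

end Family

namespace CoeffSystem

variable {K : Type u} [Field K] (c : CoeffSystem K)

theorem dInf_eq_family [CharZero K] : c.dInf = (c.values (quotMk c.relations)).family := by
  have hr : ∀ a p q j, (fsum (fun k : ℕ => phi (mi 0 (k + 1) 1) 2
      (quotMk c.relations (c.r (k + 1))))).coef (mi a p q) j =
      if a = 0 ∧ 1 ≤ p ∧ q = 1 ∧ j = 2 then quotMk c.relations (c.r (p - 1 + 1)) else 0 :=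
    fun a p q j => coef_fsum_phi (fun i => isMonomial_mi.mpr (by omega)) _ _ _ fun i => by
      rw [mi_inj]; omega
  have hs : ∀ a p q j, (fsum (fun k : ℕ => phi (mi 0 0 (k + 1)) 2
      (quotMk c.relations (c.s (k + 1))))).coef (mi a p q) j =
      if a = 0 ∧ p = 0 ∧ 1 ≤ q ∧ j = 2 then quotMk c.relations (c.s (q - 1 + 1)) else 0 :=
    fun a p q j => coef_fsum_phi (fun i => isMonomial_mi.mpr (by omega)) _ _ _ fun i => by
      rw [mi_inj]; omega
  have hy : ∀ a p q j, (fsum (fun k : ℕ => phi (mi 0 0 (k + 1)) 1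
      (quotMk c.relations (c.y (k + 1))))).coef (mi a p q) j =
      if a = 0 ∧ p = 0 ∧ 1 ≤ q ∧ j = 1 then quotMk c.relations (c.y (q - 1 + 1)) else 0 :=
    fun a p q j => coef_fsum_phi (fun i => isMonomial_mi.mpr (by omega)) _ _ _ fun i => by
      rw [mi_inj]; omega
  have hu : ∀ a p q j, (fsum (fun kl : ℕ × ℕ => phi (mi 1 kl.1 kl.2) 1
      (quotMk c.relations (c.u kl.1 kl.2)))).coef (mi a p q) j =
      if a = 1 ∧ j = 1 then quotMk c.relations (c.u p q) else 0 :=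
    fun a p q j => coef_fsum_phi (fun i => isMonomial_mi.mpr (by omega)) _ (p, q) _ fun i => by
      rw [mi_inj, Prod.ext_iff]; grind
  have hv : ∀ a p q j, (fsum (fun kl : ℕ × ℕ => phi (mi 1 kl.1 kl.2) 2
      (quotMk c.relations (c.v kl.1 kl.2)))).coef (mi a p q) j =
      if a = 1 ∧ j = 2 then quotMk c.relations (c.v p q) else 0 :=
    fun a p q j => coef_fsum_phi (fun i => isMonomial_mi.mpr (by omega)) _ (p, q) _ fun i => by
      rw [mi_inj, Prod.ext_iff]; grind
  have hsol : (c.values (quotMk c.relations)).IsSolution c.base :=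
    c.values_isSolution fun x => rfl
  refine cochain_ext (fun p q j => ?_) (fun p q j => ?_)
  · rw [hsol.family_coef_zero, dInf]
    simp only [coef_add, hr, hs, hy, hu, hv, coef_fsum_delta_zero]
    rw [coef_phi (by omega), Values.familyCoef, if_pos rfl]
    simp only [mi_inj]
    fin_cases j
    · simp [values, add_assoc]
    · rcases q with _ | q
      · simp [values, c.y_zero]
      · simp [values]
    · rcases q with _ | q
      · simp [values, c.s_zero]
      · rcases p with _ | p
        · simp [values, c.r_zero]
        · simp [values]
  · rw [Values.family_coef_one, dInf]
    simp only [coef_add, hr, hs, hy, hu, hv, coef_fsum_delta_one]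
    rw [coef_phi (by omega), Values.familyCoef, if_neg one_ne_zero]
    simp only [mi_inj]
    fin_cases j <;> simp [values]

end CoeffSystem

end SuperDeform
namespace SuperDeform

open PowerSeries

/-! ### Evaluation of formal power series and descent to quotients. -/

section Evaluation

variable {K : Type u} [Field K] {B : Type v} [Ring B] [Algebra K B] {b : BaseData K B}

/-- Values for the parameters at which formal power series can be evaluated. -/
structure IsPoint (b : BaseData K B) (a : Param → B) : Prop where
  mem : ∀ i, a i ∈ b.fil 1
  inv : ∀ i, b.inv (a i) = (-1) ^ i.parity * a i

namespace IsPoint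

variable {a : Param → B} (hb : b.IsFormal) (ha : IsPoint b a)
include hb ha

theorem swap (x y : Param) : a x * a y = (-1) ^ (x.parity * y.parity) * (a y * a x) := by
  have hx := ha.inv x
  have hy := ha.inv y
  cases x <;> cases y <;>
    simp only [Param.parity, pow_zero, pow_one, one_mul, mul_zero, mul_one, neg_mul] at hx hy ⊢
  all_goals first
    | exact hb.even_comm _ _ hx
    | exact (hb.even_comm _ _ hy).symm
    | exact hb.odd_anticomm _ _ hx hy

/-- Evaluation of polynomials. -/
noncomputable def poly : SuperPoly K →ₐ[K] B := polyLift a (ha.swap hb)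

theorem poly_gen (i : Param) : ha.poly hb (polyGen K i) = a i := polyLift_gen K _ _ i

theorem poly_mem {n : ℕ} {x : SuperPoly K} (hx : x ∈ polySpan K ^ n) :
    ha.poly hb x ∈ b.fil n := by
  have h1 : (polySpan K).map (ha.poly hb).toLinearMap ≤ b.fil 1 := by
    rw [polySpan, Submodule.map_span, Submodule.span_le]
    rintro _ ⟨_, ⟨y, rfl⟩, rfl⟩
    rw [AlgHom.toLinearMap_apply, poly_gen]
    exact ha.mem y
  have h2 : ∀ n, (polySpan K ^ n).map (ha.poly hb).toLinearMap ≤ b.fil n := by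
    intro n
    induction n with
    | zero => rw [hb.fil_zero]; exact le_top
    | succ n ih =>
      rw [pow_succ, Submodule.map_mul]
      exact Submodule.mul_le.mpr fun x hx y hy => hb.mul_mem (ih hx) (h1 hy)
  exact h2 n ⟨x, hx, rfl⟩

theorem poly_inv (x : SuperPoly K) : ha.poly hb (polyInv K x) = b.inv (ha.poly hb x) := by
  have h : (ha.poly hb).comp (polyInv K) = b.inv.comp (ha.poly hb) := poly_hom_ext K fun i => by
    rw [AlgHom.comp_apply, AlgHom.comp_apply, polyInv_gen, map_mul, map_pow, map_neg, map_one,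
      poly_gen, ha.inv]
  exact DFunLike.congr_fun h x

/-- The partial sums of the evaluation of a formal power series. -/
noncomputable def partialSum (n : ℕ) (f : SuperSeries K) : B :=
  ∑ i ∈ Finset.range n, ha.poly hb (coeff i f.1)

theorem exists_limit (f : SuperSeries K) : ∃ x, ∀ n, x - ha.partialSum hb n f ∈ b.fil n :=
  hb.complete (fun n => ha.partialSum hb n f) fun n => by
    rw [partialSum, partialSum, Finset.sum_range_succ, add_sub_cancel_left]
    exact ha.poly_mem hb (f.2 n)

/-- The value of a formal power series. -/
noncomputable def value (f : SuperSeries K) : B := (ha.exists_limit hb f).choose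

theorem value_sub_mem (f : SuperSeries K) (n : ℕ) :
    ha.value hb f - ha.partialSum hb n f ∈ b.fil n := (ha.exists_limit hb f).choose_spec n

/-- Limits are unique by separatedness; this characterization makes the chosen value additive and
multiplicative. -/
theorem value_eq {f : SuperSeries K} {x : B} (h : ∀ n, x - ha.partialSum hb n f ∈ b.fil n) :
    ha.value hb f = x := by
  refine sub_eq_zero.mp (hb.separated _ fun n => ?_)
  rw [← sub_sub_sub_cancel_right _ _ (ha.partialSum hb n f)]
  exact sub_mem (ha.value_sub_mem hb f n) (h n)

theorem value_algebraMap (c : K) :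
    ha.value hb (algebraMap K (SuperSeries K) c) = algebraMap K B c := by
  refine ha.value_eq hb fun n => ?_
  cases n with
  | zero => exact hb.mem_zero _
  | succ n =>
    have h : ∀ i, coeff i (algebraMap K (SuperSeries K) c).1 =
        if i = 0 then algebraMap K (SuperPoly K) c else 0 := fun i => by
      change coeff i (algebraMap K (PowerSeries (SuperPoly K)) c) = _
      rw [Algebra.algebraMap_eq_smul_one, coeff_smul, coeff_one, Algebra.algebraMap_eq_smul_one,
        smul_ite, smul_zero]
    rw [partialSum, Finset.sum_eq_single 0, h, if_pos rfl, AlgHom.commutes, sub_self]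
    · exact zero_mem _
    · intro i _ hi
      rw [h, if_neg hi, map_zero]
    · intro h0
      exact absurd (Finset.mem_range.mpr n.succ_pos) h0

theorem value_add (f g : SuperSeries K) :
    ha.value hb (f + g) = ha.value hb f + ha.value hb g := by
  refine ha.value_eq hb fun n => ?_
  have h : ha.partialSum hb n (f + g) = ha.partialSum hb n f + ha.partialSum hb n g := by
    rw [partialSum, partialSum, partialSum, ← Finset.sum_add_distrib]
    refine Finset.sum_congr rfl fun i _ => ?_
    rw [← map_add, ← map_add]
    rfl
  rw [h, add_sub_add_comm]
  exact add_mem (ha.value_sub_mem hb f n) (ha.value_sub_mem hb g n)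

theorem value_mul (f g : SuperSeries K) :
    ha.value hb (f * g) = ha.value hb f * ha.value hb g := by
  refine ha.value_eq hb fun n => ?_
  have h1 : ha.partialSum hb n f * ha.partialSum hb n g - ha.partialSum hb n (f * g) ∈
      b.fil n := by
    have h := sum_range_sub_sum_antidiagonal_mem (b.fil n).toAddSubgroup n
      (fun i j => ha.poly hb (coeff i f.1) * ha.poly hb (coeff j g.1)) fun i j hij =>
        hb.fil_anti hij (hb.mul_mem (ha.poly_mem hb (f.2 i)) (ha.poly_mem hb (g.2 j)))
    have hfg : ha.partialSum hb n (f * g) = ∑ m ∈ Finset.range n,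
        ∑ kl ∈ Finset.HasAntidiagonal.antidiagonal m,
          ha.poly hb (coeff kl.1 f.1) * ha.poly hb (coeff kl.2 g.1) := by
      refine Finset.sum_congr rfl fun m _ => ?_
      change ha.poly hb (coeff m (f.1 * g.1)) = _
      rw [coeff_mul, map_sum]
      exact Finset.sum_congr rfl fun _ _ => map_mul _ _ _
    rw [hfg, partialSum, partialSum, Finset.sum_mul_sum]
    exact h
  have h2 : ha.value hb f * (ha.value hb g - ha.partialSum hb n g) ∈ b.fil n := by
    have := hb.mul_mem (hb.mem_zero (ha.value hb f)) (ha.value_sub_mem hb g n)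
    rwa [zero_add] at this
  have h3 : (ha.value hb f - ha.partialSum hb n f) * ha.partialSum hb n g ∈ b.fil n :=
    hb.mul_mem (ha.value_sub_mem hb f n) (hb.mem_zero (ha.partialSum hb n g))
  have := add_mem (add_mem h2 h3) h1
  rwa [mul_sub, sub_mul, sub_add_sub_cancel, sub_add_sub_cancel] at this

/-- Evaluation of formal power series. -/
noncomputable def eval : SuperSeries K →ₐ[K] B where
  toFun := ha.value hb
  map_one' := by rw [← map_one (algebraMap K _), value_algebraMap, map_one]
  map_mul' := ha.value_mul hb
  map_zero' := by rw [← map_zero (algebraMap K _), value_algebraMap, map_zero]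
  map_add' := ha.value_add hb
  commutes' := ha.value_algebraMap hb

theorem eval_gen (i : Param) : ha.eval hb (gen K i) = a i := by
  refine ha.value_eq hb fun n => ?_
  rcases Nat.lt_or_ge 1 n with h | h
  · rw [partialSum, Finset.sum_eq_single 1, coeff_gen, if_pos rfl, poly_gen, sub_self]
    · exact zero_mem _
    · intro j _ hj
      rw [coeff_gen, if_neg hj, map_zero]
    · intro h1
      exact absurd (Finset.mem_range.mpr h) h1
  · rw [partialSum, Finset.sum_eq_zero, sub_zero]
    · exact hb.fil_anti h (ha.mem i)
    · intro j hj
      rw [coeff_gen, if_neg (by have := Finset.mem_range.mp hj; omega), map_zero]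

theorem eval_mem {n : ℕ} {f : SuperSeries K} (hf : f ∈ (seriesBase K).fil n) :
    ha.eval hb f ∈ b.fil n := by
  have h := ha.value_sub_mem hb f n
  rwa [partialSum, Finset.sum_eq_zero, sub_zero] at h
  intro i hi
  rw [hf i (Finset.mem_range.mp hi), map_zero]

theorem eval_inv (f : SuperSeries K) :
    ha.eval hb ((seriesBase K).inv f) = b.inv (ha.eval hb f) := by
  refine ha.value_eq hb fun n => ?_
  have h : ha.partialSum hb n ((seriesBase K).inv f) = b.inv (ha.partialSum hb n f) := by
    rw [partialSum, partialSum, map_sum]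
    refine Finset.sum_congr rfl fun i _ => ?_
    rw [seriesInv_coe, coeff_map, ← poly_inv]
    rfl
  rw [h, ← map_sub]
  exact hb.fil_inv n _ (ha.value_sub_mem hb f n)

theorem aug_eval (f : SuperSeries K) : b.aug (ha.eval hb f) = (seriesBase K).aug f := by
  have h : f - algebraMap K _ ((seriesBase K).aug f) ∈ (seriesBase K).fil 1 := by
    rw [series_maxIdeal]
    change (seriesBase K).aug _ = 0
    rw [map_sub, AlgHom.commutes]
    exact sub_self _
  have h1 := ha.eval_mem hb h
  rw [hb.fil_one] at h1
  change b.aug _ = 0 at h1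
  rwa [map_sub, map_sub, AlgHom.commutes, AlgHom.commutes, sub_eq_zero] at h1

/-- The kernel of evaluation is a graded ideal, and it is closed because the target is separated;
hence it contains the closed graded ideal as soon as it contains the generators. -/
theorem exists_baseHom {S : Set (SuperSeries K)} (hS : ∀ x ∈ S, (seriesBase K).aug x = 0)
    (h : ∀ x ∈ S, ha.eval hb x = 0) : ∃ f : QuotRing S →ₐ[K] B,
      IsBaseHom (quotBase S hS) b f ∧ f.comp (quotMk S) = ha.eval hb := by
  have hker : ∀ x ∈ relIdeal S, ha.eval hb x = 0 := by
    intro x hx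
    rw [relIdeal, TwoSidedIdeal.mem_sInf] at hx
    refine (TwoSidedIdeal.mem_ker _).mp (hx (TwoSidedIdeal.ker (ha.eval hb))
      ⟨fun y hy => ?_, fun y hy => ?_, fun y hy => ?_⟩)
    · exact (TwoSidedIdeal.mem_ker _).mpr (h y hy)
    · rw [TwoSidedIdeal.mem_ker] at hy ⊢
      rw [eval_inv, hy, map_zero]
    · refine (TwoSidedIdeal.mem_ker _).mpr (hb.separated _ fun n => ?_)
      obtain ⟨z, hz, hyz⟩ := hy n
      have h1 := ha.eval_mem hb hyz
      rwa [map_sub, (TwoSidedIdeal.mem_ker _).mp hz, sub_zero] at h1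
  let f : QuotRing S →ₐ[K] B := RingCon.liftₐ _ (ha.eval hb) <| by
    intro x y hxy
    rw [TwoSidedIdeal.rel_iff] at hxy
    have := hker _ hxy
    rw [map_sub] at this
    exact sub_eq_zero.mp this
  refine ⟨f, ⟨fun y => ?_, fun y => ?_, ?_⟩, AlgHom.ext fun _ => rfl⟩
  · obtain ⟨x, rfl⟩ := quotMk_surjective y
    exact ha.eval_inv hb x
  · obtain ⟨x, rfl⟩ := quotMk_surjective y
    exact ha.aug_eval hb x
  · rintro n _ ⟨x, hx, rfl⟩
    exact ha.eval_mem hb hx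

end IsPoint

/-- Modulo order two a series is a constant plus a finite linear combination of parameters, because
its linear term is a polynomial. -/
theorem quotHom_ext {S : Set (SuperSeries K)} {f g : QuotRing S →ₐ[K] B}
    (hf : ∀ x ∈ (seriesBase K).fil 2, f (quotMk S x) = 0)
    (hg : ∀ x ∈ (seriesBase K).fil 2, g (quotMk S x) = 0)
    (h : ∀ i, f (quotMk S (gen K i)) = g (quotMk S (gen K i))) : f = g := by
  refine AlgHom.ext fun y => ?_
  obtain ⟨x, rfl⟩ := quotMk_surjective y
  have h1 : ∀ z ∈ polySpan K, ∃ w ∈ (seriesBase K).fil 1, coeff 1 w.1 = z ∧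
      f (quotMk S w) = g (quotMk S w) := by
    intro z hz
    induction hz using Submodule.span_induction with
    | mem z hz =>
      obtain ⟨i, rfl⟩ := hz
      exact ⟨gen K i, gen_mem_fil i, by rw [coeff_gen, if_pos rfl], h i⟩
    | zero => exact ⟨0, zero_mem _, by simp, by simp only [map_zero]⟩
    | add z z' _ _ h h' =>
      obtain ⟨w, hw, rfl, hw'⟩ := h
      obtain ⟨x, hx, rfl, hx'⟩ := h'
      exact ⟨w + x, add_mem hw hx, map_add _ _ _, by simp only [map_add, hw', hx']⟩
    | smul c z _ h =>
      obtain ⟨w, hw, rfl, hw'⟩ := h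
      exact ⟨c • w, Submodule.smul_mem _ _ hw, coeff_smul _ _ _, by simp only [map_smul, hw']⟩
  set c := (seriesBase K).aug x with hc
  have h0 : x - algebraMap K _ c ∈ (seriesBase K).fil 1 := by
    rw [series_maxIdeal]
    change (seriesBase K).aug _ = 0
    rw [map_sub, AlgHom.commutes]
    exact sub_self _
  have hx1 := (x - algebraMap K _ c).2 1
  rw [pow_one] at hx1
  obtain ⟨w, hw, hw1, hw2⟩ := h1 _ hx1
  have h2 : x - algebraMap K _ c - w ∈ (seriesBase K).fil 2 := by
    intro i hi
    change coeff i ((x - algebraMap K _ c).1 - w.1) = 0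
    rw [map_sub]
    interval_cases i
    · rw [h0 0 one_pos, hw 0 one_pos, sub_zero]
    · rw [hw1, sub_self]
  have hf2 := hf _ h2
  have hg2 := hg _ h2
  simp only [map_sub, AlgHom.commutes] at hf2 hg2
  rw [sub_sub, sub_eq_zero] at hf2 hg2
  rw [hf2, hg2, hw2]

end Evaluation

end SuperDeform
namespace SuperDeform

/-! ### Decomposition of cocycles over an arbitrary base. -/

section Cohomology

variable {K : Type u} [Field K] {B : Type v} [Ring B] [Algebra K B] (b : BaseData K B)

/-- Verified on coefficients rather than through the bracket, so that the base need not be formal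
and the ground field can be used directly. -/
theorem cob_cob (X : Cochain B) : cob b (cob b X) = 0 := by
  refine cochain_ext (fun p q j => ?_) (fun p q j => ?_)
  · rw [coef_zero]
    by_cases hj : j = 0
    · subst hj
      rw [cob_coef_zero_zero, cob_coef_one_zero, cob_coef_zero b X _ _ one_ne_zero,
        cob_coef_zero b X _ _ (j := 2) (by decide)]
      rcases p with _ | p
      · simp
      · rcases q with _ | q
        · simp
        · simp [map_add]
    · rw [cob_coef_zero b _ _ _ hj, cob_coef_one b X _ _ hj, ite_self, map_zero]
  · rw [coef_zero]
    by_cases hj : j = 0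
    · subst hj
      rw [cob_coef_one_zero, cob_coef_one b X _ _ one_ne_zero,
        cob_coef_one b X _ _ (j := 2) (by decide), ite_self, ite_self, add_zero, map_zero]
    · rw [cob_coef_one b _ _ _ hj]

theorem cob_fsum_delta (a : Param → B) : cob b (fsum fun i => delta i (a i)) = 0 := by
  refine cochain_ext (fun p q j => ?_) (fun p q j => ?_)
  · rw [coef_zero]
    by_cases hj : j = 0
    · subst hj
      rw [cob_coef_zero_zero]
      simp only [coef_fsum_delta_zero, coef_fsum_delta_one]
      rcases p with _ | p
      · simp
      · rcases q with _ | q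
        · simp
        · simp [add_comm]
    · rw [cob_coef_zero b _ _ _ hj, coef_fsum_delta_one, if_neg hj, ite_self, map_zero]
  · rw [coef_zero]
    by_cases hj : j = 0
    · subst hj
      rw [cob_coef_one_zero]
      simp [coef_fsum_delta_one]
    · rw [cob_coef_one b _ _ _ hj]

theorem harm_fsum_delta (a : Param → B) (i : Param) :
    harm (fsum fun i => delta i (a i)) i = a i := by
  cases i <;> simp [harm, coef_fsum_delta_zero, coef_fsum_delta_one]

theorem normal_fsum_delta (a : Param → B) :
    Normal (⊥ : Submodule K B) (fsum fun i => delta i (a i)) where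
  zero p q h := by
    rw [Submodule.mem_bot, coef_fsum_delta_zero, if_pos rfl, if_neg (by omega), if_neg (by omega),
      add_zero]
  one p q := by simp [coef_fsum_delta_zero]
  two p q := by simp [coef_fsum_delta_zero, coef_fsum_delta_one]

theorem delta_zero (i : Param) : delta i (0 : B) = 0 := by
  have h : ∀ I j, phi I j (0 : B) = 0 := fun I j => by
    funext M k
    exact ite_self _
  cases i <;> simp [delta, h]

theorem fsum_delta_finsupp (a : Param →₀ B) :
    (fsum fun i => delta i (a i)) = a.sum fun i x => delta i x := by
  funext M j
  rw [fsum, Finsupp.sum, Finset.sum_apply, Finset.sum_apply]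
  refine finsum_eq_sum_of_support_subset _ fun i hi => ?_
  rw [Finset.mem_coe, Finsupp.mem_support_iff]
  intro h
  exact hi (by change delta i (a i) M j = 0; rw [h, delta_zero]; rfl)

theorem fsum_delta_single [DecidableEq Param] (i : Param) (x : B) :
    (fsum fun k => delta k ((Finsupp.single i x) k)) = delta i x := by
  rw [fsum_delta_finsupp, Finsupp.sum_single_index (delta_zero i)]

/-- Once the homotopy term and the class components are removed, a normal cocycle without class
components remains; it vanishes by `Normal.mem_of_cob`. -/
theorem cocycle_eq (hinv : ∀ x, b.inv (b.inv x) = x) {z : Cochain B} (hz : cob b z = 0) :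
    z = fsum (fun i => delta i (harm z i)) + cob b (homotopy b z) := by
  have hN := normal_sub_cob_homotopy hinv z
  have h := (hN.sub (normal_fsum_delta (K := K) (harm z))).mem_of_cob hinv
    (fun x hx => by rw [(Submodule.mem_bot K).mp hx, map_zero]; exact zero_mem _)
    (fun i => by
      rw [harm_sub, harm_sub, harm_cob, harm_fsum_delta, sub_zero, sub_self]; exact zero_mem _)
    (by
      rw [map_sub, map_sub, hz, cob_cob, cob_fsum_delta, sub_zero, sub_zero]
      exact normal_of_mem (zero_mem _))
  have h0 : z - cob b (homotopy b z) - (fsum fun i => delta i (harm z i)) = 0 := by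
    funext M j
    exact (Submodule.mem_bot K).mp (h M j)
  rw [sub_sub, sub_eq_zero] at h0
  rwa [add_comm]

/-- The uniqueness half: the class components kill coboundaries and are dual to the representatives.
-/
theorem harm_eq_of_eq {z w : Cochain B} {a : Param → B}
    (h : z = fsum (fun i => delta i (a i)) + cob b w) : harm z = a := by
  funext i
  rw [h, harm_add, harm_cob, add_zero, harm_fsum_delta]

end Cohomology

/-! ### Cohomology over the ground field, with degrees. -/

section Ground

variable {K : Type u} [Field K]

theorem isHomogeneous_iff {n : ℕ} {z : Cochain K} :
    IsHomogeneous n z ↔ ∀ a p q j, z.coef (mi a p q) j ≠ 0 → a + p + q = n := by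
  constructor
  · intro h a p q j hne
    by_cases hm : IsMonomial (mi a p q)
    · have h1 := h ⟨_, hm⟩ j (by rwa [← coef_val z ⟨_, hm⟩ j])
      simpa [deg] using h1
    · exact absurd (coef_of_not z hm j) hne
  · intro h M j hne
    refine h (M.1 0) (M.1 1) (M.1 2) j ?_
    rwa [← eq_mi, coef_val]

theorem IsHomogeneous.harm {n : ℕ} {z : Cochain K} (h : IsHomogeneous n z) {i : Param}
    (hi : harm z i ≠ 0) : i.classDeg = n := by
  rw [isHomogeneous_iff] at h
  cases i with
  | t1 => exact h 0 0 1 0 hi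
  | t2 => exact h 0 1 0 0 hi
  | th m =>
    by_cases h0 : z.coef (mi 1 0 m) 0 = 0
    · have h1 : z.coef (mi 0 1 m) 1 ≠ 0 := fun h1 => hi (by
        change z.coef (mi 1 0 m) 0 - z.coef (mi 0 1 m) 1 = 0
        rw [h0, h1, sub_zero])
      have := h _ _ _ _ h1
      simp only [Param.classDeg]
      omega
    · have := h _ _ _ _ h0
      simp only [Param.classDeg]
      omega
  | et m =>
    have := h 0 (m + 1) 0 1 hi
    simp only [Param.classDeg]
    omega

/-- Since `d` is quadratic, the coboundary raises the degree by one and the homotopy lowers it by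
one, so primitives stay homogeneous. -/
theorem IsHomogeneous.homotopy {n : ℕ} {z : Cochain K} (h : IsHomogeneous (n + 1) z) :
    IsHomogeneous n (homotopy (groundBase K) z) := by
  rw [isHomogeneous_iff] at h ⊢
  have h' : ∀ a p q j, a + p + q ≠ n + 1 → z.coef (mi a p q) j = 0 := fun a p q j hne => by
    by_contra h0
    exact hne (h a p q j h0)
  intro a p q j hne
  by_contra hdeg
  refine hne ?_
  by_cases hm : IsMonomial (mi a p q)
  · obtain ⟨ha, hpos⟩ := isMonomial_mi.mp hm
    rw [homotopy_coef z ha hpos, ← map_zero (groundBase K).inv]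
    congr 1
    split_ifs with h1 h2 h3 h2 h3
    · exact h' _ _ _ _ (by omega)
    · rw [h' _ _ _ _ (by omega), h' _ _ _ _ (by omega), sub_zero]
    · rfl
    · rw [h' _ _ _ _ (by omega), neg_zero]
    · rw [h' _ _ _ _ (by omega), neg_zero]
    · rfl
  · exact coef_of_not _ hm j

theorem finite_classDeg (n : ℕ) : {i : Param | i.classDeg = n}.Finite := by
  refine (Set.toFinite {Param.t1, Param.t2, Param.th (n - 1), Param.et (n - 1)}).subset ?_
  rintro (_ | _ | m | m) h
  · simp
  · simp
  · have : n = m + 1 := h.symm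
    simp [this]
  · have : n = m + 1 := h.symm
    simp [this]

variable [CharZero K]

theorem coboundary_eq (z : Cochain K) : coboundary K z = cob (groundBase K) z :=
  bracket_odd_right (b := groundBase K) z isOdd_dB

theorem isCodifferential_d011 : IsCodifferential (groundBase K) (d011 K) :=
  isCodifferential_iff.mpr ⟨isOdd_dB, comp_dB_dB⟩

theorem coboundary_delta (i : Param) : coboundary K (delta i 1) = 0 := by
  classical
  rw [coboundary_eq, ← fsum_delta_single (B := K) i 1, cob_fsum_delta (groundBase K)]

theorem homogeneous_cohomology (n : ℕ) (z : Cochain K) (hn : IsHomogeneous (n + 1) z)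
    (hz : coboundary K z = 0) :
    ∃! a : Param →₀ K, (∀ i, a i ≠ 0 → i.classDeg = n + 1) ∧
      ∃ w : Cochain K, IsHomogeneous n w ∧
        z = (a.sum fun i x => delta i x) + coboundary K w := by
  rw [coboundary_eq] at hz
  have hfin : (Function.support (harm z)).Finite :=
    (finite_classDeg (n + 1)).subset fun i hi => hn.harm hi
  refine ⟨Finsupp.ofSupportFinite (harm z) hfin, ⟨fun i hi => hn.harm hi, homotopy (groundBase K) z,
    hn.homotopy, ?_⟩, ?_⟩
  · rw [coboundary_eq, ← fsum_delta_finsupp]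
    exact cocycle_eq (groundBase K) (fun _ => rfl) hz
  · rintro a ⟨-, w, -, hw⟩
    rw [coboundary_eq, ← fsum_delta_finsupp] at hw
    exact DFunLike.coe_injective (harm_eq_of_eq (groundBase K) hw).symm

theorem formal_cohomology (z : Cochain K) (hz : coboundary K z = 0) :
    ∃! a : Param → K, ∃ w : Cochain K,
      z = fsum (fun i => delta i (a i)) + coboundary K w := by
  rw [coboundary_eq] at hz
  refine ⟨harm z, ⟨homotopy (groundBase K) z, ?_⟩, ?_⟩
  · rw [coboundary_eq]
    exact cocycle_eq (groundBase K) (fun _ => rfl) hz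
  · rintro a ⟨w, hw⟩
    rw [coboundary_eq] at hw
    exact (harm_eq_of_eq (groundBase K) hw).symm

end Ground

/-! ### Miniversality of `d^∞`. -/

section Miniversal

variable {K : Type u} [Field K] {B : Type v} [Ring B] [Algebra K B] {b : BaseData K B}

theorem aug_dB (M : MIdx) (j : Fin 3) : b.aug (dB B M j) = d011 K M j := by
  rw [dB, d011, phi, phi, apply_ite b.aug, map_one, map_zero]

theorem sub_dB_mem_iff (hb : b.IsFormal) {X : Cochain B} :
    X - dB B ∈ cochainsIn (b.fil 1) ↔ ∀ M j, b.aug (X M j) = d011 K M j := by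
  refine forall_congr' fun M => forall_congr' fun j => ?_
  rw [hb.fil_one, ← aug_dB (b := b), ← sub_eq_zero, ← map_sub]
  rfl

/-- The classes of `t¹`, `t²` are odd cochains and those of `θⁿ`, `ηⁿ` are even, so the components
of an odd `Z` have the parity of the parameters; they lie in the maximal ideal because `d` has no
class components. -/
theorem isPoint_harm {Z : Cochain B} (hZ : IsOdd b Z)
    (hZ1 : Z - dB B ∈ cochainsIn (b.fil 1)) : IsPoint b (harm Z) where
  mem i := by
    have h : harm Z i = harm (Z - dB B) i := by
      rw [harm_sub]
      cases i <;> simp [harm, coef_dB]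
    rw [h]
    have h1 := mem_cochainsIn.mp hZ1
    cases i with
    | t1 => exact h1 _ _
    | t2 => exact h1 _ _
    | th n => exact sub_mem (h1 _ _) (h1 _ _)
    | et n => exact h1 _ _
  inv i := by
    cases i with
    | t1 => simpa [harm, Param.parity] using hZ.coef 0 0 1 0
    | t2 => simpa [harm, Param.parity] using hZ.coef 0 1 0 0
    | th n =>
      have h1 := hZ.coef 1 0 n 0
      have h2 := hZ.coef 0 1 n 1
      simp at h1 h2
      simp [harm, Param.parity, h1, h2]
      abel
    | et n => simpa [harm, Param.parity] using hZ.coef 0 (n + 1) 0 1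

/-- As `m ^ 2 = 0`, the filtration is constant from `fil 2` on, hence zero by separatedness. -/
theorem BaseData.IsInfinitesimal.eq_zero (hb : b.IsInfinitesimal) {x : B} (hx : x ∈ b.fil 2) : x = 0 := by
  have hpow : ∀ n, b.maxIdeal ^ (n + 2) = ⊥ := by
    intro n
    rw [pow_add, pow_two, show b.maxIdeal * b.maxIdeal = ⊥ from ?_, Submodule.mul_bot]
    rw [eq_bot_iff, Submodule.mul_le]
    exact fun x hx y hy => (Submodule.mem_bot K).mpr (hb.2 x hx y hy)
  have h : ∀ n, x ∈ b.fil (n + 2) := by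
    intro n
    induction n with
    | zero => exact hx
    | succ n ih =>
      rwa [hb.1.fil_eq, hpow, bot_sup_eq] at ih
  exact hb.1.separated x fun n => hb.1.fil_anti (Nat.le_add_right n 2) (h n)

namespace CoeffSystem

theorem pushforward_family (c : CoeffSystem K) {A : Type*} [Ring A] [Algebra K A]
    (g : SuperSeries K →ₐ[K] A) (f : A →ₐ[K] B) :
    pushforward f (c.values g).family = (c.values (f.comp g)).family := by
  funext M j
  simp only [pushforward, Values.family, Values.familyCoef, values, apply_ite f, map_add, map_zero,
    map_one, AlgHom.comp_apply]

variable [CharZero K] (c : CoeffSystem K)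

theorem harm_of_equivalent (hb : b.IsInfinitesimal) {f : c.BaseRing →ₐ[K] B}
    (hf : IsBaseHom c.base b f) {Y : Cochain B} (h : Equivalent b (pushforward f c.dInf) Y)
    (hX : pushforward f c.dInf - dB B ∈ cochainsIn (b.fil 1)) (i : Param) :
    harm Y i = f (quotMk c.relations (gen K i)) := by
  obtain ⟨φ, hφe, hφ, h⟩ := h
  rw [bracket_eq_ad hφe] at h
  have hφ1 : φ ∈ cochainsIn (b.fil 1) := fun M j => by rw [hb.1.fil_one]; exact hφ M j
  -- The exponential stops after the linear term, and there `d^∞` may be replaced by `d`; thus the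
  -- equivalence adds a coboundary, which the class components do not see.
  have h2 : Y = pushforward f c.dInf + ad b φ (pushforward f c.dInf) := by
    funext M j
    rw [← sub_eq_zero]
    have := hb.eq_zero (h 2 M j)
    simpa [Finset.sum_range_succ] using this
  have h3 : ad b φ (pushforward f c.dInf) = cob b φ := by
    rw [cob_even hφe, ← sub_eq_zero, ← map_sub]
    funext M j
    exact hb.eq_zero (ad_mem hb.1 hφ1 hX M j)
  have hsol : (c.values (f.comp (quotMk c.relations))).IsSolution b :=
    c.values_isSolution fun x => hf.map_inv (quotMk c.relations x)
  rw [h2, h3, harm_add, harm_cob, add_zero, dInf_eq_family, pushforward_family, hsol.harm_family]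
  rfl

theorem dInf_sub_dB_mem : c.dInf - dB c.BaseRing ∈ cochainsIn (c.base.fil 1) := by
  have h : ∀ x ∈ (seriesBase K).fil 1, quotMk c.relations x ∈ c.base.fil 1 :=
    fun x hx => ⟨x, hx, rfl⟩
  have h2 : ∀ x ∈ (seriesBase K).fil 2, quotMk c.relations x ∈ c.base.fil 1 :=
    fun x hx => h x (series_isFormal.fil_succ_le 1 hx)
  have hsol : (c.values (quotMk c.relations)).IsSolution c.base :=
    c.values_isSolution fun x => rfl
  rw [dInf_eq_family]
  exact hsol.sub_dB_mem (fun i => h _ (gen_mem_fil i)) (fun k => h2 _ (c.r_mem k))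
    (fun k => h2 _ (c.s_mem k)) (fun k => h2 _ (c.y_mem k)) (fun k l => h2 _ (c.u_mem k l))
    (fun k l => h2 _ (c.v_mem k l))

theorem base_isFormal : c.base.IsFormal := quotBase_isFormal c.aug_relations

theorem dInf_isDeformation : IsDeformation c.base (d011 K) c.dInf := by
  have hb := c.base_isFormal
  have hsol : (c.values (quotMk c.relations)).IsSolution c.base :=
    c.values_isSolution fun x => rfl
  have h1 := c.dInf_sub_dB_mem
  refine ⟨isCodifferential_iff.mpr ?_, (sub_dB_mem_iff hb).mp h1⟩
  rw [dInf_eq_family] at h1 ⊢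
  refine ⟨hsol.isOdd, comp_self_eq_zero hb hsol.isOdd h1 (hsol.normal_comp hb) fun i => ?_⟩
  rw [hsol.harm_comp hb]
  exact (c.rel_values_eq_zero_iff _).mpr
    (fun x hx => quotMk_eq_zero.mpr (subset_relIdeal hx)) i

theorem exists_equivalent (hb : b.IsFormal) {Y : Cochain B} (hY : IsDeformation b (d011 K) Y) :
    ∃ f : c.BaseRing →ₐ[K] B, IsBaseHom c.base b f ∧ Equivalent b (pushforward f c.dInf) Y := by
  obtain ⟨hYo, hYY⟩ := isCodifferential_iff.mp hY.1
  obtain ⟨φ, Z, hφe, hφ, hZ, hZ1, hZN, h⟩ := exists_normal hb hYo ((sub_dB_mem_iff hb).mpr hY.2)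
  have hZZ := comp_self_of_exp hb hφe hφ hZ hYY h
  have ha := isPoint_harm hZ hZ1
  have hsol : (c.values (ha.eval hb)).IsSolution b := c.values_isSolution (ha.eval_inv hb)
  have hle : ∀ x ∈ (seriesBase K).fil 2, ha.eval hb x ∈ b.fil 1 :=
    fun x hx => hb.fil_succ_le 1 (ha.eval_mem hb hx)
  -- The class components of `Z` are inserted for the parameters. The relations are not known at
  -- these values yet, so the square of the family is only known to be normal.
  have hZX : Z = (c.values (ha.eval hb)).family := by
    refine eq_of_normal hb hZ hsol.isOdd hZ1 ?_ hZN hsol.normal_sub_dB (fun i => ?_) ?_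
      (hsol.normal_comp hb)
    · exact hsol.sub_dB_mem (fun i => ha.eval_mem hb (gen_mem_fil i))
        (fun k => hle _ (c.r_mem k)) (fun k => hle _ (c.s_mem k)) (fun k => hle _ (c.y_mem k))
        (fun k l => hle _ (c.u_mem k l)) (fun k l => hle _ (c.v_mem k l))
    · rw [hsol.harm_family]
      exact (ha.eval_gen hb i).symm
    · rw [hZZ]
      exact normal_of_mem (zero_mem _)
  -- The relations are, up to sign, the class components of the square of the family, which now
  -- equals `Z ∘ Z = 0`.
  have hrel : ∀ x ∈ c.relations, ha.eval hb x = 0 := by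
    refine (c.rel_values_eq_zero_iff _).mp fun i => ?_
    rw [← hsol.harm_comp hb, ← hZX, hZZ]
    cases i <;> simp [harm]
  obtain ⟨f, hf, hfe⟩ := ha.exists_baseHom hb c.aug_relations hrel
  refine ⟨f, hf, φ, hφe, fun M j => ?_, fun n M j => ?_⟩
  · rw [← hb.fil_one]; exact hφ M j
  · rw [bracket_eq_ad hφe, dInf_eq_family, pushforward_family, hfe, ← hZX]
    exact h n M j

theorem isMiniversal : IsMiniversal.{u, v} c.base (d011 K) c.dInf where
  formal := c.base_isFormal
  deformation := c.dInf_isDeformation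
  versal B _ _ b hb Y hY := c.exists_equivalent hb hY
  unique B _ _ b hb Y hY f g hf hg hfY hgY := by
    have hfil : ∀ f : c.BaseRing →ₐ[K] B, IsBaseHom c.base b f →
        ∀ x ∈ (seriesBase K).fil 2, f (quotMk c.relations x) = 0 := fun f hf x hx =>
      hb.eq_zero (hf.map_fil 2 _ ⟨x, hx, rfl⟩)
    have hX : ∀ f : c.BaseRing →ₐ[K] B, IsBaseHom c.base b f →
        pushforward f c.dInf - dB B ∈ cochainsIn (b.fil 1) := fun f hf =>
      (sub_dB_mem_iff hb.1).mpr fun M j =>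
        (hf.map_aug _).trans ((sub_dB_mem_iff c.base_isFormal).mp c.dInf_sub_dB_mem M j)
    refine quotHom_ext (hfil f hf) (hfil g hg) fun i => ?_
    rw [← c.harm_of_equivalent hb hf hfY (hX f hf), ← c.harm_of_equivalent hb hg hgY (hX g hg)]

end CoeffSystem

end Miniversal

end SuperDeform

theorem mainTheorem3 {K : Type u} [Field K] [CharZero K] :
    (SuperDeform.IsCodifferential (SuperDeform.groundBase K) (SuperDeform.d011 K)) ∧
    (∀ i : SuperDeform.Param, SuperDeform.coboundary K (SuperDeform.delta i 1) = 0) ∧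
    (∀ (n : ℕ) (z : SuperDeform.Cochain K), SuperDeform.IsHomogeneous (n + 1) z →
      SuperDeform.coboundary K z = 0 →
      ∃! a : SuperDeform.Param →₀ K, (∀ i, a i ≠ 0 → i.classDeg = n + 1) ∧
        ∃ w : SuperDeform.Cochain K, SuperDeform.IsHomogeneous n w ∧
          z = (a.sum fun i x => SuperDeform.delta i x) + SuperDeform.coboundary K w) ∧
    (∀ z : SuperDeform.Cochain K, SuperDeform.coboundary K z = 0 →
      ∃! a : SuperDeform.Param → K, ∃ w : SuperDeform.Cochain K,
        z = SuperDeform.fsum (fun i => SuperDeform.delta i (a i)) +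
          SuperDeform.coboundary K w) ∧
    Nonempty (SuperDeform.CoeffSystem K) ∧
    Subsingleton (SuperDeform.CoeffSystem K) ∧
    ∀ c : SuperDeform.CoeffSystem K,
      SuperDeform.IsMiniversal.{u, v} c.base (SuperDeform.d011 K) c.dInf := by
  exact ⟨SuperDeform.isCodifferential_d011, SuperDeform.coboundary_delta,
    SuperDeform.homogeneous_cohomology, SuperDeform.formal_cohomology,
    SuperDeform.CoeffSystem.nonempty, SuperDeform.CoeffSystem.subsingleton,
    SuperDeform.CoeffSystem.isMiniversal⟩
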